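/- **Setting.** Let $x_0,\tau>0$ and, for $\rho,\sigma>0$, let $x_{i+1}=a_ix_i$ with $a_i=1+\rho\,e^{\sigma W_i-\frac12\sigma^2t_i}$, where $t_i=i\tau$ and $W_i=W(t_i)$ for a standard Brownian motion $W$ with $W(0)=0$. For $\rho,\beta>0$ let $$\lambda(\rho,\beta)=\lim_{n\to\infty}\frac1n\log\mathbb E[x_n],$$ where, for each $n$, $\sigma=\sigma_n$ is chosen so that $\frac12\sigma^2\tau n^2=\beta$. For measurable $f:[0,1]\to[0,1]$ put $$\Lambda_{\rho,\beta}[f]=\log\rho\int_0^1 f\,dx+\beta\int_0^1\Big(\int_x^1f(y)\,dy\Big)^2dx-\int_0^1I(f(x))\,dx,\qquad I(u)=u\log u+(1-u)\log(1-u),$$ and let $D(\rho,\beta)$ be the set of values $d=\int_0^1f\,dx$ over all maximizers $f$ of $\Lambda_{\rho,\beta}$. A point $(\rho,\beta)$ with $\rho,\beta>0$ is a *first-order transition point* if $\lambda$ is continuous there but $\partial\lambda/\partial\rho$ or $\partial\lambda/\partial\beta$ is discontinuous there (has no limit along the points where it exists). A function $\beta_{\rm cr}$ on an open set $J\subset(0,\infty)$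 is a *first-order transition curve* if its graph has an open neighbourhood $V\subset(0,\infty)^2$ in which the first-order transition points are exactly the points of the graph. For $\rho>0$ and $a>\log\rho$ let $F(a;\rho)=\int_{\log\rho}^a\big(\log\frac{1+e^a}{1+e^x}\big)^{-1/2}dx$, and let $$\rho_c=\sup\{\rho>0:\ \partial_aF(a;\rho)<0\text{ for some }a>\log\rho\}.$$ **Theorem (Clausius–Clapeyron relation).** The limit $\lambda(\rho,\beta)$ exists for all $\rho,\beta>0$. (i) Let $\beta_{\rm cr}:J\to(0,\infty)$ be a first-order transition curve. Then for every $\rho\in J$ the variational problem at $(\rho,\beta_{\rm cr}(\rho))$ has exactly two optimal values, $D(\rho,\beta_{\rm cr}(\rho))=\{d_1,d_2\}$ with $0<d_1<d_2<1$. At points tending to $(\rho,\beta_{\rm cr}(\rho))$ from strictly below the curve all optimal values tend to $d_1$, and from strictly above the curve they tend to $d_2$. Near $(\rho,\beta_{\rm cr}(\rho))$ and off the curve the first partial derivatives of $\lambda$ exist, and they have limits at $(\rho,\beta_{\rm cr}(\rho))$ from below the curve (denoted $|_{d_1}$) and from above it (denoted $|_{d_2}$). With $$\Delta\Big(\frac{\partial\lambda}{\partial\rho}\Big)=\frac{\partial\lambda}{\partial\rho}\Big|_{d_2}-\frac{\partial\lambda}{\partial\rho}\Big|_{d_1},\qquad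 \Delta\Big(\frac{\partial\lambda}{\partial\beta}\Big)=\frac{\partial\lambda}{\partial\beta}\Big|_{d_2}-\frac{\partial\lambda}{\partial\beta}\Big|_{d_1}\neq0,$$ the function $\beta_{\rm cr}$ is differentiable at $\rho$ and $$\frac{d\beta_{\rm cr}}{d\rho}=-\frac{\Delta(\partial\lambda/\partial\rho)}{\Delta(\partial\lambda/\partial\beta)}=-\frac{2}{\rho(d_1+d_2)}.$$ (ii) $\rho_c$ is finite and positive, there are first-order transition points $(\rho,\beta)$ with $\rho<\rho_c$ arbitrarily close to $\rho_c$, and the optimal values merge there: for every $\varepsilon>0$ there is $\delta>0$ such that $|d_2-d_1|<\varepsilon$ for all $d_1,d_2\in D(\rho,\beta)$ whenever $(\rho,\beta)$ is a first-order transition point with $|\rho-\rho_c|<\delta$. In particular $d_2-d_1\to0$ as $\rho\to\rho_c$ along a transition curve. -/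

import Mathlib

open Filter Topology MeasureTheory ProbabilityTheory Set

namespace LinRec

noncomputable section

/-! ### The random recursion and its Lyapunov exponent -/

/-- Law of the independent increments `V_j = W(t_{j+1}) - W(t_j)`, each `N(0, τ)`, of a standard
Brownian motion sampled at the times `t_j = j τ`. -/
def incrementLaw (τ : ℝ) : Measure (ℕ → ℝ) :=
  Measure.infinitePi (fun _ : ℕ => gaussianReal 0 τ.toNNReal)

/-- The Brownian motion at time `t_i`, as a function of its increments. -/
def walk (v : ℕ → ℝ) (i : ℕ) : ℝ := ∑ j ∈ Finset.range i, v j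

/-- The multiplier `a_i = 1 + ρ exp (σ W_i - σ² t_i / 2)`, with `t_i = i τ`. -/
def multiplier (τ ρ σ : ℝ) (v : ℕ → ℝ) (i : ℕ) : ℝ :=
  1 + ρ * Real.exp (σ * walk v i - σ ^ 2 * (i * τ) / 2)

/-- The process `x_{i+1} = a_i x_i` started at `x₀`. -/
def state (x₀ τ ρ σ : ℝ) (v : ℕ → ℝ) : ℕ → ℝ
  | 0 => x₀
  | i + 1 => multiplier τ ρ σ v i * state x₀ τ ρ σ v i

/-- The volatility `σ` for which `σ² τ n² / 2 = β`. -/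
def volatility (τ β : ℝ) (n : ℕ) : ℝ := Real.sqrt (2 * β / τ) / n

/-- `(1/n) log E[x_n]`, with `σ` tuned so that `σ² τ n² / 2 = β`. -/
def growthRate (x₀ τ ρ β : ℝ) (n : ℕ) : ℝ :=
  1 / (n : ℝ) * Real.log (∫ v, state x₀ τ ρ (volatility τ β n) v n ∂(incrementLaw τ))

/-- The Lyapunov exponent `λ(ρ, β) = lim (1/n) log E[x_n]` at fixed `β`. -/
def lyapunov (x₀ τ ρ β : ℝ) : ℝ := limUnder atTop (growthRate x₀ τ ρ β)

/-! ### The variational problem -/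

/-- `I(x) = x log x + (1 - x) log (1 - x)`. -/
def entropyI (x : ℝ) : ℝ := x * Real.log x + (1 - x) * Real.log (1 - x)

/-- Measurable functions `f : [0,1] → [0,1]` (values outside `[0,1]` are irrelevant). -/
def Admissible (f : ℝ → ℝ) : Prop :=
  Measurable f ∧ ∀ x ∈ Icc (0 : ℝ) 1, f x ∈ Icc (0 : ℝ) 1

/-- `Λ[f] = log ρ ∫ f + β ∫₀¹ (∫ₓ¹ f)² dx - ∫ I(f)`. -/
def functional (ρ β : ℝ) (f : ℝ → ℝ) : ℝ :=
  Real.log ρ * (∫ x in (0 : ℝ)..1, f x)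
    + β * (∫ x in (0 : ℝ)..1, (∫ y in x..1, f y) ^ 2)
    - ∫ x in (0 : ℝ)..1, entropyI (f x)

/-- `f` maximizes `Λ` among all admissible functions. -/
def IsOptimizer (ρ β : ℝ) (f : ℝ → ℝ) : Prop :=
  Admissible f ∧ ∀ g, Admissible g → functional ρ β g ≤ functional ρ β f

/-- The values `d = ∫₀¹ f` over all maximizers `f` of the variational problem. -/
def optimalDensities (ρ β : ℝ) : Set ℝ :=
  {d | ∃ f, IsOptimizer ρ β f ∧ ∫ x in (0 : ℝ)..1, f x = d}

/-! ### First-order phase transitions -/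

/-- Partial derivative with respect to the first argument. -/
def partialRho (L : ℝ → ℝ → ℝ) (p : ℝ × ℝ) : ℝ := deriv (fun r => L r p.2) p.1

/-- Partial derivative with respect to the second argument. -/
def partialBeta (L : ℝ → ℝ → ℝ) (p : ℝ × ℝ) : ℝ := deriv (fun b => L p.1 b) p.2

/-- `p` is a point of first-order phase transition of `L`: `L` is continuous at `p`, but one of its
first partial derivatives is discontinuous there, that is, it has no limit at `p` along the set of
points where it exists. -/
def FirstOrderTransition (L : ℝ → ℝ → ℝ) (p : ℝ × ℝ) : Prop :=
  ContinuousAt (fun q : ℝ × ℝ => L q.1 q.2) p ∧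
  ((¬ ∃ l, Tendsto (partialRho L)
      (𝓝[{q : ℝ × ℝ | DifferentiableAt ℝ (fun r => L r q.2) q.1}] p) (𝓝 l)) ∨
   (¬ ∃ l, Tendsto (partialBeta L)
      (𝓝[{q : ℝ × ℝ | DifferentiableAt ℝ (fun b => L q.1 b) q.2}] p) (𝓝 l)))

/-- Over the open set `J`, the graph of `βcr` is a first-order transition curve of `L`: the graph
has an open neighbourhood in the parameter quadrant in which the points of first-order phase
transition are exactly the points of the graph. -/
def IsTransitionCurve (L : ℝ → ℝ → ℝ) (J : Set ℝ) (βcr : ℝ → ℝ) : Prop :=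
  IsOpen J ∧ ∃ V : Set (ℝ × ℝ), IsOpen V ∧ V ⊆ Ioi 0 ×ˢ Ioi 0 ∧
    (∀ ρ ∈ J, (ρ, βcr ρ) ∈ V) ∧
    ∀ p ∈ V, FirstOrderTransition L p ↔ p.1 ∈ J ∧ p.2 = βcr p.1

/-- The filter of points tending to `(ρ, βcr ρ)` from strictly below the curve. -/
def belowCurve (βcr : ℝ → ℝ) (ρ : ℝ) : Filter (ℝ × ℝ) :=
  𝓝[{p : ℝ × ℝ | p.2 < βcr p.1}] (ρ, βcr ρ)

/-- The filter of points tending to `(ρ, βcr ρ)` from strictly above the curve. -/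
def aboveCurve (βcr : ℝ → ℝ) (ρ : ℝ) : Filter (ℝ × ℝ) :=
  𝓝[{p : ℝ × ℝ | βcr p.1 < p.2}] (ρ, βcr ρ)

/-! ### The critical point -/

/-- `F(a; ρ) = ∫_{log ρ}^a dx / √(log ((1 + e^a) / (1 + e^x)))`. -/
def timeMap (a ρ : ℝ) : ℝ :=
  ∫ x in (Real.log ρ)..a, 1 / Real.sqrt (Real.log ((1 + Real.exp a) / (1 + Real.exp x)))

/-- The `ρ > 0` for which `∂F/∂a (a; ρ) < 0` at some `a > log ρ`. -/
def nonmonotoneSet : Set ℝ :=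
  {ρ | 0 < ρ ∧ ∃ a, Real.log ρ < a ∧ deriv (fun b => timeMap b ρ) a < 0}

/-- The critical value `ρ_c`. -/
def criticalRho : ℝ := sSup nonmonotoneSet

end

end LinRec

namespace LinRec

/-- The integrated tail `∫ₓ¹ f`. -/
noncomputable def tail (f : ℝ → ℝ) (x : ℝ) : ℝ := ∫ y in x..1, f y

/-- The effective field `log ρ + 2β ∫₀ˣ c`. -/
noncomputable def field (ρ β : ℝ) (c : ℝ → ℝ) (x : ℝ) : ℝ :=
  Real.log ρ + 2 * β * ∫ y in (0 : ℝ)..x, c y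

/-- `softplus h = log (1 + e^h)`, the convex conjugate of the entropy. -/
noncomputable def softplus (h : ℝ) : ℝ := Real.log (1 + Real.exp h)

/-- The functional dual to `functional`, obtained by linearizing the quadratic term. -/
noncomputable def dual (ρ β : ℝ) (c : ℝ → ℝ) : ℝ :=
  (∫ x in (0 : ℝ)..1, softplus (field ρ β c x)) - β * ∫ x in (0 : ℝ)..1, c x ^ 2

/-- Projection of the real line onto the unit interval. -/
noncomputable def clamp (x : ℝ) : ℝ := max 0 (min x 1)

/-- The density generated by the effective field of `c`. -/
noncomputable def response (ρ β : ℝ) (c : ℝ → ℝ) (x : ℝ) : ℝ :=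
  Real.sigmoid (field ρ β c (clamp x))

lemma clamp_mem (x : ℝ) : clamp x ∈ Icc (0 : ℝ) 1 := by
  simp [clamp]

lemma clamp_of_mem {x : ℝ} (hx : x ∈ Icc (0 : ℝ) 1) : clamp x = x := by
  simp [clamp, hx.1, hx.2]

lemma continuous_clamp : Continuous clamp := by unfold clamp; fun_prop

lemma continuous_softplus : Continuous softplus := by
  unfold softplus
  exact Continuous.log (by fun_prop) fun x => by positivity

lemma exp_softplus (h : ℝ) : Real.exp (softplus h) = 1 + Real.exp h :=
  Real.exp_log (by positivity)

lemma softplus_pos (h : ℝ) : 0 < softplus h :=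
  Real.log_pos (by linarith [Real.exp_pos h])

lemma softplus_mono : Monotone softplus := fun a b h =>
  Real.log_le_log (by positivity) (by gcongr)

lemma sigmoid_eq (h : ℝ) : Real.sigmoid h = Real.exp (h - softplus h) := by
  rw [Real.exp_sub, exp_softplus, Real.sigmoid_def, Real.exp_neg]
  have := Real.exp_pos h
  field_simp
  ring

lemma one_sub_sigmoid_eq (h : ℝ) : 1 - Real.sigmoid h = Real.exp (-softplus h) := by
  rw [Real.exp_neg, exp_softplus, Real.sigmoid_def, Real.exp_neg]
  have := Real.exp_pos h
  field_simp
  ring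

lemma mul_log_sub_le {u s : ℝ} (hu : 0 ≤ u) (hs : 0 < s) :
    u * (Real.log s - Real.log u) ≤ s - u := by
  rcases hu.eq_or_lt with rfl | hu
  · simpa using hs.le
  · rw [← Real.log_div hs.ne' hu.ne']
    have := Real.log_le_sub_one_of_pos (div_pos hs hu)
    calc u * Real.log (s / u) ≤ u * (s / u - 1) := by gcongr
      _ = s - u := by field_simp

lemma mul_sub_entropyI_le {u : ℝ} (hu : u ∈ Icc (0 : ℝ) 1) (h : ℝ) :
    u * h - entropyI u ≤ softplus h := by
  have h1 := mul_log_sub_le hu.1 (Real.exp_pos (h - softplus h))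
  have h2 := mul_log_sub_le (sub_nonneg.2 hu.2) (Real.exp_pos (-softplus h))
  have h3 := sigmoid_eq h
  have h4 := one_sub_sigmoid_eq h
  rw [Real.log_exp] at h1 h2
  rw [← h3] at h1
  rw [← h4] at h2
  unfold entropyI
  nlinarith

lemma sigmoid_mul_sub_entropyI (h : ℝ) :
    Real.sigmoid h * h - entropyI (Real.sigmoid h) = softplus h := by
  unfold entropyI
  rw [one_sub_sigmoid_eq]
  nth_rewrite 3 [sigmoid_eq]
  rw [Real.log_exp, Real.log_exp, ← one_sub_sigmoid_eq]
  ring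

lemma continuous_entropyI : Continuous entropyI := by
  unfold entropyI
  exact Real.continuous_mul_log.add
    (Real.continuous_mul_log.comp (continuous_const.sub continuous_id))

/-! ### Integrability -/

lemma intervalIntegrable_of_bounded {f : ℝ → ℝ} {C : ℝ} (hf : AEStronglyMeasurable f volume)
    (hC : ∀ x ∈ Icc (0 : ℝ) 1, |f x| ≤ C) :
    IntervalIntegrable f volume 0 1 := by
  rw [intervalIntegrable_iff_integrableOn_Ioc_of_le zero_le_one]
  refine Measure.integrableOn_of_bounded (M := C) (by simp) hf ?_
  refine (ae_restrict_iff' measurableSet_Ioc).2 (Eventually.of_forall fun x hx => ?_)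
  exact hC x ⟨hx.1.le, hx.2⟩

lemma Admissible.intervalIntegrable {f : ℝ → ℝ} (hf : Admissible f) :
    IntervalIntegrable f volume 0 1 :=
  intervalIntegrable_of_bounded (C := 1) hf.1.aestronglyMeasurable fun x hx => by
    rw [abs_of_nonneg (hf.2 x hx).1]; exact (hf.2 x hx).2

lemma Admissible.intervalIntegrable' {f : ℝ → ℝ} (hf : Admissible f) {a b : ℝ}
    (ha : a ∈ Icc (0 : ℝ) 1) (hb : b ∈ Icc (0 : ℝ) 1) : IntervalIntegrable f volume a b :=
  hf.intervalIntegrable.mono_set (by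
    rw [uIcc_of_le zero_le_one]
    exact uIcc_subset_Icc ha hb)

lemma Admissible.entropyI {f : ℝ → ℝ} (hf : Admissible f) :
    IntervalIntegrable (fun x => entropyI (f x)) volume 0 1 := by
  obtain ⟨C, hC⟩ := (isCompact_Icc (a := (0 : ℝ)) (b := 1)).exists_bound_of_continuousOn
    continuous_entropyI.continuousOn
  exact intervalIntegrable_of_bounded (C := C)
    (continuous_entropyI.measurable.comp hf.1).aestronglyMeasurable
    fun x hx => hC _ (hf.2 x hx)

lemma Admissible.tail_mem {f : ℝ → ℝ} (hf : Admissible f) {x : ℝ} (hx : x ∈ Icc (0 : ℝ) 1) :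
    tail f x ∈ Icc (0 : ℝ) 1 := by
  have h1 : (1 : ℝ) ∈ Icc (0 : ℝ) 1 := by simp
  constructor
  · exact intervalIntegral.integral_nonneg hx.2 fun y hy => (hf.2 y ⟨hx.1.trans hy.1, hy.2⟩).1
  · have := intervalIntegral.integral_mono_on hx.2 (hf.intervalIntegrable' hx h1)
      (intervalIntegrable_const (c := (1 : ℝ))) fun y hy => (hf.2 y ⟨hx.1.trans hy.1, hy.2⟩).2
    unfold tail
    simp at this
    linarith [hx.1]

lemma Admissible.tail_sub_tail {f : ℝ → ℝ} (hf : Admissible f) {x y : ℝ}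
    (hx : x ∈ Icc (0 : ℝ) 1) (hy : y ∈ Icc (0 : ℝ) 1) :
    tail f x - tail f y = ∫ z in x..y, f z := by
  have h1 : (1 : ℝ) ∈ Icc (0 : ℝ) 1 := by simp
  have := intervalIntegral.integral_add_adjacent_intervals (hf.intervalIntegrable' hx hy)
    (hf.intervalIntegrable' hy h1)
  unfold tail
  linarith

lemma Admissible.tail_antitone {f : ℝ → ℝ} (hf : Admissible f) :
    AntitoneOn (tail f) (Icc 0 1) := by
  intro x hx y hy hxy
  have := hf.tail_sub_tail hx hy
  have h := intervalIntegral.integral_nonneg (f := f) (μ := volume) hxy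
    fun z hz => (hf.2 z ⟨hx.1.trans hz.1, hz.2.trans hy.2⟩).1
  linarith

lemma Admissible.abs_tail_sub_le {f : ℝ → ℝ} (hf : Admissible f) {x y : ℝ}
    (hx : x ∈ Icc (0 : ℝ) 1) (hy : y ∈ Icc (0 : ℝ) 1) :
    |tail f x - tail f y| ≤ |x - y| := by
  rw [hf.tail_sub_tail hx hy, abs_sub_comm x y]
  have := intervalIntegral.norm_integral_le_of_norm_le_const (a := x) (b := y) (C := 1) (f := f)
    fun z hz => by
      have hz' : z ∈ Icc (0 : ℝ) 1 := (uIcc_subset_Icc hx hy) (uIoc_subset_uIcc hz)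
      rw [Real.norm_eq_abs, abs_of_nonneg (hf.2 z hz').1]; exact (hf.2 z hz').2
  simpa using this

lemma Admissible.tail_continuousOn {f : ℝ → ℝ} (hf : Admissible f) :
    ContinuousOn (tail f) (Icc 0 1) := by
  refine LipschitzOnWith.continuousOn (K := 1) (LipschitzOnWith.of_dist_le_mul fun x hx y hy => ?_)
  simpa [Real.dist_eq] using hf.abs_tail_sub_le hx hy

lemma field_continuousOn {c : ℝ → ℝ} (hc : IntervalIntegrable c volume 0 1) (ρ β : ℝ) :
    ContinuousOn (field ρ β c) (Icc 0 1) := by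
  unfold field
  refine continuousOn_const.add (continuousOn_const.mul ?_)
  have h := intervalIntegral.continuousOn_primitive_interval
    (f := c) (a := (0 : ℝ)) (b := 1) (μ := volume) ?_
  · rwa [uIcc_of_le zero_le_one] at h
  · rw [uIcc_of_le zero_le_one]
    exact (intervalIntegrable_iff_integrableOn_Icc_of_le zero_le_one).1 hc

lemma continuous_response {c : ℝ → ℝ} (hc : IntervalIntegrable c volume 0 1) (ρ β : ℝ) :
    Continuous (response ρ β c) := by
  unfold response
  exact continuous_sigmoid.comp
    ((field_continuousOn hc ρ β).comp_continuous continuous_clamp clamp_mem)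

lemma response_admissible {c : ℝ → ℝ} (hc : IntervalIntegrable c volume 0 1) (ρ β : ℝ) :
    Admissible (response ρ β c) :=
  ⟨(continuous_response hc ρ β).measurable, fun _ _ =>
    ⟨(Real.sigmoid_pos _).le, (Real.sigmoid_lt_one _).le⟩⟩

/-- Fubini's theorem on the triangle `0 < y < x < 1`. -/
lemma integral_mul_primitive {f c : ℝ → ℝ} (hf : IntervalIntegrable f volume 0 1)
    (hc : IntervalIntegrable c volume 0 1) :
    ∫ x in (0 : ℝ)..1, f x * ∫ y in (0 : ℝ)..x, c y =
      ∫ y in (0 : ℝ)..1, c y * tail f y := by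
  have hf' := (intervalIntegrable_iff_integrableOn_Ioc_of_le zero_le_one).1 hf
  have hc' := (intervalIntegrable_iff_integrableOn_Ioc_of_le zero_le_one).1 hc
  set μ := volume.restrict (Ioc (0 : ℝ) 1)
  have hK : Integrable (Function.uncurry fun x y : ℝ =>
      ({p : ℝ × ℝ | p.2 < p.1}.indicator (fun p => f p.1 * c p.2) (x, y))) (μ.prod μ) := by
    have : MeasurableSet {p : ℝ × ℝ | p.2 < p.1} := measurableSet_lt measurable_snd measurable_fst
    exact (Integrable.mul_prod (μ := μ) (ν := μ) hf' hc').indicator this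
  have hsw := integral_integral_swap hK
  rw [intervalIntegral.integral_of_le zero_le_one, intervalIntegral.integral_of_le zero_le_one]
  convert hsw using 1
  · refine setIntegral_congr_fun measurableSet_Ioc fun x hx => ?_
    have : (fun y => {p : ℝ × ℝ | p.2 < p.1}.indicator (fun p => f p.1 * c p.2) (x, y)) =
        (Iio x).indicator (fun y => f x * c y) := by
      ext y; simp [indicator]
    simp only [this]
    rw [integral_indicator measurableSet_Iio, integral_const_mul,
      Measure.restrict_restrict measurableSet_Iio, intervalIntegral.integral_of_le hx.1.le,
      integral_Ioc_eq_integral_Ioo]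
    congr 3
    ext y
    simp only [mem_inter_iff, mem_Iio, mem_Ioc, mem_Ioo]
    exact ⟨fun h => ⟨h.2, h.1, h.2.le.trans hx.2⟩, fun h => ⟨h.2.1, h.1⟩⟩
  · refine setIntegral_congr_fun measurableSet_Ioc fun y hy => ?_
    have : (fun x => {p : ℝ × ℝ | p.2 < p.1}.indicator (fun p => f p.1 * c p.2) (x, y)) =
        (Ioi y).indicator (fun x => c y * f x) := by
      ext x; simp [indicator, mul_comm]
    simp only [this]
    rw [integral_indicator measurableSet_Ioi, integral_const_mul,
      Measure.restrict_restrict measurableSet_Ioi, tail, intervalIntegral.integral_of_le hy.2]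
    congr 3
    ext x
    simp only [mem_inter_iff, mem_Ioi, mem_Ioc]
    exact ⟨fun h => ⟨h.1, hy.1.trans h.1, h.2⟩, fun h => ⟨h.1, h.2.2⟩⟩

lemma integral_mul_field {f c : ℝ → ℝ} (hf : IntervalIntegrable f volume 0 1)
    (hc : IntervalIntegrable c volume 0 1) (ρ β : ℝ) :
    ∫ x in (0 : ℝ)..1, f x * field ρ β c x =
      Real.log ρ * (∫ x in (0 : ℝ)..1, f x) + 2 * β * ∫ x in (0 : ℝ)..1, c x * tail f x := by
  rw [← integral_mul_primitive hf hc, ← intervalIntegral.integral_const_mul,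
    ← intervalIntegral.integral_const_mul, ← intervalIntegral.integral_add]
  · congr 1; ext x; unfold field; ring
  · exact hf.const_mul _
  · refine (hf.mul_continuousOn ?_).const_mul _
    have h := field_continuousOn hc 1 (1 / 2)
    unfold field at h
    rw [uIcc_of_le zero_le_one]
    simpa using h

/-- The quadratic energy `∫₀¹ (∫ₓ¹ f)² dx`. -/
noncomputable def energy (f : ℝ → ℝ) : ℝ := ∫ x in (0 : ℝ)..1, tail f x ^ 2

/-- The supremum of the variational functional. -/
noncomputable def value (ρ β : ℝ) : ℝ := sSup (functional ρ β '' {f | Admissible f})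

lemma functional_eq (ρ β : ℝ) (f : ℝ → ℝ) :
    functional ρ β f = Real.log ρ * tail f 0 + β * energy f - ∫ x in (0 : ℝ)..1, entropyI (f x) :=
  rfl

lemma Admissible.tail_intervalIntegrable {f : ℝ → ℝ} (hf : Admissible f) :
    IntervalIntegrable (tail f) volume 0 1 := by
  refine ContinuousOn.intervalIntegrable ?_
  rw [uIcc_of_le zero_le_one]
  exact hf.tail_continuousOn

lemma Admissible.tail_sq_intervalIntegrable {f : ℝ → ℝ} (hf : Admissible f) :
    IntervalIntegrable (fun x => tail f x ^ 2) volume 0 1 := by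
  refine ContinuousOn.intervalIntegrable ?_
  rw [uIcc_of_le zero_le_one]
  exact hf.tail_continuousOn.pow 2

lemma softplus_field_intervalIntegrable {c : ℝ → ℝ} (hc : IntervalIntegrable c volume 0 1)
    (ρ β : ℝ) : IntervalIntegrable (fun x => softplus (field ρ β c x)) volume 0 1 := by
  refine ContinuousOn.intervalIntegrable ?_
  rw [uIcc_of_le zero_le_one]
  exact continuous_softplus.comp_continuousOn (field_continuousOn hc ρ β)

lemma Admissible.mul_field_intervalIntegrable {f c : ℝ → ℝ} (hf : Admissible f)
    (hc : IntervalIntegrable c volume 0 1) (ρ β : ℝ) :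
    IntervalIntegrable (fun x => f x * field ρ β c x) volume 0 1 :=
  hf.intervalIntegrable.mul_continuousOn (by
    rw [uIcc_of_le zero_le_one]; exact field_continuousOn hc ρ β)

lemma Admissible.mul_tail_intervalIntegrable {f c : ℝ → ℝ} (hf : Admissible f)
    (hc : IntervalIntegrable c volume 0 1) :
    IntervalIntegrable (fun x => c x * tail f x) volume 0 1 :=
  hc.mul_continuousOn (by
    rw [uIcc_of_le zero_le_one]; exact hf.tail_continuousOn)

lemma functional_le_dual {f : ℝ → ℝ} (hf : Admissible f) (ρ β : ℝ) :
    functional ρ β f ≤ dual ρ β (tail f) := by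
  have h1 := integral_mul_field hf.intervalIntegrable hf.tail_intervalIntegrable ρ β
  have h2 : ∫ x in (0 : ℝ)..1, (f x * field ρ β (tail f) x - entropyI (f x)) ≤
      ∫ x in (0 : ℝ)..1, softplus (field ρ β (tail f) x) :=
    intervalIntegral.integral_mono_on zero_le_one
      ((hf.mul_field_intervalIntegrable hf.tail_intervalIntegrable ρ β).sub hf.entropyI)
      (softplus_field_intervalIntegrable hf.tail_intervalIntegrable ρ β)
      fun x hx => mul_sub_entropyI_le (hf.2 x hx) _
  rw [intervalIntegral.integral_sub
    (hf.mul_field_intervalIntegrable hf.tail_intervalIntegrable ρ β) hf.entropyI, h1] at h2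
  have h3 : ∫ x in (0 : ℝ)..1, tail f x * tail f x = energy f := by
    unfold energy; congr 1; ext x; ring
  rw [h3] at h2
  rw [functional_eq, dual]
  change _ ≤ _ - β * energy f
  have h4 : ∫ x in (0 : ℝ)..1, f x = tail f 0 := rfl
  rw [h4] at h2
  linarith

lemma functional_response {c : ℝ → ℝ} (hc : IntervalIntegrable c volume 0 1)
    (hc2 : IntervalIntegrable (fun x => c x ^ 2) volume 0 1) (ρ β : ℝ) :
    functional ρ β (response ρ β c) =
      dual ρ β c + β * ∫ x in (0 : ℝ)..1, (tail (response ρ β c) x - c x) ^ 2 := by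
  set f := response ρ β c with hf_def
  have hf : Admissible f := response_admissible hc ρ β
  have h1 := integral_mul_field hf.intervalIntegrable hc ρ β
  have h2 : ∫ x in (0 : ℝ)..1, (f x * field ρ β c x - entropyI (f x)) =
      ∫ x in (0 : ℝ)..1, softplus (field ρ β c x) := by
    refine intervalIntegral.integral_congr fun x hx => ?_
    rw [uIcc_of_le zero_le_one] at hx
    simp only [hf_def, response, clamp_of_mem hx]
    exact sigmoid_mul_sub_entropyI _
  rw [intervalIntegral.integral_sub (hf.mul_field_intervalIntegrable hc ρ β) hf.entropyI, h1] at h2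
  have h3 : ∫ x in (0 : ℝ)..1, (tail f x - c x) ^ 2 =
      energy f - 2 * (∫ x in (0 : ℝ)..1, c x * tail f x) + ∫ x in (0 : ℝ)..1, c x ^ 2 := by
    unfold energy
    rw [← intervalIntegral.integral_const_mul, ← intervalIntegral.integral_sub
      hf.tail_sq_intervalIntegrable ((hf.mul_tail_intervalIntegrable hc).const_mul 2),
      ← intervalIntegral.integral_add (hf.tail_sq_intervalIntegrable.sub
      ((hf.mul_tail_intervalIntegrable hc).const_mul 2)) hc2]
    congr 1; ext x; ring
  rw [functional_eq, dual, ← h2, h3]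
  change _ = Real.log ρ * tail f 0 + _ - _ - _ + _
  ring

lemma Admissible.energy_mem {f : ℝ → ℝ} (hf : Admissible f) : energy f ∈ Icc (0 : ℝ) 1 := by
  unfold energy
  refine ⟨intervalIntegral.integral_nonneg zero_le_one fun x _ => sq_nonneg _, ?_⟩
  have := intervalIntegral.integral_mono_on zero_le_one hf.tail_sq_intervalIntegrable
    (intervalIntegrable_const (c := (1 : ℝ))) fun y hy => by
      have := hf.tail_mem hy
      exact pow_le_one₀ this.1 this.2
  simpa using this

lemma zero_mem_unit : (0 : ℝ) ∈ Icc (0 : ℝ) 1 := by simp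

lemma Admissible.functional_le {f : ℝ → ℝ} (hf : Admissible f) (ρ β : ℝ) :
    functional ρ β f ≤ |Real.log ρ| + |β| + Real.log 2 := by
  rw [functional_eq]
  have h1 : Real.log ρ * tail f 0 ≤ |Real.log ρ| := by
    have := hf.tail_mem zero_mem_unit
    calc _ ≤ |Real.log ρ| * tail f 0 := by
          apply mul_le_mul_of_nonneg_right (le_abs_self _) this.1
      _ ≤ |Real.log ρ| * 1 := by gcongr; exact this.2
      _ = _ := mul_one _
  have h2 : β * energy f ≤ |β| := by
    have := hf.energy_mem
    calc _ ≤ |β| * energy f := by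
          apply mul_le_mul_of_nonneg_right (le_abs_self _) this.1
      _ ≤ |β| * 1 := by gcongr; exact this.2
      _ = _ := mul_one _
  have h3 := intervalIntegral.integral_mono_on zero_le_one hf.entropyI.neg
    (intervalIntegrable_const (c := Real.log 2)) fun y hy => by
      have := mul_sub_entropyI_le (hf.2 y hy) 0
      have e : softplus 0 = Real.log 2 := by unfold softplus; norm_num
      rw [e] at this
      simpa using this
  simp only [Pi.neg_apply, intervalIntegral.integral_neg, intervalIntegral.integral_const, sub_zero, one_smul] at h3
  linarith

lemma admissible_zero : Admissible (fun _ => (0 : ℝ)) := ⟨measurable_const, by simp⟩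

lemma functional_bddAbove (ρ β : ℝ) : BddAbove (functional ρ β '' {f | Admissible f}) := by
  refine ⟨|Real.log ρ| + |β| + Real.log 2, ?_⟩
  rintro _ ⟨f, hf, rfl⟩
  exact Admissible.functional_le hf ρ β

lemma Admissible.functional_le_value {f : ℝ → ℝ} (hf : Admissible f) (ρ β : ℝ) :
    functional ρ β f ≤ value ρ β :=
  le_csSup (functional_bddAbove ρ β) ⟨f, hf, rfl⟩

lemma value_le {ρ β C : ℝ} (h : ∀ f, Admissible f → functional ρ β f ≤ C) : value ρ β ≤ C := by
  refine csSup_le ⟨_, _, admissible_zero, rfl⟩ ?_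
  rintro _ ⟨f, hf, rfl⟩
  exact h f hf

lemma exists_lt_functional {ρ β C : ℝ} (h : C < value ρ β) :
    ∃ f, Admissible f ∧ C < functional ρ β f := by
  by_contra! H
  exact absurd (value_le H) (not_le.2 h)

lemma isOptimizer_iff {ρ β : ℝ} {f : ℝ → ℝ} :
    IsOptimizer ρ β f ↔ Admissible f ∧ functional ρ β f = value ρ β := by
  refine and_congr_right fun hf => ⟨fun h => le_antisymm (hf.functional_le_value ρ β) (value_le h),
    fun h g hg => h ▸ hg.functional_le_value ρ β⟩

lemma dual_le_value {β : ℝ} (hβ : 0 ≤ β) {c : ℝ → ℝ} (hc : IntervalIntegrable c volume 0 1)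
    (hc2 : IntervalIntegrable (fun x => c x ^ 2) volume 0 1) (ρ : ℝ) :
    dual ρ β c ≤ value ρ β := by
  have h := functional_response hc hc2 ρ β
  have h2 := (response_admissible hc ρ β).functional_le_value ρ β
  have h3 : 0 ≤ ∫ x in (0 : ℝ)..1, (tail (response ρ β c) x - c x) ^ 2 :=
    intervalIntegral.integral_nonneg zero_le_one fun x _ => sq_nonneg _
  nlinarith

lemma functional_sub (ρ β ρ' β' : ℝ) (f : ℝ → ℝ) :
    functional ρ' β' f =
      functional ρ β f + (Real.log ρ' - Real.log ρ) * tail f 0 + (β' - β) * energy f := by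
  rw [functional_eq, functional_eq]; ring

lemma value_le_value_add (ρ β ρ' β' : ℝ) :
    value ρ' β' ≤ value ρ β + |Real.log ρ' - Real.log ρ| + |β' - β| := by
  refine value_le fun f hf => ?_
  rw [functional_sub ρ β]
  have h0 := hf.functional_le_value ρ β
  have h1 := hf.tail_mem zero_mem_unit
  have h2 := hf.energy_mem
  have h3 : (Real.log ρ' - Real.log ρ) * tail f 0 ≤ |Real.log ρ' - Real.log ρ| :=
    (le_abs_self _).trans (by
      rw [abs_mul, abs_of_nonneg h1.1]; exact mul_le_of_le_one_right (abs_nonneg _) h1.2)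
  have h4 : (β' - β) * energy f ≤ |β' - β| :=
    (le_abs_self _).trans (by
      rw [abs_mul, abs_of_nonneg h2.1]; exact mul_le_of_le_one_right (abs_nonneg _) h2.2)
  linarith

lemma continuousAt_value {p : ℝ × ℝ} (hp : 0 < p.1) :
    ContinuousAt (fun q : ℝ × ℝ => value q.1 q.2) p := by
  have hg : ContinuousAt (fun q : ℝ × ℝ => |Real.log q.1 - Real.log p.1| + |q.2 - p.2|) p := by
    refine ContinuousAt.add (ContinuousAt.abs (ContinuousAt.sub
      (ContinuousAt.log continuousAt_fst hp.ne') continuousAt_const)) (by fun_prop)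
  have hg' : Tendsto (fun q : ℝ × ℝ => |Real.log q.1 - Real.log p.1| + |q.2 - p.2|) (𝓝 p) (𝓝 0) := by
    simpa [ContinuousAt] using hg
  rw [ContinuousAt, tendsto_iff_norm_sub_tendsto_zero]
  refine squeeze_zero (fun _ => norm_nonneg _) (fun q => ?_) hg'
  rw [Real.norm_eq_abs, abs_le]
  have h1 := value_le_value_add p.1 p.2 q.1 q.2
  have h2 := value_le_value_add q.1 q.2 p.1 p.2
  rw [abs_sub_comm (Real.log p.1), abs_sub_comm p.2] at h2
  constructor <;> linarith

lemma one_mem_unit : (1 : ℝ) ∈ Icc (0 : ℝ) 1 := by simp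

lemma intervalIntegrable_of_continuousOn_unit {c : ℝ → ℝ} (hc : ContinuousOn c (Icc 0 1)) :
    IntervalIntegrable c volume 0 1 :=
  ContinuousOn.intervalIntegrable (by rwa [uIcc_of_le zero_le_one])

/-- A continuous maximizer of the dual functional is the tail of a maximizer of the variational
problem. -/
lemma isOptimizer_response {ρ β : ℝ} (hβ : 0 < β) {c : ℝ → ℝ} (hc : ContinuousOn c (Icc 0 1))
    (h : value ρ β ≤ dual ρ β c) :
    IsOptimizer ρ β (response ρ β c) ∧ ∀ x ∈ Icc (0 : ℝ) 1, tail (response ρ β c) x = c x := by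
  have hci := intervalIntegrable_of_continuousOn_unit hc
  have ha : Admissible (response ρ β c) := response_admissible hci ρ β
  have h1 := functional_response hci (intervalIntegrable_of_continuousOn_unit (hc.pow 2)) ρ β
  have h2 := ha.functional_le_value ρ β
  have hnn : 0 ≤ ∫ x in (0 : ℝ)..1, (tail (response ρ β c) x - c x) ^ 2 :=
    intervalIntegral.integral_nonneg zero_le_one fun x _ => sq_nonneg _
  refine ⟨isOptimizer_iff.2 ⟨ha, by nlinarith⟩, ?_⟩
  by_contra! hx
  obtain ⟨x, hx, hne⟩ := hx
  have : 0 < ∫ x in (0 : ℝ)..1, (tail (response ρ β c) x - c x) ^ 2 :=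
    intervalIntegral.integral_pos zero_lt_one ((ha.tail_continuousOn.sub hc).pow 2)
      (fun x _ => sq_nonneg _) ⟨x, hx, by have := sub_ne_zero.2 hne; positivity⟩
  nlinarith


lemma tendsto_dual {ρ β : ℝ} (hβ : 0 < β) {c : ℕ → ℝ → ℝ} {c₀ : ℝ → ℝ}
    (hc : ∀ n, ContinuousOn (c n) (Icc 0 1)) (hmem : ∀ n, ∀ x ∈ Icc (0 : ℝ) 1, c n x ∈ Icc (0 : ℝ) 1)
    (h : ∀ x ∈ Icc (0 : ℝ) 1, Tendsto (fun n => c n x) atTop (𝓝 (c₀ x))) :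
    Tendsto (fun n => dual ρ β (c n)) atTop (𝓝 (dual ρ β c₀)) := by
  have hsub : ∀ x ∈ Icc (0 : ℝ) 1, ∀ y, y ∈ uIoc 0 x → y ∈ Icc (0 : ℝ) 1 := by
    intro x hx y hy
    rw [uIoc_of_le hx.1] at hy
    exact ⟨hy.1.le, hy.2.trans hx.2⟩
  have hmeas : ∀ {u : ℝ → ℝ}, ContinuousOn u (Icc 0 1) → ∀ x ∈ Icc (0 : ℝ) 1,
      AEStronglyMeasurable u (volume.restrict (uIoc 0 x)) := fun hu x hx =>
    (hu.mono fun y hy => hsub x hx y hy).aestronglyMeasurable measurableSet_uIoc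
  have hfield : ∀ x ∈ Icc (0 : ℝ) 1,
      Tendsto (fun n => field ρ β (c n) x) atTop (𝓝 (field ρ β c₀ x)) := by
    intro x hx
    unfold field
    refine tendsto_const_nhds.add (tendsto_const_nhds.mul ?_)
    refine intervalIntegral.tendsto_integral_filter_of_dominated_convergence (fun _ => 1)
      (Eventually.of_forall fun n => hmeas (hc n) x hx)
      (Eventually.of_forall fun n => Eventually.of_forall fun y hy => ?_)
      intervalIntegrable_const (Eventually.of_forall fun y hy => h y (hsub x hx y hy))
    have := hmem n y (hsub x hx y hy)
    rw [Real.norm_eq_abs, abs_of_nonneg this.1]; exact this.2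
  have hfb : ∀ n, ∀ x ∈ Icc (0 : ℝ) 1, field ρ β (c n) x ≤ Real.log ρ + 2 * β := by
    intro n x hx
    have h1 : ∫ y in (0 : ℝ)..x, c n y ≤ ∫ y in (0 : ℝ)..x, (1 : ℝ) := by
      refine intervalIntegral.integral_mono_on hx.1 ?_ intervalIntegrable_const fun y hy =>
        (hmem n y ⟨hy.1, hy.2.trans hx.2⟩).2
      refine ContinuousOn.intervalIntegrable ((hc n).mono ?_)
      rw [uIcc_of_le hx.1]; exact Icc_subset_Icc_right hx.2
    have h2 : ∫ y in (0 : ℝ)..x, c n y ≤ 1 := h1.trans (by simpa using hx.2)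
    unfold field
    nlinarith
  unfold dual
  refine Tendsto.sub ?_ (tendsto_const_nhds.mul ?_)
  · refine intervalIntegral.tendsto_integral_filter_of_dominated_convergence
      (fun _ => softplus (Real.log ρ + 2 * β))
      (Eventually.of_forall fun n => hmeas (continuous_softplus.comp_continuousOn
        (field_continuousOn (intervalIntegrable_of_continuousOn_unit (hc n)) ρ β)) 1 one_mem_unit)
      (Eventually.of_forall fun n => Eventually.of_forall fun y hy => ?_)
      intervalIntegrable_const (Eventually.of_forall fun y hy =>
        (continuous_softplus.tendsto _).comp (hfield y (hsub 1 one_mem_unit y hy)))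
    rw [Real.norm_eq_abs, abs_of_pos (softplus_pos _)]
    exact softplus_mono (hfb n y (hsub 1 one_mem_unit y hy))
  · refine intervalIntegral.tendsto_integral_filter_of_dominated_convergence (fun _ => 1)
      (Eventually.of_forall fun n => hmeas ((hc n).pow 2) 1 one_mem_unit)
      (Eventually.of_forall fun n => Eventually.of_forall fun y hy => ?_)
      intervalIntegrable_const (Eventually.of_forall fun y hy =>
        (h y (hsub 1 one_mem_unit y hy)).pow 2)
    have := hmem n y (hsub 1 one_mem_unit y hy)
    rw [Real.norm_eq_abs, abs_of_nonneg (sq_nonneg _)]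
    exact pow_le_one₀ this.1 this.2

/-- Arzelà–Ascoli for tails of admissible functions. -/
lemma exists_tendsto_tail {f : ℕ → ℝ → ℝ} (hf : ∀ n, Admissible (f n)) :
    ∃ c : ℝ → ℝ, Continuous c ∧ ∃ φ : ℕ → ℕ, StrictMono φ ∧
      ∀ x ∈ Icc (0 : ℝ) 1, Tendsto (fun n => tail (f (φ n)) x) atTop (𝓝 (c x)) := by
  let T : ℕ → BoundedContinuousFunction (Icc (0 : ℝ) 1) ℝ := fun n =>
    BoundedContinuousFunction.mkOfCompact ⟨fun x => tail (f n) x,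
      (hf n).tail_continuousOn.domRestrict⟩
  let A : Set (BoundedContinuousFunction (Icc (0 : ℝ) 1) ℝ) :=
    {F | ∀ x y, F x ∈ Icc (0 : ℝ) 1 ∧ dist (F x) (F y) ≤ dist x y}
  have hA : IsClosed A := by
    simp only [A, ofPred_forall, ofPred_and]
    refine isClosed_iInter fun x => isClosed_iInter fun y => ?_
    have hx := (BoundedContinuousFunction.lipschitz_eval_const (β := ℝ) x).continuous
    have hy := (BoundedContinuousFunction.lipschitz_eval_const (β := ℝ) y).continuous
    exact (isClosed_Icc.preimage hx).inter (isClosed_le (hx.dist hy) continuous_const)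
  have hcomp : IsCompact A := by
    refine BoundedContinuousFunction.arzela_ascoli₂ (Icc 0 1) isCompact_Icc A hA
      (fun F x hF => (hF x x).1) ?_
    exact (Metric.uniformEquicontinuous_of_continuity_modulus id tendsto_id _
      fun x y F => (F.2 x y).2).equicontinuous
  have hT : ∀ n, T n ∈ A := fun n x y => ⟨(hf n).tail_mem x.2, (hf n).abs_tail_sub_le x.2 y.2⟩
  obtain ⟨F, -, φ, hφ, hlim⟩ := hcomp.tendsto_subseq hT
  refine ⟨fun x => F (projIcc 0 1 zero_le_one x), F.continuous.comp continuous_projIcc, φ, hφ,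
    fun x hx => ?_⟩
  simp only [projIcc_of_mem zero_le_one hx]
  exact ((BoundedContinuousFunction.lipschitz_eval_const
    (⟨x, hx⟩ : Icc (0 : ℝ) 1)).continuous.tendsto
    F).comp hlim

lemma exists_optimal_limit {ρ β : ℝ} (hρ : 0 < ρ) (hβ : 0 < β) {p : ℕ → ℝ × ℝ}
    (hp : Tendsto p atTop (𝓝 (ρ, β))) {f : ℕ → ℝ → ℝ} (hf : ∀ n, Admissible (f n))
    (h : Tendsto (fun n => functional (p n).1 (p n).2 (f n)) atTop (𝓝 (value ρ β))) :
    ∃ d ∈ optimalDensities ρ β, ∃ φ : ℕ → ℕ, StrictMono φ ∧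
      Tendsto (fun n => tail (f (φ n)) 0) atTop (𝓝 d) := by
  obtain ⟨c, hc, φ, hφ, hlim⟩ := exists_tendsto_tail hf
  have hdual := tendsto_dual (ρ := ρ) hβ (fun n => (hf (φ n)).tail_continuousOn)
    (fun n x hx => (hf (φ n)).tail_mem hx) hlim
  have h1 : Tendsto (fun n => functional ρ β (f n)) atTop (𝓝 (value ρ β)) := by
    have hlog : Tendsto (fun n => Real.log ρ - Real.log (p n).1) atTop (𝓝 0) := by
      have := (Real.continuousAt_log hρ.ne').tendsto.comp ((continuous_fst.tendsto _).comp hp)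
      simpa using (tendsto_const_nhds (x := Real.log ρ)).sub this
    have hb : Tendsto (fun n => β - (p n).2) atTop (𝓝 0) := by
      simpa using (tendsto_const_nhds (x := β)).sub ((continuous_snd.tendsto _).comp hp)
    have e1 : Tendsto (fun n => (Real.log ρ - Real.log (p n).1) * tail (f n) 0) atTop (𝓝 0) :=
      hlog.zero_mul_isBoundedUnder_le (isBoundedUnder_of ⟨1, fun n => by
        have := (hf n).tail_mem zero_mem_unit
        simp only [Function.comp, Real.norm_eq_abs, abs_of_nonneg this.1]; exact this.2⟩)
    have e2 : Tendsto (fun n => (β - (p n).2) * energy (f n)) atTop (𝓝 0) :=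
      hb.zero_mul_isBoundedUnder_le (isBoundedUnder_of ⟨1, fun n => by
        have := (hf n).energy_mem
        simp only [Function.comp, Real.norm_eq_abs, abs_of_nonneg this.1]; exact this.2⟩)
    have := (h.add e1).add e2
    simp only [add_zero] at this
    exact this.congr fun n => (functional_sub _ _ _ _ _).symm
  have h2 : value ρ β ≤ dual ρ β c :=
    le_of_tendsto_of_tendsto' (h1.comp hφ.tendsto_atTop) hdual fun n =>
      functional_le_dual (hf (φ n)) ρ β
  obtain ⟨h3, h4⟩ := isOptimizer_response hβ hc.continuousOn h2
  refine ⟨c 0, ⟨_, h3, h4 0 zero_mem_unit⟩, φ, hφ, hlim 0 zero_mem_unit⟩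

lemma optimalDensities_nonempty {ρ β : ℝ} (hρ : 0 < ρ) (hβ : 0 < β) :
    (optimalDensities ρ β).Nonempty := by
  have : ∀ n : ℕ, ∃ f, Admissible f ∧ value ρ β - 1 / (n + 1 : ℝ) < functional ρ β f := fun n =>
    exists_lt_functional (by linarith [Nat.one_div_pos_of_nat (α := ℝ) (n := n)])
  choose f hf hlt using this
  obtain ⟨d, hd, -⟩ := exists_optimal_limit hρ hβ (p := fun _ => (ρ, β)) tendsto_const_nhds hf (by
    refine tendsto_of_tendsto_of_tendsto_of_le_of_le ?_ tendsto_const_nhds (fun n => (hlt n).le)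
      fun n => (hf n).functional_le_value ρ β
    simpa using (tendsto_const_nhds (x := value ρ β)).sub
      (tendsto_one_div_add_atTop_nhds_zero_nat (𝕜 := ℝ)))
  exact ⟨d, hd⟩

/-- The optimal densities depend on the parameters in an upper semicontinuous way. -/
lemma exists_limit_of_optimalDensities {ρ β : ℝ} (hρ : 0 < ρ) (hβ : 0 < β) {p : ℕ → ℝ × ℝ}
    (hp : Tendsto p atTop (𝓝 (ρ, β))) {d : ℕ → ℝ}
    (hd : ∀ n, d n ∈ optimalDensities (p n).1 (p n).2) :
    ∃ d₀ ∈ optimalDensities ρ β, ∃ φ : ℕ → ℕ, StrictMono φ ∧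
      Tendsto (fun n => d (φ n)) atTop (𝓝 d₀) := by
  choose f hf hfd using hd
  obtain ⟨d₀, h0, φ, hφ, hlim⟩ := exists_optimal_limit hρ hβ hp (fun n => (hf n).1)
    (((continuousAt_value (p := (ρ, β)) hρ).tendsto.comp hp).congr fun n =>
      (isOptimizer_iff.1 (hf n)).2.symm)
  refine ⟨d₀, h0, φ, hφ, ?_⟩
  simpa only [tail, hfd] using hlim

lemma eventually_optimalDensities_subset {ρ β : ℝ} (hρ : 0 < ρ) (hβ : 0 < β) {U : Set ℝ}
    (hU : IsOpen U) (h : optimalDensities ρ β ⊆ U) :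
    ∀ᶠ p : ℝ × ℝ in 𝓝 (ρ, β), optimalDensities p.1 p.2 ⊆ U := by
  by_contra H
  rw [not_eventually] at H
  obtain ⟨p, hp, hpU⟩ := exists_seq_forall_of_frequently H
  simp only [not_subset] at hpU
  choose d hd hdU using hpU
  obtain ⟨d₀, h0, φ, -, hlim⟩ := exists_limit_of_optimalDensities hρ hβ hp hd
  obtain ⟨n, hn⟩ := (hlim.eventually (hU.mem_nhds (h h0))).exists
  exact hdU _ hn

/-- `g(y) = 1 / (1 - e^{-y})`. -/
noncomputable def gfun (y : ℝ) : ℝ := 1 / (1 - Real.exp (-y))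

/-- `G(s, r) = ∫₀¹ g(s + r² (1 - w²)) dw`. -/
noncomputable def meanG (s r : ℝ) : ℝ := ∫ w in (0 : ℝ)..1, gfun (s + r ^ 2 * (1 - w ^ 2))

lemma one_sub_exp_neg_pos {y : ℝ} (hy : 0 < y) : 0 < 1 - Real.exp (-y) := by
  have : Real.exp (-y) < 1 := by rw [Real.exp_lt_one_iff]; linarith
  linarith

lemma gfun_softplus (h : ℝ) : gfun (softplus h) = 1 / Real.sigmoid h := by
  unfold gfun
  rw [← one_sub_sigmoid_eq]; ring_nf

lemma continuousAt_gfun {y : ℝ} (hy : 0 < y) : ContinuousAt gfun y := by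
  unfold gfun
  exact continuousAt_const.div (by fun_prop) (one_sub_exp_neg_pos hy).ne'

lemma hasDerivAt_softplus (h : ℝ) : HasDerivAt softplus (Real.sigmoid h) h := by
  have := ((Real.hasDerivAt_exp h).const_add 1).log (by positivity)
  unfold softplus
  convert this using 1
  rw [Real.sigmoid_def, Real.exp_neg]
  field_simp
  ring

/-- The energy of a maximizer as a function of its density. -/
noncomputable def energyOf (ρ β d : ℝ) : ℝ :=
  d ^ 2 / 2 + (Real.log (1 + ρ) - value ρ β) / (2 * β)

lemma euler_lagrange {ρ β : ℝ} (hρ : 0 < ρ) (hβ : 0 < β) {f : ℝ → ℝ} (hf : IsOptimizer ρ β f) :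
    energy f = energyOf ρ β (tail f 0) ∧
      tail f 0 * meanG (Real.log (1 + ρ)) (√β * tail f 0) = 1 := by
  obtain ⟨ha, hval⟩ := isOptimizer_iff.1 hf
  have hle : value ρ β ≤ dual ρ β (tail f) := hval ▸ functional_le_dual ha ρ β
  have hdual : dual ρ β (tail f) = value ρ β := le_antisymm
    (dual_le_value hβ.le ha.tail_intervalIntegrable ha.tail_sq_intervalIntegrable ρ) hle
  obtain ⟨-, htail⟩ := isOptimizer_response hβ ha.tail_continuousOn hle
  set u := response ρ β (tail f) with hu
  have hucont : Continuous u := continuous_response ha.tail_intervalIntegrable ρ β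
  have hFder : ∀ x, HasDerivAt (tail u) (-u x) x := fun x => by
    unfold tail
    exact intervalIntegral.integral_hasDerivAt_left (hucont.intervalIntegrable _ _)
      hucont.aestronglyMeasurable.stronglyMeasurableAtFilter hucont.continuousAt
  have hFcont : Continuous (tail u) := continuous_iff_continuousAt.2 fun x => (hFder x).continuousAt
  set h := field ρ β (tail u) with hh
  have hhder : ∀ x, HasDerivAt h (2 * β * tail u x) x := fun x => by
    rw [hh]; unfold field
    exact ((intervalIntegral.integral_hasDerivAt_right (hFcont.intervalIntegrable _ _)
      hFcont.aestronglyMeasurable.stronglyMeasurableAtFilter hFcont.continuousAt).const_mul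
      (2 * β)).const_add _
  have hfield : ∀ x ∈ Icc (0 : ℝ) 1, field ρ β (tail f) x = h x := fun x hx => by
    rw [hh]; unfold field
    congr 2
    refine intervalIntegral.integral_congr fun y hy => ?_
    rw [uIcc_of_le hx.1] at hy
    exact (htail y ⟨hy.1, hy.2.trans hx.2⟩).symm
  have hux : ∀ x ∈ Icc (0 : ℝ) 1, u x = Real.sigmoid (h x) := fun x hx => by
    rw [hu, response, clamp_of_mem hx, hfield x hx]
  set d := tail f 0 with hd
  have hd0 : tail u 0 = d := htail 0 zero_mem_unit
  have hEder : ∀ x ∈ Icc (0 : ℝ) 1,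
      HasDerivAt (fun x => β * tail u x ^ 2 + softplus (h x)) 0 x := fun x hx => by
    refine HasDerivAt.congr_deriv ((((hFder x).pow 2).const_mul β).add
      ((hasDerivAt_softplus (h x)).comp x (hhder x))) ?_
    rw [hux x hx]; ring
  have hE : ∀ x ∈ Icc (0 : ℝ) 1,
      β * tail u x ^ 2 + softplus (h x) = β * d ^ 2 + Real.log (1 + ρ) := fun x hx => by
    have := constant_of_has_deriv_right_zero
      (f := fun x => β * tail u x ^ 2 + softplus (h x)) (a := 0) (b := 1)
      (fun y hy => (hEder y hy).continuousAt.continuousWithinAt)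
      (fun y hy => (hEder y (Ico_subset_Icc_self hy)).hasDerivWithinAt) x hx
    rw [this, hd0]
    simp [hh, field, softplus, Real.exp_log hρ]
  constructor
  · have hE2 : ∫ x in (0 : ℝ)..1, softplus (field ρ β (tail f) x) =
        ∫ x in (0 : ℝ)..1, (β * d ^ 2 + Real.log (1 + ρ) - β * tail f x ^ 2) := by
      refine intervalIntegral.integral_congr fun x hx => ?_
      rw [uIcc_of_le zero_le_one] at hx
      simp only [hfield x hx, ← htail x hx]
      linarith [hE x hx]
    rw [intervalIntegral.integral_sub intervalIntegrable_const
      (ha.tail_sq_intervalIntegrable.const_mul β), intervalIntegral.integral_const_mul] at hE2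
    simp only [intervalIntegral.integral_const, sub_zero, one_smul] at hE2
    rw [dual, hE2] at hdual
    change β * d ^ 2 + Real.log (1 + ρ) - β * energy f - β * energy f = _ at hdual
    rw [energyOf]
    field_simp
    linarith
  · have hpos : ∀ x ∈ Icc (0 : ℝ) 1, Real.log (1 + ρ) + β * (d ^ 2 - tail u x ^ 2) =
        softplus (h x) := fun x hx => by linarith [hE x hx]
    have hsub := intervalIntegral.integral_comp_mul_deriv' (a := 0) (b := 1)
      (f := tail u) (f' := fun x => -u x)
      (g := fun v => gfun (Real.log (1 + ρ) + β * (d ^ 2 - v ^ 2)))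
      (fun x _ => hFder x) hucont.neg.continuousOn ?_
    · have h1 : ∫ x in (0 : ℝ)..1, ((fun v => gfun (Real.log (1 + ρ) + β * (d ^ 2 - v ^ 2))) ∘
          tail u) x * -u x = ∫ x in (0 : ℝ)..1, (-1 : ℝ) := by
        refine intervalIntegral.integral_congr fun x hx => ?_
        rw [uIcc_of_le zero_le_one] at hx
        simp only [Function.comp, hpos x hx, gfun_softplus, hux x hx]
        have := Real.sigmoid_pos (h x)
        field_simp
      have h2 : tail u 1 = 0 := by simp [tail]
      rw [h1, hd0, h2, intervalIntegral.integral_symm 0 d] at hsub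
      simp only [intervalIntegral.integral_const, sub_zero, one_smul, neg_inj] at hsub
      have h3 := intervalIntegral.mul_integral_comp_mul_left (a := 0) (b := 1) (c := d)
        (f := fun v => gfun (Real.log (1 + ρ) + β * (d ^ 2 - v ^ 2)))
      rw [mul_zero, mul_one, ← hsub] at h3
      refine Eq.trans ?_ h3
      rw [meanG]
      congr 2
      ext w
      rw [mul_pow, Real.sq_sqrt hβ.le]
      congr 1; ring
    · rintro _ ⟨x, hx, rfl⟩
      rw [uIcc_of_le zero_le_one] at hx
      refine ContinuousAt.continuousWithinAt ?_
      refine ContinuousAt.comp (f := fun v => Real.log (1 + ρ) + β * (d ^ 2 - v ^ 2)) (g := gfun) ?_ (by fun_prop)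
      refine continuousAt_gfun ?_
      rw [hpos x hx]
      exact softplus_pos _

lemma exists_optimizer_of_mem {ρ β d : ℝ} (hρ : 0 < ρ) (hβ : 0 < β)
    (hd : d ∈ optimalDensities ρ β) :
    ∃ f, Admissible f ∧ functional ρ β f = value ρ β ∧ tail f 0 = d ∧ energy f = energyOf ρ β d := by
  obtain ⟨f, hf, rfl⟩ := hd
  exact ⟨f, hf.1, (isOptimizer_iff.1 hf).2, rfl, (euler_lagrange hρ hβ hf).1⟩

lemma mul_meanG_of_mem {ρ β d : ℝ} (hρ : 0 < ρ) (hβ : 0 < β)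
    (hd : d ∈ optimalDensities ρ β) : d * meanG (Real.log (1 + ρ)) (√β * d) = 1 := by
  obtain ⟨f, hf, rfl⟩ := hd
  exact (euler_lagrange hρ hβ hf).2

lemma optimalDensities_subset_Icc (ρ β : ℝ) : optimalDensities ρ β ⊆ Icc 0 1 := by
  rintro _ ⟨f, hf, rfl⟩
  exact hf.1.tail_mem zero_mem_unit

lemma gfun_gt_one {y : ℝ} (hy : 0 < y) : 1 < gfun y := by
  unfold gfun
  rw [lt_div_iff₀ (one_sub_exp_neg_pos hy)]
  linarith [Real.exp_pos (-y)]

lemma arg_pos {s r w : ℝ} (hs : 0 < s) (hw : w ∈ Icc (0 : ℝ) 1) :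
    0 < s + r ^ 2 * (1 - w ^ 2) := by
  have : w ^ 2 ≤ 1 := pow_le_one₀ hw.1 hw.2
  have := mul_nonneg (sq_nonneg r) (sub_nonneg.2 this)
  linarith

lemma gfun_arg_continuousOn {s r : ℝ} (hs : 0 < s) :
    ContinuousOn (fun w => gfun (s + r ^ 2 * (1 - w ^ 2))) (Icc 0 1) := fun w hw =>
  ((continuousAt_gfun (arg_pos hs hw)).comp (f := fun w : ℝ => s + r ^ 2 * (1 - w ^ 2))
    (by fun_prop)).continuousWithinAt

lemma meanG_gt_one {s : ℝ} (hs : 0 < s) (r : ℝ) : 1 < meanG s r := by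
  have h := intervalIntegral.intervalIntegral_pos_of_pos_on
    (f := fun w => gfun (s + r ^ 2 * (1 - w ^ 2)) - 1) (a := 0) (b := 1)
    ((intervalIntegrable_of_continuousOn_unit (gfun_arg_continuousOn hs)).sub
      intervalIntegrable_const)
    (fun w hw => sub_pos.2 (gfun_gt_one (arg_pos hs (Ioo_subset_Icc_self hw)))) zero_lt_one
  rw [intervalIntegral.integral_sub
    (intervalIntegrable_of_continuousOn_unit (gfun_arg_continuousOn hs))
      intervalIntegrable_const] at h
  simpa [meanG] using h

lemma log_one_add_pos {ρ : ℝ} (hρ : 0 < ρ) : 0 < Real.log (1 + ρ) := Real.log_pos (by linarith)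

lemma optimalDensities_subset_Ioo {ρ β : ℝ} (hρ : 0 < ρ) (hβ : 0 < β) :
    optimalDensities ρ β ⊆ Ioo 0 1 := fun d hd => by
  have h1 := mul_meanG_of_mem hρ hβ hd
  have h2 := meanG_gt_one (log_one_add_pos hρ) (√β * d)
  have h3 := (optimalDensities_subset_Icc ρ β hd).1
  have h4 : 0 < d := h3.lt_of_ne fun h => by simp [← h] at h1
  exact ⟨h4, by nlinarith⟩

/-- The supporting-hyperplane inequality for the value at an optimal density. -/
lemma value_support {ρ β ρ' β' d : ℝ} (hρ : 0 < ρ) (hβ : 0 < β)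
    (hd : d ∈ optimalDensities ρ β) :
    value ρ β + (Real.log ρ' - Real.log ρ) * d + (β' - β) * energyOf ρ β d ≤ value ρ' β' := by
  obtain ⟨f, hf, hv, rfl, he⟩ := exists_optimizer_of_mem hρ hβ hd
  rw [← he, ← hv, ← functional_sub]
  exact hf.functional_le_value ρ' β'

lemma gfun_anti {x y : ℝ} (hx : 0 < x) (hxy : x ≤ y) : gfun y ≤ gfun x := by
  unfold gfun
  refine one_div_le_one_div_of_le (one_sub_exp_neg_pos hx) ?_
  have : Real.exp (-y) ≤ Real.exp (-x) := Real.exp_le_exp.2 (by linarith)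
  linarith

lemma gfun_le {y : ℝ} (hy : 0 < y) : gfun y ≤ 1 + 1 / y := by
  unfold gfun
  have h1 := one_sub_exp_neg_pos hy
  have h2 : Real.exp (-y) ≤ 1 / (1 + y) := by
    rw [Real.exp_neg, ← one_div]
    exact one_div_le_one_div_of_le (by linarith) (by linarith [Real.add_one_le_exp y])
  have h3 : y / (1 + y) ≤ 1 - Real.exp (-y) := by
    have : y / (1 + y) = 1 - 1 / (1 + y) := by field_simp; ring
    linarith
  calc 1 / (1 - Real.exp (-y)) ≤ 1 / (y / (1 + y)) := one_div_le_one_div_of_le (by positivity) h3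
    _ = 1 + 1 / y := by field_simp; ring

lemma one_div_le_gfun {y : ℝ} (hy : 0 < y) : 1 / y ≤ gfun y := by
  unfold gfun
  exact one_div_le_one_div_of_le (one_sub_exp_neg_pos hy) (by linarith [Real.add_one_le_exp (-y)])

lemma mem_unit_of_uIoc {w : ℝ} (hw : w ∈ uIoc (0 : ℝ) 1) : w ∈ Icc (0 : ℝ) 1 := by
  rw [uIoc_of_le zero_le_one] at hw
  exact Ioc_subset_Icc_self hw

lemma one_sub_sq_mem {w : ℝ} (hw : w ∈ Icc (0 : ℝ) 1) : 1 - w ^ 2 ∈ Icc (0 : ℝ) 1 := by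
  have : w ^ 2 ≤ 1 := pow_le_one₀ hw.1 hw.2
  exact ⟨by linarith, by linarith [sq_nonneg w]⟩

lemma gfun_arg_intervalIntegrable {s : ℝ} (hs : 0 < s) (r : ℝ) :
    IntervalIntegrable (fun w => gfun (s + r ^ 2 * (1 - w ^ 2))) volume 0 1 :=
  intervalIntegrable_of_continuousOn_unit (gfun_arg_continuousOn hs)

lemma le_arg (s r : ℝ) {w : ℝ} (hw : w ∈ Icc (0 : ℝ) 1) : s ≤ s + r ^ 2 * (1 - w ^ 2) := by
  have := mul_nonneg (sq_nonneg r) (one_sub_sq_mem hw).1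
  linarith

lemma continuousAt_meanG {p : ℝ × ℝ} (hp : 0 < p.1) :
    ContinuousAt (fun q : ℝ × ℝ => meanG q.1 q.2) p := by
  unfold meanG
  have hev : ∀ᶠ q : ℝ × ℝ in 𝓝 p, p.1 / 2 < q.1 :=
    continuous_fst.continuousAt.eventually (lt_mem_nhds (by linarith))
  refine intervalIntegral.continuousAt_of_dominated_interval (bound := fun _ => gfun (p.1 / 2))
    ?_ ?_ intervalIntegrable_const ?_
  · filter_upwards [hev] with q hq
    exact (gfun_arg_intervalIntegrable (by linarith) q.2).aestronglyMeasurable_restrict_uIoc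
  · filter_upwards [hev] with q hq
    refine Eventually.of_forall fun w hw => ?_
    have hw' := mem_unit_of_uIoc hw
    rw [Real.norm_eq_abs, abs_of_pos
      (zero_lt_one.trans (gfun_gt_one (arg_pos (by linarith) hw')))]
    exact gfun_anti (by linarith) (hq.le.trans (le_arg _ _ hw'))
  · refine Eventually.of_forall fun w hw => ?_
    exact ContinuousAt.comp (g := gfun) (f := fun q : ℝ × ℝ => q.1 + q.2 ^ 2 * (1 - w ^ 2))
      (continuousAt_gfun (arg_pos hp (mem_unit_of_uIoc hw))) (by fun_prop)

/-! ### Analyticity -/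

/-- The analytic continuation of `meanG`, in the variable `t = r²`. -/
noncomputable def complexG (s : ℝ) (t : ℂ) : ℂ :=
  ∫ w in (0 : ℝ)..1, 1 / (1 - Complex.exp (-(s + t * ((1 - w ^ 2 : ℝ) : ℂ))))

lemma one_sub_exp_re_le_norm (z : ℂ) : 1 - Real.exp (-z.re) ≤ ‖1 - Complex.exp (-z)‖ := by
  have := norm_sub_norm_le (1 : ℂ) (Complex.exp (-z))
  simpa [Complex.norm_exp] using this

lemma differentiableOn_complexG {s : ℝ} (hs : 0 < s) :
    DifferentiableOn ℂ (complexG s) {t | -s < t.re} := by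
  intro t₀ ht₀
  simp only [mem_ofPred_eq] at ht₀
  set δ := min s ((s + t₀.re) / 2) with hδ_def
  have hδ : 0 < δ := lt_min hs (by linarith)
  set N : Set ℂ := {t | (t₀.re - s) / 2 < t.re} with hN
  have hNmem : N ∈ 𝓝 t₀ := (isOpen_lt continuous_const Complex.continuous_re).mem_nhds (by
    change (t₀.re - s) / 2 < t₀.re; linarith)
  have hre : ∀ t ∈ N, ∀ w ∈ Icc (0 : ℝ) 1,
      δ ≤ ((s : ℂ) + t * ((1 - w ^ 2 : ℝ) : ℂ)).re := by
    intro t ht w hw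
    have hu := one_sub_sq_mem hw
    rw [Complex.add_re, Complex.re_mul_ofReal, Complex.ofReal_re]
    have h1 : δ ≤ s := min_le_left _ _
    have h2 : δ ≤ s + t.re := (min_le_right _ _).trans (by
      change (t₀.re - s) / 2 < t.re at ht; linarith)
    nlinarith [hu.1, hu.2, mul_nonneg hu.1 (sub_nonneg.2 h2),
      mul_nonneg (sub_nonneg.2 hu.2) (sub_nonneg.2 h1)]
  have hden : ∀ t ∈ N, ∀ w ∈ Icc (0 : ℝ) 1, 1 - Real.exp (-δ) ≤
      ‖1 - Complex.exp (-(s + t * ((1 - w ^ 2 : ℝ) : ℂ)))‖ := fun t ht w hw =>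
    le_trans (by
      have := Real.exp_le_exp.2 (neg_le_neg (hre t ht w hw))
      linarith) (one_sub_exp_re_le_norm _)
  have hpos := one_sub_exp_neg_pos hδ
  have hne : ∀ t ∈ N, ∀ w ∈ Icc (0 : ℝ) 1,
      1 - Complex.exp (-(s + t * ((1 - w ^ 2 : ℝ) : ℂ))) ≠ 0 := fun t ht w hw =>
    norm_pos_iff.1 (hpos.trans_le (hden t ht w hw))
  have hcont : ∀ t ∈ N, ContinuousOn
      (fun w : ℝ => 1 / (1 - Complex.exp (-(s + t * ((1 - w ^ 2 : ℝ) : ℂ))))) (Icc 0 1) :=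
    fun t ht => continuousOn_const.div (by fun_prop) (hne t ht)
  set F' : ℂ → ℝ → ℂ := fun t w =>
    -(Complex.exp (-(s + t * ((1 - w ^ 2 : ℝ) : ℂ))) * ((1 - w ^ 2 : ℝ) : ℂ)) /
      (1 - Complex.exp (-(s + t * ((1 - w ^ 2 : ℝ) : ℂ)))) ^ 2 with hF'
  have hsub : uIoc (0 : ℝ) 1 ⊆ Icc 0 1 := fun w => mem_unit_of_uIoc
  have key := intervalIntegral.hasDerivAt_integral_of_dominated_loc_of_deriv_le
    (𝕜 := ℂ) (μ := volume) (a := 0) (b := 1)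
    (F := fun t w => 1 / (1 - Complex.exp (-(s + t * ((1 - w ^ 2 : ℝ) : ℂ))))) (F' := F')
    (x₀ := t₀) (s := N) (bound := fun _ => 1 / (1 - Real.exp (-δ)) ^ 2) hNmem ?_ ?_ ?_ ?_
    intervalIntegrable_const ?_
  · exact key.2.differentiableAt.differentiableWithinAt
  · filter_upwards [hNmem] with t ht
    exact ((hcont t ht).mono hsub).aestronglyMeasurable measurableSet_uIoc
  · refine ContinuousOn.intervalIntegrable ?_
    rw [uIcc_of_le zero_le_one]
    exact hcont t₀ (mem_of_mem_nhds hNmem)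
  · refine ContinuousOn.aestronglyMeasurable (ContinuousOn.mono ?_ hsub) measurableSet_uIoc
    exact ContinuousOn.div (by fun_prop) (by fun_prop) fun w hw =>
      pow_ne_zero _ (hne t₀ (mem_of_mem_nhds hNmem) w hw)
  · refine Eventually.of_forall fun w hw t ht => ?_
    have hw' := mem_unit_of_uIoc hw
    have hu := one_sub_sq_mem hw'
    have h1 : ‖Complex.exp (-(s + t * ((1 - w ^ 2 : ℝ) : ℂ)))‖ ≤ 1 := by
      rw [Complex.norm_exp, Real.exp_le_one_iff, Complex.neg_re]
      linarith [hre t ht w hw']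
    have h2 : ‖((1 - w ^ 2 : ℝ) : ℂ)‖ ≤ 1 := by
      rw [Complex.norm_real, Real.norm_eq_abs, abs_of_nonneg hu.1]; exact hu.2
    rw [hF']
    simp only [norm_div, norm_neg, norm_mul, norm_pow]
    refine div_le_div₀ zero_le_one (mul_le_one₀ h1 (norm_nonneg _) h2) (by positivity) ?_
    exact pow_le_pow_left₀ hpos.le (hden t ht w hw') 2
  · refine Eventually.of_forall fun w hw t ht => ?_
    have hw' := mem_unit_of_uIoc hw
    have hlin : HasDerivAt (fun t : ℂ => -((s : ℂ) + t * ((1 - w ^ 2 : ℝ) : ℂ)))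
        (-((1 - w ^ 2 : ℝ) : ℂ)) t :=
      ((((hasDerivAt_id t).mul_const ((1 - w ^ 2 : ℝ) : ℂ)).const_add (s : ℂ)).neg).congr_deriv
        (by rw [one_mul])
    have h := (hlin.cexp.const_sub 1).inv (hne t ht w hw')
    simp only [one_div]
    refine h.congr_deriv ?_
    rw [hF']
    ring

lemma meanG_eq_re {s : ℝ} (r : ℝ) : meanG s r = (complexG s ((r ^ 2 : ℝ) : ℂ)).re := by
  have : complexG s ((r ^ 2 : ℝ) : ℂ) = ((meanG s r : ℝ) : ℂ) := by
    unfold complexG meanG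
    rw [← intervalIntegral.integral_ofReal]
    congr 1
    ext w
    unfold gfun
    push_cast
    rfl
  rw [this, Complex.ofReal_re]

lemma analyticAt_meanG {s : ℝ} (hs : 0 < s) (r : ℝ) : AnalyticAt ℝ (meanG s) r := by
  have hopen : IsOpen {t : ℂ | -s < t.re} := isOpen_lt continuous_const Complex.continuous_re
  have h1 := ((differentiableOn_complexG hs).analyticAt (hopen.mem_nhds
    (show -s < ((r ^ 2 : ℝ) : ℂ).re by rw [Complex.ofReal_re]; nlinarith [sq_nonneg r]))).re_ofReal
  have h2 : AnalyticAt ℝ (fun r : ℝ => r ^ 2) r := by fun_prop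
  have h3 := AnalyticAt.comp (g := fun x : ℝ => (complexG s x).re) (f := fun r : ℝ => r ^ 2) h1 h2
  refine h3.congr (Eventually.of_forall fun r' => ?_)
  exact (meanG_eq_re r').symm

/-- `H(s, r) = r G(s, r)`; the density `d` of a maximizer solves `H(log (1 + ρ), √β d) = √β`. -/
noncomputable def shoot (s r : ℝ) : ℝ := r * meanG s r

lemma analyticAt_shoot {s : ℝ} (hs : 0 < s) (r : ℝ) : AnalyticAt ℝ (shoot s) r :=
  analyticAt_id.mul (analyticAt_meanG hs r)

lemma continuous_shoot {s : ℝ} (hs : 0 < s) : Continuous (shoot s) :=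
  continuous_iff_continuousAt.2 fun r => (analyticAt_shoot hs r).continuousAt

lemma continuousAt_shoot {p : ℝ × ℝ} (hp : 0 < p.1) :
    ContinuousAt (fun q : ℝ × ℝ => shoot q.1 q.2) p :=
  continuousAt_snd.mul (continuousAt_meanG hp)

lemma le_shoot {s : ℝ} (hs : 0 < s) {r : ℝ} (hr : 0 ≤ r) : r ≤ shoot s r := by
  have := meanG_gt_one hs r
  unfold shoot; nlinarith

lemma shoot_zero (s : ℝ) : shoot s 0 = 0 := by simp [shoot]

lemma shoot_eq_sqrt_of_mem {ρ β d : ℝ} (hρ : 0 < ρ) (hβ : 0 < β)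
    (hd : d ∈ optimalDensities ρ β) : shoot (Real.log (1 + ρ)) (√β * d) = √β := by
  have := mul_meanG_of_mem hρ hβ hd
  unfold shoot
  rw [mul_assoc, this, mul_one]

lemma not_frequently_shoot_eq {s : ℝ} (hs : 0 < s) {C : ℝ} (hC : C ≠ 0) (r : ℝ) :
    ¬ ∃ᶠ x in 𝓝[≠] r, shoot s x = C := fun h => by
  have := AnalyticOnNhd.eqOn_of_preconnected_of_frequently_eq (f := shoot s) (g := fun _ => C)
    (U := univ) (fun x _ => analyticAt_shoot hs x) (fun x _ => analyticAt_const)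
    isPreconnected_univ (mem_univ r) h (mem_univ 0)
  rw [shoot_zero] at this
  exact hC this.symm

lemma optimalDensities_finite {ρ β : ℝ} (hρ : 0 < ρ) (hβ : 0 < β) :
    (optimalDensities ρ β).Finite := by
  have hsq : 0 < √β := Real.sqrt_pos.2 hβ
  by_contra hinf
  have hinf' : ((fun d => √β * d) '' optimalDensities ρ β).Infinite :=
    Set.Infinite.image (fun a _ b _ h => mul_left_cancel₀ hsq.ne' h) hinf
  obtain ⟨x, -, hx⟩ := hinf'.exists_accPt_of_subset_isCompact (K := Icc 0 √β) isCompact_Icc (by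
    rintro _ ⟨d, hd, rfl⟩
    have := optimalDensities_subset_Icc ρ β hd
    exact ⟨mul_nonneg hsq.le this.1, mul_le_of_le_one_right hsq.le this.2⟩)
  rw [accPt_iff_frequently_nhdsNE] at hx
  refine not_frequently_shoot_eq (log_one_add_pos hρ) hsq.ne' x (hx.mono ?_)
  rintro _ ⟨d, hd, rfl⟩
  exact shoot_eq_sqrt_of_mem hρ hβ hd

lemma strictMonoOn_shoot {s : ℝ} (hs : 0 < s) (h : MonotoneOn (shoot s) (Ici 0)) :
    StrictMonoOn (shoot s) (Ici 0) := by
  intro a ha b hb hab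
  refine (h ha hb hab.le).lt_of_ne fun heq => ?_
  have hb' : 0 < b := lt_of_le_of_lt ha hab
  have hC : shoot s b ≠ 0 := (hb'.trans_le (le_shoot hs hb'.le)).ne'
  refine not_frequently_shoot_eq hs hC ((a + b) / 2) (Eventually.frequently ?_)
  refine eventually_nhdsWithin_of_eventually_nhds ?_
  filter_upwards [Ioo_mem_nhds (show a < (a + b) / 2 by linarith) (show (a + b) / 2 < b by linarith)]
    with x hx
  have hx0 : x ∈ Ici (0 : ℝ) := le_trans ha hx.1.le
  exact le_antisymm (h hx0 hb hx.2.le) (heq ▸ h ha hx0 hx.1.le)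

lemma meanG_le_log {s r : ℝ} (hs : 0 < s) (hr : 0 < r) :
    meanG s r ≤ 1 + (Real.log (s + r ^ 2) - Real.log s) / r ^ 2 := by
  have hpos : ∀ w ∈ Icc (0 : ℝ) 1, 0 < s + r ^ 2 * (1 - w) := fun w hw => by
    have := mul_nonneg (sq_nonneg r) (sub_nonneg.2 hw.2)
    linarith
  have hcont : ContinuousOn (fun w : ℝ => 1 / (s + r ^ 2 * (1 - w))) (Icc 0 1) :=
    continuousOn_const.div (by fun_prop) fun w hw => (hpos w hw).ne'
  have hint := intervalIntegrable_of_continuousOn_unit hcont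
  have h1 : meanG s r ≤ ∫ w in (0 : ℝ)..1, (1 + 1 / (s + r ^ 2 * (1 - w))) := by
    refine intervalIntegral.integral_mono_on zero_le_one (gfun_arg_intervalIntegrable hs r)
      (intervalIntegrable_const.add hint) fun w hw => (gfun_le (arg_pos hs hw)).trans ?_
    have : 1 / (s + r ^ 2 * (1 - w ^ 2)) ≤ 1 / (s + r ^ 2 * (1 - w)) := by
      refine one_div_le_one_div_of_le (hpos w hw) ?_
      have : w ^ 2 ≤ w := by nlinarith [hw.1, hw.2]
      nlinarith [sq_nonneg r]
    linarith
  have h2 : ∫ w in (0 : ℝ)..1, 1 / (s + r ^ 2 * (1 - w)) =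
      (Real.log (s + r ^ 2) - Real.log s) / r ^ 2 := by
    rw [intervalIntegral.integral_eq_sub_of_hasDerivAt
      (f := fun w => -(Real.log (s + r ^ 2 * (1 - w)) / r ^ 2)) (fun w hw => ?_) hint]
    · simp only [sub_self, mul_zero, add_zero, sub_zero, mul_one]; ring
    · rw [uIcc_of_le zero_le_one] at hw
      have hlin : HasDerivAt (fun w : ℝ => s + r ^ 2 * (1 - w)) (-r ^ 2) w :=
        ((((hasDerivAt_id w).const_sub 1).const_mul (r ^ 2)).const_add s).congr_deriv (by ring)
      refine ((hlin.log (hpos w hw).ne').div_const (r ^ 2)).neg.congr_deriv ?_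
      have := hpos w hw
      field_simp
  rw [intervalIntegral.integral_add intervalIntegrable_const hint, h2] at h1
  simpa using h1

lemma meanG_le {s r : ℝ} (hs : 0 < s) (hr : 1 ≤ r) : meanG s r ≤ 1 + (2 + 2 / √s) / r := by
  have h := meanG_le_log hs (by linarith : 0 < r)
  have hsq := Real.sqrt_pos.2 hs
  have h1 : Real.log (s + r ^ 2) - Real.log s ≤ 2 * (1 + r / √s) := by
    rw [← Real.log_div (by positivity) hs.ne']
    have h2 : (s + r ^ 2) / s ≤ (1 + r / √s) ^ 2 := by
      have : (1 + r / √s) ^ 2 = 1 + 2 * (r / √s) + r ^ 2 / s := by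
        rw [add_sq, div_pow, Real.sq_sqrt hs.le]; ring
      rw [this, add_div, div_self hs.ne']
      have : 0 ≤ r / √s := by positivity
      linarith
    calc _ ≤ Real.log ((1 + r / √s) ^ 2) := Real.log_le_log (by positivity) h2
      _ = 2 * Real.log (1 + r / √s) := by rw [Real.log_pow]; norm_num
      _ ≤ 2 * (1 + r / √s) := by
        have := Real.log_le_self (show 0 ≤ 1 + r / √s by positivity)
        linarith
  have h2 : 2 * (1 + r / √s) / r ^ 2 ≤ (2 + 2 / √s) / r := by
    rw [div_le_div_iff₀ (by positivity) (by positivity)]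
    have : 2 * (1 + r / √s) ≤ (2 + 2 / √s) * r := by
      have : (2 + 2 / √s) * r = 2 * r + 2 * (r / √s) := by ring
      rw [this]; linarith
    calc _ ≤ (2 + 2 / √s) * r * r := by gcongr
      _ = _ := by ring
  have h3 : (Real.log (s + r ^ 2) - Real.log s) / r ^ 2 ≤ 2 * (1 + r / √s) / r ^ 2 := by gcongr
  linarith

lemma mul_gfun_mono {s u r₁ r₂ : ℝ} (hs : Real.log 2 ≤ s) (hu : 0 ≤ u) (h₁ : 0 ≤ r₁)
    (h₂ : r₁ ≤ r₂) : r₁ * gfun (s + r₁ ^ 2 * u) ≤ r₂ * gfun (s + r₂ ^ 2 * u) := by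
  have hs0 : 0 < s := (Real.log_pos one_lt_two).trans_le hs
  set A := r₁ ^ 2 * u with hA
  set B := r₂ ^ 2 * u with hB
  have hA0 : 0 ≤ A := by positivity
  have hB0 : 0 ≤ B := by positivity
  set q := Real.exp (-s) with hq
  have hq0 : 0 < q := Real.exp_pos _
  have hq2 : q ≤ 1 / 2 := by
    have : Real.exp (-s) ≤ Real.exp (-Real.log 2) := Real.exp_le_exp.2 (by linarith)
    rw [Real.exp_neg (Real.log 2), Real.exp_log two_pos] at this
    rw [hq]; linarith
  have hkey : r₂ * Real.exp (-A) - r₁ * Real.exp (-B) ≤ 2 * (r₂ - r₁) := by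
    have heA : Real.exp (-A) ≤ 1 := Real.exp_le_one_iff.2 (by linarith)
    have heA0 := Real.exp_pos (-A)
    have heB0 := Real.exp_pos (-B)
    rcases le_or_gt (2 * r₁) r₂ with h | h
    · nlinarith [mul_nonneg h₁ heB0.le]
    · have hexp : Real.exp (-A) * (1 - (B - A)) ≤ Real.exp (-B) := by
        have e : Real.exp (-B) = Real.exp (-A) * Real.exp (-(B - A)) := by
          rw [← Real.exp_add]; ring_nf
        rw [e]
        gcongr
        linarith [Real.add_one_le_exp (-(B - A))]
      have h3 : Real.exp (-A) * (1 + 3 * A) ≤ 2 := by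
        have h4 := Real.quadratic_le_exp_of_nonneg hA0
        have h5 : 1 + 3 * A ≤ 2 * Real.exp A := by nlinarith [sq_nonneg (A - 1)]
        calc _ ≤ Real.exp (-A) * (2 * Real.exp A) := by gcongr
          _ = 2 := by rw [Real.exp_neg]; field_simp
      have h6 : r₁ * (B - A) ≤ (r₂ - r₁) * (3 * A) := by
        have e : r₁ * (B - A) = (r₂ - r₁) * (r₁ * (r₁ + r₂) * u) := by rw [hA, hB]; ring
        rw [e]
        refine mul_le_mul_of_nonneg_left ?_ (by linarith)
        rw [hA]
        nlinarith [mul_nonneg (mul_nonneg h₁ hu) (by linarith : 0 ≤ 2 * r₁ - r₂)]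
      calc r₂ * Real.exp (-A) - r₁ * Real.exp (-B)
          ≤ r₂ * Real.exp (-A) - r₁ * (Real.exp (-A) * (1 - (B - A))) := by gcongr
        _ = Real.exp (-A) * ((r₂ - r₁) + r₁ * (B - A)) := by ring
        _ ≤ Real.exp (-A) * ((r₂ - r₁) + (r₂ - r₁) * (3 * A)) := by gcongr
        _ = (r₂ - r₁) * (Real.exp (-A) * (1 + 3 * A)) := by ring
        _ ≤ (r₂ - r₁) * 2 := by
            refine mul_le_mul_of_nonneg_left h3 (by linarith)
        _ = _ := by ring
  unfold gfun
  have d1 := one_sub_exp_neg_pos (show 0 < s + A by linarith)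
  have d2 := one_sub_exp_neg_pos (show 0 < s + B by linarith)
  rw [mul_one_div, mul_one_div, div_le_div_iff₀ d1 d2]
  have e1 : Real.exp (-(s + A)) = q * Real.exp (-A) := by rw [hq, ← Real.exp_add]; ring_nf
  have e2 : Real.exp (-(s + B)) = q * Real.exp (-B) := by rw [hq, ← Real.exp_add]; ring_nf
  rw [e1, e2]
  have h7 : q * (r₂ * Real.exp (-A) - r₁ * Real.exp (-B)) ≤ q * (2 * (r₂ - r₁)) := by gcongr
  have h8 : q * (2 * (r₂ - r₁)) ≤ 1 / 2 * (2 * (r₂ - r₁)) := by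
    refine mul_le_mul_of_nonneg_right hq2 (by linarith)
  nlinarith

lemma shoot_monotoneOn {s : ℝ} (hs : Real.log 2 ≤ s) : MonotoneOn (shoot s) (Ici 0) := by
  intro r₁ h₁ r₂ h₂ h
  have hs0 : 0 < s := (Real.log_pos one_lt_two).trans_le hs
  unfold shoot meanG
  rw [← intervalIntegral.integral_const_mul, ← intervalIntegral.integral_const_mul]
  exact intervalIntegral.integral_mono_on zero_le_one
    ((gfun_arg_intervalIntegrable hs0 _).const_mul _)
    ((gfun_arg_intervalIntegrable hs0 _).const_mul _)
    fun w hw => mul_gfun_mono hs (one_sub_sq_mem hw).1 h₁ h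

lemma shoot_not_monotoneOn : ¬ MonotoneOn (shoot (1 / 400)) (Ici 0) := fun h => by
  have h1 := h (show (1 / 20 : ℝ) ∈ Ici (0 : ℝ) by simp) (show (1 : ℝ) ∈ Ici (0 : ℝ) by simp)
    (by norm_num)
  have h2 := meanG_le_log (show (0 : ℝ) < 1 / 400 by norm_num) zero_lt_one
  have h3 : Real.log (1 / 400 + 1 ^ 2) - Real.log (1 / 400) ≤ 7 := by
    rw [← Real.log_div (by norm_num) (by norm_num)]
    calc _ ≤ Real.log (2 ^ 9) := Real.log_le_log (by norm_num) (by norm_num)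
      _ = 9 * Real.log 2 := by rw [Real.log_pow]; norm_num
      _ ≤ 7 := by linarith [Real.log_two_lt_d9]
  have h4 : 200 ≤ meanG (1 / 400) (1 / 20) := by
    have := intervalIntegral.integral_mono_on zero_le_one
      (intervalIntegrable_const (c := (200 : ℝ)))
      (gfun_arg_intervalIntegrable (show (0 : ℝ) < 1 / 400 by norm_num) (1 / 20)) fun w hw => by
        refine le_trans ?_ (one_div_le_gfun (arg_pos (by norm_num) hw))
        rw [le_div_iff₀ (arg_pos (by norm_num) hw)]
        nlinarith [(one_sub_sq_mem hw).2]
    simpa [meanG] using this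
  unfold shoot at h1
  norm_num at h1 h2 h3
  norm_num at h4
  linarith

/-! ### The time map -/

/-- The inverse of `softplus`. -/
noncomputable def softplusInv (y : ℝ) : ℝ := Real.log (Real.exp y - 1)

lemma exp_sub_one_pos {y : ℝ} (hy : 0 < y) : 0 < Real.exp y - 1 := by
  linarith [Real.add_one_lt_exp hy.ne']

lemma softplus_softplusInv {y : ℝ} (hy : 0 < y) : softplus (softplusInv y) = y := by
  unfold softplus softplusInv
  rw [Real.exp_log (exp_sub_one_pos hy)]
  simp

lemma softplusInv_softplus (h : ℝ) : softplusInv (softplus h) = h := by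
  unfold softplusInv
  rw [exp_softplus]
  simp

lemma softplus_strictMono : StrictMono softplus := fun a b h =>
  Real.log_lt_log (by positivity) (by gcongr)

lemma hasDerivAt_softplusInv {y : ℝ} (hy : 0 < y) : HasDerivAt softplusInv (gfun y) y := by
  have := exp_sub_one_pos hy
  refine (((Real.hasDerivAt_exp y).sub_const 1).log this.ne').congr_deriv ?_
  unfold gfun
  rw [Real.exp_neg]
  have := Real.exp_pos y
  field_simp

lemma timeMap_eq {ρ a : ℝ} (hρ : 0 < ρ) (ha : Real.log ρ < a) :
    timeMap a ρ = 2 * shoot (Real.log (1 + ρ)) √(softplus a - Real.log (1 + ρ)) := by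
  set s := Real.log (1 + ρ) with hs
  have hs0 : 0 < s := log_one_add_pos hρ
  have hlog : softplus (Real.log ρ) = s := by rw [softplus, Real.exp_log hρ]
  have hsa : s < softplus a := hlog ▸ softplus_strictMono ha
  set r := √(softplus a - s) with hr
  have hr0 : 0 < r := Real.sqrt_pos.2 (by linarith)
  have hr2 : s + r ^ 2 = softplus a := by rw [hr, Real.sq_sqrt (by linarith)]; ring
  set y : ℝ → ℝ := fun w => s + r ^ 2 * (1 - w ^ 2) with hy
  have hypos : ∀ w ∈ Ioo (0 : ℝ) 1, 0 < y w := fun w hw => arg_pos hs0 (Ioo_subset_Icc_self hw)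
  have hyder : ∀ w, HasDerivAt y (-(2 * r ^ 2 * w)) w := fun w =>
    (((((hasDerivAt_id w).pow 2).const_sub 1).const_mul (r ^ 2)).const_add s).congr_deriv (by
      simp; ring)
  have hyinj : InjOn y (Ioo 0 1) := fun v hv w hw h => by
    have : v ^ 2 = w ^ 2 := by
      have h' : r ^ 2 * (1 - v ^ 2) = r ^ 2 * (1 - w ^ 2) := by simpa [hy] using h
      have := mul_left_cancel₀ (pow_pos hr0 2).ne' h'
      linarith
    exact (pow_left_inj₀ hv.1.le hw.1.le two_ne_zero).1 this
  have himage : (fun w => softplusInv (y w)) '' Ioo 0 1 = Ioo (Real.log ρ) a := by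
    ext z
    constructor
    · rintro ⟨w, hw, rfl⟩
      have hw2 : w ^ 2 < 1 := pow_lt_one₀ hw.1.le hw.2 two_ne_zero
      have hw3 : 0 < w ^ 2 := pow_pos hw.1 2
      have hr3 : 0 < r ^ 2 := pow_pos hr0 2
      constructor
      · rw [← softplus_strictMono.lt_iff_lt, softplus_softplusInv (hypos w hw), hlog]
        simp only [hy]; nlinarith
      · rw [← softplus_strictMono.lt_iff_lt, softplus_softplusInv (hypos w hw), ← hr2]
        simp only [hy]; nlinarith
    · intro hz
      have h1 : s < softplus z := hlog ▸ softplus_strictMono hz.1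
      have h2 : softplus z < s + r ^ 2 := hr2 ▸ softplus_strictMono hz.2
      have h3 : 0 < (s + r ^ 2 - softplus z) / r ^ 2 := div_pos (by linarith) (by positivity)
      have h4 : (s + r ^ 2 - softplus z) / r ^ 2 < 1 := by
        rw [div_lt_one (by positivity)]; linarith
      refine ⟨√((s + r ^ 2 - softplus z) / r ^ 2), ⟨Real.sqrt_pos.2 h3, ?_⟩, ?_⟩
      · rw [Real.sqrt_lt' one_pos]; simpa using h4
      · have : y √((s + r ^ 2 - softplus z) / r ^ 2) = softplus z := by
          simp only [hy]
          rw [Real.sq_sqrt h3.le]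
          field_simp
          ring
        simp only [this, softplusInv_softplus]
  have hder : ∀ w ∈ Ioo (0 : ℝ) 1, HasDerivWithinAt (fun w => softplusInv (y w))
      (gfun (y w) * -(2 * r ^ 2 * w)) (Ioo 0 1) w := fun w hw =>
    ((hasDerivAt_softplusInv (hypos w hw)).comp w (hyder w)).hasDerivWithinAt
  have hinj : InjOn (fun w => softplusInv (y w)) (Ioo 0 1) := fun v hv w hw h => by
    refine hyinj hv hw ?_
    have := congrArg softplus h
    simpa only [softplus_softplusInv (hypos v hv), softplus_softplusInv (hypos w hw)] using this
  have hcv := integral_image_eq_integral_abs_deriv_smul measurableSet_Ioo hder hinj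
    (fun x => 1 / √(Real.log ((1 + Real.exp a) / (1 + Real.exp x))))
  rw [himage] at hcv
  rw [timeMap, intervalIntegral.integral_of_le ha.le, integral_Ioc_eq_integral_Ioo, hcv, shoot,
    meanG, intervalIntegral.integral_of_le zero_le_one, integral_Ioc_eq_integral_Ioo,
    ← integral_const_mul, ← integral_const_mul]
  refine setIntegral_congr_fun measurableSet_Ioo fun w hw => ?_
  have hg : 0 < gfun (y w) := zero_lt_one.trans (gfun_gt_one (hypos w hw))
  have h1 : Real.log ((1 + Real.exp a) / (1 + Real.exp (softplusInv (y w)))) = (r * w) ^ 2 := by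
    rw [Real.log_div (by positivity) (by positivity)]
    change softplus a - softplus (softplusInv (y w)) = _
    rw [softplus_softplusInv (hypos w hw), ← hr2]
    simp only [hy]; ring
  have hw0 := hw.1
  simp only [smul_eq_mul, h1]
  rw [Real.sqrt_sq (by positivity), mul_neg, abs_neg, abs_of_pos (by positivity)]
  field_simp
  rfl

lemma mem_nonmonotoneSet_iff {ρ : ℝ} (hρ : 0 < ρ) :
    ρ ∈ nonmonotoneSet ↔ ¬ MonotoneOn (shoot (Real.log (1 + ρ))) (Ici 0) := by
  have hs0 := log_one_add_pos hρ
  have hlog : softplus (Real.log ρ) = Real.log (1 + ρ) := by rw [softplus, Real.exp_log hρ]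
  have hdiff : ∀ a ∈ Ioi (Real.log ρ), DifferentiableAt ℝ (fun b => timeMap b ρ) a := by
    intro a ha
    have hsa : Real.log (1 + ρ) < softplus a := hlog ▸ softplus_strictMono ha
    have h1 : DifferentiableAt ℝ (fun b => √(softplus b - Real.log (1 + ρ))) a :=
      (((hasDerivAt_softplus a).sub_const _).sqrt (by linarith)).differentiableAt
    have h2 := ((analyticAt_shoot hs0 √(softplus a - Real.log (1 + ρ))).differentiableAt.comp a
      h1).const_mul 2
    refine h2.congr_of_eventuallyEq ?_
    filter_upwards [Ioi_mem_nhds ha] with b hb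
    exact timeMap_eq hρ hb
  constructor
  · rintro ⟨-, a, ha, hneg⟩ hmono
    have hT : MonotoneOn (fun b => timeMap b ρ) (Ioi (Real.log ρ)) := by
      intro b hb c hc hbc
      simp only
      rw [timeMap_eq hρ hb, timeMap_eq hρ hc]
      have := hmono (Real.sqrt_nonneg (softplus b - Real.log (1 + ρ))) (Real.sqrt_nonneg _)
        (Real.sqrt_le_sqrt (sub_le_sub_right (softplus_mono hbc) (Real.log (1 + ρ))))
      linarith
    have := hT.derivWithin_nonneg (x := a)
    rw [derivWithin_of_isOpen isOpen_Ioi ha] at this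
    linarith
  · intro hnot
    refine ⟨hρ, ?_⟩
    by_contra! hnn
    refine hnot ?_
    have hT : MonotoneOn (fun b => timeMap b ρ) (Ioi (Real.log ρ)) :=
      monotoneOn_of_deriv_nonneg (convex_Ioi _)
        (fun a ha => (hdiff a ha).continuousAt.continuousWithinAt)
        (by rw [interior_Ioi]; exact fun a ha => (hdiff a ha).differentiableWithinAt)
        (by rw [interior_Ioi]; exact fun a ha => hnn a ha)
    have hS : MonotoneOn (shoot (Real.log (1 + ρ))) (Ioi 0) := by
      have harg : ∀ r ∈ Ioi (0 : ℝ), Real.log ρ < softplusInv (Real.log (1 + ρ) + r ^ 2) ∧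
          timeMap (softplusInv (Real.log (1 + ρ) + r ^ 2)) ρ =
            2 * shoot (Real.log (1 + ρ)) r := by
        intro r hr
        have hr2 : 0 < r ^ 2 := pow_pos hr 2
        have h1 : Real.log ρ < softplusInv (Real.log (1 + ρ) + r ^ 2) := by
          rw [← softplus_strictMono.lt_iff_lt, softplus_softplusInv (by linarith), hlog]
          linarith
        refine ⟨h1, ?_⟩
        rw [timeMap_eq hρ h1, softplus_softplusInv (by linarith), add_sub_cancel_left,
          Real.sqrt_sq (le_of_lt hr)]
      intro r₁ h₁ r₂ h₂ h
      have hr1 : 0 < r₁ := h₁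
      have hle : softplusInv (Real.log (1 + ρ) + r₁ ^ 2) ≤
          softplusInv (Real.log (1 + ρ) + r₂ ^ 2) := by
        rw [← softplus_strictMono.le_iff_le, softplus_softplusInv (by positivity),
          softplus_softplusInv (by positivity)]
        gcongr
      have := hT (harg r₁ h₁).1 (harg r₂ h₂).1 hle
      simp only [(harg r₁ h₁).2, (harg r₂ h₂).2] at this
      linarith
    intro r₁ h₁ r₂ h₂ h
    rcases (show (0 : ℝ) ≤ r₁ from h₁).eq_or_lt with h0 | h0
    · rw [← h0, shoot_zero]
      exact le_trans h₂ (le_shoot hs0 h₂)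
    · exact hS h0 (h0.trans_le h) h

lemma isLUB_criticalRho : IsLUB nonmonotoneSet criticalRho := by
  refine isLUB_csSup ⟨Real.exp (1 / 400) - 1, ?_⟩ ⟨1, ?_⟩
  · rw [mem_nonmonotoneSet_iff (exp_sub_one_pos (by norm_num))]
    simpa using shoot_not_monotoneOn
  · intro ρ hρ
    by_contra! h
    refine (mem_nonmonotoneSet_iff hρ.1).1 hρ (shoot_monotoneOn ?_)
    exact Real.log_le_log two_pos (by linarith)

lemma criticalRho_pos : 0 < criticalRho := by
  have h : Real.exp (1 / 400) - 1 ∈ nonmonotoneSet := by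
    rw [mem_nonmonotoneSet_iff (exp_sub_one_pos (by norm_num))]
    simpa using shoot_not_monotoneOn
  exact h.1.trans_le (isLUB_criticalRho.1 h)

lemma isOpen_nonmonotoneSet : IsOpen nonmonotoneSet := by
  rw [isOpen_iff_mem_nhds]
  intro ρ hρ
  have hρ0 := hρ.1
  have hs0 := log_one_add_pos hρ0
  have h := (mem_nonmonotoneSet_iff hρ0).1 hρ
  simp only [MonotoneOn, not_forall, not_le] at h
  obtain ⟨r₁, h₁, r₂, h₂, hle, hlt⟩ := h
  have hcont : ∀ r : ℝ, ContinuousAt (fun x => shoot (Real.log (1 + x)) r) ρ := fun r => by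
    refine ContinuousAt.comp (f := fun x => (Real.log (1 + x), r))
      (g := fun q : ℝ × ℝ => shoot q.1 q.2) (continuousAt_shoot hs0) ?_
    exact ContinuousAt.prodMk (ContinuousAt.log (by fun_prop) (by positivity)) continuousAt_const
  filter_upwards [(hcont r₂).eventually_lt (hcont r₁) hlt, Ioi_mem_nhds hρ0] with x hx hx0
  rw [mem_nonmonotoneSet_iff hx0]
  exact fun hm => absurd (hm h₁ h₂ hle) (not_le.2 hx)

lemma criticalRho_not_mem : criticalRho ∉ nonmonotoneSet := fun h => by
  have := isOpen_nonmonotoneSet.mem_nhds h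
  obtain ⟨ε, hε, hball⟩ := Metric.mem_nhds_iff.1 this
  have h2 : criticalRho + ε / 2 ∈ nonmonotoneSet := hball (by
    rw [Metric.mem_ball, Real.dist_eq, add_sub_cancel_left, abs_of_pos (by linarith)]
    linarith)
  linarith [isLUB_criticalRho.1 h2]

lemma shoot_criticalRho_strictMonoOn :
    StrictMonoOn (shoot (Real.log (1 + criticalRho))) (Ici 0) := by
  refine strictMonoOn_shoot (log_one_add_pos criticalRho_pos) ?_
  by_contra h
  exact criticalRho_not_mem ((mem_nonmonotoneSet_iff criticalRho_pos).2 h)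

lemma frequently_mem_nonmonotoneSet : ∃ᶠ ρ in 𝓝[<] criticalRho, ρ ∈ nonmonotoneSet := by
  have h := isLUB_criticalRho.frequently_mem (isLUB_criticalRho.nonempty)
  rw [frequently_nhdsWithin_iff] at h ⊢
  exact h.mono fun x hx => ⟨hx.1, lt_of_le_of_ne (show x ≤ criticalRho from hx.2)
    fun e => criticalRho_not_mem (e ▸ hx.1)⟩

/-! ### Derivatives of the value -/

/-- Squeezing the increments of `f` between multiples of the increments of `m`. -/
lemma hasDerivAt_of_increment_le {f m g₁ g₂ : ℝ → ℝ} {x m' c : ℝ} (hm : HasDerivAt m m' x)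
    (hg₁ : Tendsto g₁ (𝓝 x) (𝓝 c)) (hg₂ : Tendsto g₂ (𝓝 x) (𝓝 c))
    (h₁ : ∀ᶠ y in 𝓝 x, (m y - m x) * g₁ y ≤ f y - f x)
    (h₂ : ∀ᶠ y in 𝓝 x, f y - f x ≤ (m y - m x) * g₂ y) : HasDerivAt f (c * m') x := by
  rw [hasDerivAt_iff_isLittleO] at hm ⊢
  have hO : (fun y => m y - m x) =O[𝓝 x] fun y => y - x := by
    have h := hm.isBigO.add ((Asymptotics.isBigO_refl (fun y : ℝ => y - x) (𝓝 x)).const_mul_left m')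
    refine h.congr_left fun y => ?_
    simp only [smul_eq_mul]; ring
  have hg0 : (fun y => |g₁ y - c| + |g₂ y - c|) =o[𝓝 x] fun _ => (1 : ℝ) := by
    rw [Asymptotics.isLittleO_one_iff]
    simpa using (hg₁.sub_const c).abs.add (hg₂.sub_const c).abs
  have h3 : (fun y => f y - f x - (m y - m x) * c) =o[𝓝 x] fun y => y - x := by
    have h4 := hO.mul_isLittleO hg0
    simp only [mul_one] at h4
    refine Asymptotics.IsBigO.trans_isLittleO (Asymptotics.IsBigO.of_bound 1 ?_) h4
    filter_upwards [h₁, h₂] with y hy1 hy2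
    have e1 : |(m y - m x) * (g₁ y - c)| = |m y - m x| * |g₁ y - c| := abs_mul _ _
    have e2 : |(m y - m x) * (g₂ y - c)| = |m y - m x| * |g₂ y - c| := abs_mul _ _
    rw [one_mul, norm_mul, Real.norm_eq_abs, Real.norm_eq_abs, Real.norm_eq_abs,
      abs_of_nonneg (add_nonneg (abs_nonneg (g₁ y - c)) (abs_nonneg _)), mul_add, ← e1, ← e2,
      abs_le]
    have b1 := neg_abs_le ((m y - m x) * (g₁ y - c))
    have b2 := le_abs_self ((m y - m x) * (g₂ y - c))
    have b3 := abs_nonneg ((m y - m x) * (g₁ y - c))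
    have b4 := abs_nonneg ((m y - m x) * (g₂ y - c))
    constructor <;> linarith
  have h5 := h3.add (hm.const_mul_left c)
  refine h5.congr_left fun y => ?_
  simp only [smul_eq_mul]; ring

lemma hasDerivAt_of_support {f m g : ℝ → ℝ} {x m' : ℝ} (hm : HasDerivAt m m' x)
    (hg : ContinuousAt g x) (h1 : ∀ᶠ y in 𝓝 x, f x + (m y - m x) * g x ≤ f y)
    (h2 : ∀ᶠ y in 𝓝 x, f y + (m x - m y) * g y ≤ f x) : HasDerivAt f (g x * m') x :=
  hasDerivAt_of_increment_le hm tendsto_const_nhds hg (h1.mono fun y hy => by linarith)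
    (h2.mono fun y hy => by linarith)

lemma continuousAt_energyOf {ρ β d : ℝ} (hρ : 0 < ρ) (hβ : 0 < β) :
    ContinuousAt (fun x : (ℝ × ℝ) × ℝ => energyOf x.1.1 x.1.2 x.2) ((ρ, β), d) := by
  have hv : ContinuousAt (fun x : (ℝ × ℝ) × ℝ => value x.1.1 x.1.2) ((ρ, β), d) :=
    ContinuousAt.comp (f := fun x : (ℝ × ℝ) × ℝ => x.1) (g := fun q : ℝ × ℝ => value q.1 q.2)
      (continuousAt_value (p := (ρ, β)) hρ) continuousAt_fst
  unfold energyOf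
  refine ContinuousAt.add (by fun_prop) (ContinuousAt.div (ContinuousAt.sub
    (ContinuousAt.log (by fun_prop) ?_) hv) (by fun_prop) ?_)
  · change 1 + ρ ≠ 0; positivity
  · change 2 * β ≠ 0; positivity

/-- A choice of optimal density. -/
noncomputable def someDensity (p : ℝ × ℝ) : ℝ := sInf (optimalDensities p.1 p.2)

lemma someDensity_mem {p : ℝ × ℝ} (h1 : 0 < p.1) (h2 : 0 < p.2) :
    someDensity p ∈ optimalDensities p.1 p.2 :=
  (optimalDensities_nonempty h1 h2).csInf_mem (optimalDensities_finite h1 h2)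

lemma quadrant_mem_nhds {p : ℝ × ℝ} (h1 : 0 < p.1) (h2 : 0 < p.2) :
    ∀ᶠ q : ℝ × ℝ in 𝓝 p, 0 < q.1 ∧ 0 < q.2 :=
  (continuous_fst.continuousAt.eventually (lt_mem_nhds h1)).and
    (continuous_snd.continuousAt.eventually (lt_mem_nhds h2))

lemma continuousAt_someDensity {p : ℝ × ℝ} (h1 : 0 < p.1) (h2 : 0 < p.2)
    (h : (optimalDensities p.1 p.2).Subsingleton) : ContinuousAt someDensity p := by
  intro U hU
  obtain ⟨V, hVU, hV, hmem⟩ := mem_nhds_iff.1 hU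
  have hsub : optimalDensities p.1 p.2 ⊆ V := fun d hd => by
    rwa [h hd (someDensity_mem h1 h2)]
  have := eventually_optimalDensities_subset (ρ := p.1) (β := p.2) h1 h2 hV hsub
  change ∀ᶠ q in 𝓝 p, someDensity q ∈ U
  filter_upwards [this, quadrant_mem_nhds h1 h2] with q hq hq0
  exact hVU (hq (someDensity_mem hq0.1 hq0.2))

lemma continuousAt_energyOf_someDensity {p : ℝ × ℝ} (h1 : 0 < p.1) (h2 : 0 < p.2)
    (h : (optimalDensities p.1 p.2).Subsingleton) :
    ContinuousAt (fun q => energyOf q.1 q.2 (someDensity q)) p :=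
  ContinuousAt.comp (f := fun q : ℝ × ℝ => (q, someDensity q))
    (g := fun x : (ℝ × ℝ) × ℝ => energyOf x.1.1 x.1.2 x.2)
    (continuousAt_energyOf (ρ := p.1) (β := p.2) h1 h2)
    (continuousAt_id.prodMk (continuousAt_someDensity h1 h2 h))

lemma hasDerivAt_value_fst {ρ β : ℝ} (hρ : 0 < ρ) (hβ : 0 < β)
    (h : (optimalDensities ρ β).Subsingleton) :
    HasDerivAt (fun r => value r β) (someDensity (ρ, β) * ρ⁻¹) ρ := by
  refine hasDerivAt_of_support (g := fun r => someDensity (r, β)) (Real.hasDerivAt_log hρ.ne') ?_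
    (Eventually.of_forall fun r => ?_) ?_
  · exact ContinuousAt.comp (f := fun r => (r, β)) (g := someDensity)
      (continuousAt_someDensity (p := (ρ, β)) hρ hβ h) (by fun_prop)
  · have := value_support (ρ' := r) (β' := β) hρ hβ (someDensity_mem (p := (ρ, β)) hρ hβ)
    simpa using this
  · filter_upwards [lt_mem_nhds hρ] with r hr
    have := value_support (ρ' := ρ) (β' := β) hr hβ (someDensity_mem (p := (r, β)) hr hβ)
    simpa using this

lemma hasDerivAt_value_snd {ρ β : ℝ} (hρ : 0 < ρ) (hβ : 0 < β)
    (h : (optimalDensities ρ β).Subsingleton) :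
    HasDerivAt (fun b => value ρ b) (energyOf ρ β (someDensity (ρ, β)) * 1) β := by
  refine hasDerivAt_of_support (g := fun b => energyOf ρ b (someDensity (ρ, b)))
    (hasDerivAt_id β) ?_ (Eventually.of_forall fun b => ?_) ?_
  · exact ContinuousAt.comp (f := fun b => (ρ, b))
      (g := fun q : ℝ × ℝ => energyOf q.1 q.2 (someDensity q))
      (continuousAt_energyOf_someDensity (p := (ρ, β)) hρ hβ h) (by fun_prop)
  · have := value_support (ρ' := ρ) (β' := b) hρ hβ (someDensity_mem (p := (ρ, β)) hρ hβ)
    simpa using this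
  · filter_upwards [lt_mem_nhds hβ] with b hb
    have := value_support (ρ' := ρ) (β' := β) hρ hb (someDensity_mem (p := (ρ, b)) hρ hb)
    simpa using this

lemma deriv_value_fst {ρ β d : ℝ} (hρ : 0 < ρ) (hβ : 0 < β) (hd : d ∈ optimalDensities ρ β)
    (h : DifferentiableAt ℝ (fun r => value r β) ρ) : deriv (fun r => value r β) ρ = d / ρ := by
  have hlog := ((Real.hasDerivAt_log hρ.ne').sub_const (Real.log ρ)).mul_const d
  have hmin : IsLocalMin (fun r => value r β - (Real.log r - Real.log ρ) * d) ρ :=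
    Eventually.of_forall fun r => by
      have := value_support (ρ' := r) (β' := β) hρ hβ hd
      simp only [sub_self, zero_mul, add_zero, sub_zero] at this ⊢
      linarith
  have := hmin.hasDerivAt_eq_zero (h.hasDerivAt.sub hlog)
  rw [div_eq_inv_mul]
  linarith

lemma deriv_value_snd {ρ β d : ℝ} (hρ : 0 < ρ) (hβ : 0 < β) (hd : d ∈ optimalDensities ρ β)
    (h : DifferentiableAt ℝ (fun b => value ρ b) β) :
    deriv (fun b => value ρ b) β = energyOf ρ β d := by
  have hlin := ((hasDerivAt_id β).sub_const β).mul_const (energyOf ρ β d)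
  have hmin : IsLocalMin (fun b => value ρ b - (id b - β) * energyOf ρ β d) β :=
    Eventually.of_forall fun b => by
      have := value_support (ρ' := ρ) (β' := b) hρ hβ hd
      simp only [sub_self, zero_mul, add_zero, sub_zero, id] at this ⊢
      linarith
  have := hmin.hasDerivAt_eq_zero (h.hasDerivAt.sub hlin)
  linarith

lemma support_monotone {ρ β ρ' β' d d' : ℝ} (hρ : 0 < ρ) (hβ : 0 < β) (hρ' : 0 < ρ') (hβ' : 0 < β')
    (hd : d ∈ optimalDensities ρ β) (hd' : d' ∈ optimalDensities ρ' β') :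
    0 ≤ (Real.log ρ' - Real.log ρ) * (d' - d) +
      (β' - β) * (energyOf ρ' β' d' - energyOf ρ β d) := by
  have h1 := value_support (ρ' := ρ') (β' := β') hρ hβ hd
  have h2 := value_support (ρ' := ρ) (β' := β) hρ' hβ' hd'
  nlinarith

lemma optimalDensities_mono {ρ ρ' β d d' : ℝ} (hρ : 0 < ρ) (h : ρ < ρ') (hβ : 0 < β)
    (hd : d ∈ optimalDensities ρ β) (hd' : d' ∈ optimalDensities ρ' β) : d ≤ d' := by
  have h1 := support_monotone hρ hβ (hρ.trans h) hβ hd hd'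
  have h2 := Real.log_lt_log hρ h
  simp only [sub_self, zero_mul, add_zero] at h1
  by_contra! hc
  linarith [mul_neg_of_pos_of_neg (sub_pos.2 h2) (sub_neg.2 hc)]

/-! ### First-order transitions are the points with several optimal densities -/

/-- `L` agrees with the variational value on the parameter quadrant. -/
def AgreesWithValue (L : ℝ → ℝ → ℝ) : Prop := ∀ ρ β : ℝ, 0 < ρ → 0 < β → L ρ β = value ρ β

namespace AgreesWithValue

variable {L : ℝ → ℝ → ℝ}

lemma eventuallyEq_fst (hL : AgreesWithValue L) {ρ β : ℝ} (hρ : 0 < ρ) (hβ : 0 < β) :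
    (fun r => L r β) =ᶠ[𝓝 ρ] fun r => value r β := by
  filter_upwards [lt_mem_nhds hρ] with r hr
  exact hL r β hr hβ

lemma eventuallyEq_snd (hL : AgreesWithValue L) {ρ β : ℝ} (hρ : 0 < ρ) (hβ : 0 < β) :
    (fun b => L ρ b) =ᶠ[𝓝 β] fun b => value ρ b := by
  filter_upwards [lt_mem_nhds hβ] with b hb
  exact hL ρ b hρ hb

lemma continuousAt (hL : AgreesWithValue L) {p : ℝ × ℝ} (h1 : 0 < p.1) (h2 : 0 < p.2) :
    ContinuousAt (fun q : ℝ × ℝ => L q.1 q.2) p := by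
  refine (continuousAt_value h1).congr ?_
  filter_upwards [quadrant_mem_nhds h1 h2] with q hq
  exact (hL q.1 q.2 hq.1 hq.2).symm

lemma partialRho_eq (hL : AgreesWithValue L) {p : ℝ × ℝ} (h1 : 0 < p.1) (h2 : 0 < p.2) {d : ℝ}
    (hd : d ∈ optimalDensities p.1 p.2) (h : DifferentiableAt ℝ (fun r => L r p.2) p.1) :
    partialRho L p = d / p.1 := by
  have e := hL.eventuallyEq_fst h1 h2
  rw [partialRho, e.deriv_eq]
  exact deriv_value_fst h1 h2 hd (h.congr_of_eventuallyEq e.symm)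

lemma partialBeta_eq (hL : AgreesWithValue L) {p : ℝ × ℝ} (h1 : 0 < p.1) (h2 : 0 < p.2) {d : ℝ}
    (hd : d ∈ optimalDensities p.1 p.2) (h : DifferentiableAt ℝ (fun b => L p.1 b) p.2) :
    partialBeta L p = energyOf p.1 p.2 d := by
  have e := hL.eventuallyEq_snd h1 h2
  rw [partialBeta, e.deriv_eq]
  exact deriv_value_snd h1 h2 hd (h.congr_of_eventuallyEq e.symm)

lemma differentiableAt_fst (hL : AgreesWithValue L) {p : ℝ × ℝ} (h1 : 0 < p.1) (h2 : 0 < p.2)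
    (h : (optimalDensities p.1 p.2).Subsingleton) :
    DifferentiableAt ℝ (fun r => L r p.2) p.1 :=
  (hasDerivAt_value_fst h1 h2 h).differentiableAt.congr_of_eventuallyEq (hL.eventuallyEq_fst h1 h2)

lemma differentiableAt_snd (hL : AgreesWithValue L) {p : ℝ × ℝ} (h1 : 0 < p.1) (h2 : 0 < p.2)
    (h : (optimalDensities p.1 p.2).Subsingleton) :
    DifferentiableAt ℝ (fun b => L p.1 b) p.2 :=
  (hasDerivAt_value_snd h1 h2 h).differentiableAt.congr_of_eventuallyEq (hL.eventuallyEq_snd h1 h2)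

end AgreesWithValue

lemma monotoneOn_value {β : ℝ} (hβ : 0 < β) : MonotoneOn (fun r => value r β) (Ioi 0) := by
  intro r hr r' hr' h
  have hr0 : 0 < r := hr
  have h1 := value_support (ρ' := r') (β' := β) hr0 hβ (someDensity_mem (p := (r, β)) hr0 hβ)
  have h2 := (optimalDensities_subset_Icc _ _ (someDensity_mem (p := (r, β)) hr0 hβ)).1
  have h3 := mul_nonneg (sub_nonneg.2 (Real.log_le_log hr0 h)) h2
  simp only [sub_self, zero_mul, add_zero] at h1 ⊢
  linarith

lemma dense_differentiableAt_value {β : ℝ} (hβ : 0 < β) :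
    Dense {r : ℝ | 0 < r → DifferentiableAt ℝ (fun r => value r β) r} := by
  refine Measure.dense_of_ae (μ := volume) ?_
  filter_upwards [(monotoneOn_value hβ).ae_differentiableWithinAt_of_mem] with r hr hr0
  exact (hr hr0).differentiableAt (Ioi_mem_nhds hr0)

lemma frequently_nhdsGT_of_dense {S : Set ℝ} (hS : Dense S) (x : ℝ) : ∃ᶠ y in 𝓝[>] x, y ∈ S := by
  intro h
  obtain ⟨b, hb, hsub⟩ := mem_nhdsGT_iff_exists_Ioo_subset.1 h
  obtain ⟨y, hyS, hy⟩ := hS.exists_between hb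
  exact hsub hy hyS

lemma frequently_nhdsLT_of_dense {S : Set ℝ} (hS : Dense S) (x : ℝ) : ∃ᶠ y in 𝓝[<] x, y ∈ S := by
  intro h
  obtain ⟨b, hb, hsub⟩ := mem_nhdsLT_iff_exists_Ioo_subset.1 h
  obtain ⟨y, hyS, hy⟩ := hS.exists_between hb
  exact hsub hy hyS

lemma firstOrderTransition_iff {L : ℝ → ℝ → ℝ} (hL : AgreesWithValue L) {p : ℝ × ℝ}
    (h1 : 0 < p.1) (h2 : 0 < p.2) :
    FirstOrderTransition L p ↔ ¬ (optimalDensities p.1 p.2).Subsingleton := by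
  constructor
  · rintro ⟨-, h⟩ hsub
    have hd := continuousAt_someDensity h1 h2 hsub
    have he := continuousAt_energyOf_someDensity h1 h2 hsub
    rcases h with h | h
    · refine h ⟨someDensity p / p.1, ?_⟩
      have : ContinuousAt (fun q : ℝ × ℝ => someDensity q / q.1) p :=
        hd.div continuousAt_fst h1.ne'
      refine (this.tendsto.mono_left nhdsWithin_le_nhds).congr' ?_
      filter_upwards [self_mem_nhdsWithin, nhdsWithin_le_nhds (quadrant_mem_nhds h1 h2)]
        with q hq hq0
      exact (hL.partialRho_eq hq0.1 hq0.2 (someDensity_mem hq0.1 hq0.2) hq).symm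
    · refine h ⟨energyOf p.1 p.2 (someDensity p), ?_⟩
      refine (he.tendsto.mono_left nhdsWithin_le_nhds).congr' ?_
      filter_upwards [self_mem_nhdsWithin, nhdsWithin_le_nhds (quadrant_mem_nhds h1 h2)]
        with q hq hq0
      exact (hL.partialBeta_eq hq0.1 hq0.2 (someDensity_mem hq0.1 hq0.2) hq).symm
  · intro hns
    refine ⟨hL.continuousAt h1 h2, Or.inl ?_⟩
    rintro ⟨l, hl⟩
    obtain ⟨d₁, hd₁, d₂, hd₂, hlt⟩ : ∃ d₁ ∈ optimalDensities p.1 p.2,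
        ∃ d₂ ∈ optimalDensities p.1 p.2, d₁ < d₂ := by
      obtain ⟨d₁, hd₁, d₂, hd₂, hne⟩ := Set.not_subsingleton_iff.1 hns
      rcases hne.lt_or_gt with h | h
      · exact ⟨d₁, hd₁, d₂, hd₂, h⟩
      · exact ⟨d₂, hd₂, d₁, hd₁, h⟩
    have hline : Tendsto (fun r : ℝ => (r, p.2)) (𝓝 p.1) (𝓝 p) :=
      (Continuous.prodMk continuous_id continuous_const).tendsto' _ _ rfl
    have hpull : ∀ {P : ℝ → Prop}, (∀ᶠ x in 𝓝 l, P x) → ∀ᶠ r in 𝓝 p.1,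
        DifferentiableAt ℝ (fun r => L r p.2) r → P (partialRho L (r, p.2)) := fun hP =>
      hline.eventually (eventually_nhdsWithin_iff.1 (hl.eventually hP))
    have hdiff : ∀ r, 0 < r → (0 < r → DifferentiableAt ℝ (fun r => value r p.2) r) →
        DifferentiableAt ℝ (fun r => L r p.2) r := fun r hr h =>
      (h hr).congr_of_eventuallyEq (hL.eventuallyEq_fst hr h2)
    have hpos : ∀ᶠ r in 𝓝 p.1, 0 < r := lt_mem_nhds h1
    have hright : d₂ / p.1 ≤ l := by
      by_contra! hc
      obtain ⟨c, hlc, hc⟩ := exists_between hc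
      have hcont : ∀ᶠ r in 𝓝 p.1, c < d₂ / r :=
        (continuousAt_const.div continuousAt_id h1.ne').eventually (lt_mem_nhds hc)
      obtain ⟨r, hr, hr1, hr2, hr3, hr4⟩ :=
        ((frequently_nhdsGT_of_dense (dense_differentiableAt_value h2) p.1).and_eventually
        (((hpull (gt_mem_nhds hlc)).filter_mono nhdsWithin_le_nhds).and
        ((hcont.filter_mono nhdsWithin_le_nhds).and
        ((hpos.filter_mono nhdsWithin_le_nhds).and self_mem_nhdsWithin)))).exists
      have hm := someDensity_mem (p := (r, p.2)) hr3 h2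
      have hr5 := hdiff r hr3 hr
      have h5 := hr1 hr5
      rw [hL.partialRho_eq (p := (r, p.2)) hr3 h2 hm hr5] at h5
      have h6 : d₂ / r ≤ someDensity (r, p.2) / r := by
        gcongr
        exact optimalDensities_mono h1 hr4 h2 hd₂ hm
      change someDensity (r, p.2) / r < c at h5
      linarith
    have hleft : l ≤ d₁ / p.1 := by
      by_contra! hc
      obtain ⟨c, hc, hlc⟩ := exists_between hc
      have hcont : ∀ᶠ r in 𝓝 p.1, d₁ / r < c :=
        (continuousAt_const.div continuousAt_id h1.ne').eventually (gt_mem_nhds hc)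
      obtain ⟨r, hr, hr1, hr2, hr3, hr4⟩ :=
        ((frequently_nhdsLT_of_dense (dense_differentiableAt_value h2) p.1).and_eventually
        (((hpull (lt_mem_nhds hlc)).filter_mono nhdsWithin_le_nhds).and
        ((hcont.filter_mono nhdsWithin_le_nhds).and
        ((hpos.filter_mono nhdsWithin_le_nhds).and self_mem_nhdsWithin)))).exists
      have hm := someDensity_mem (p := (r, p.2)) hr3 h2
      have hr5 := hdiff r hr3 hr
      have h5 := hr1 hr5
      rw [hL.partialRho_eq (p := (r, p.2)) hr3 h2 hm hr5] at h5
      have h6 : someDensity (r, p.2) / r ≤ d₁ / r := by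
        gcongr
        exact optimalDensities_mono hr3 hr4 h2 hm hd₁
      change c < someDensity (r, p.2) / r at h5
      linarith
    have : d₁ / p.1 < d₂ / p.1 := by gcongr
    linarith

/-! ### The critical point -/

lemma exists_not_subsingleton {ρ : ℝ} (h : ρ ∈ nonmonotoneSet) :
    ∃ β, 0 < β ∧ ¬ (optimalDensities ρ β).Subsingleton := by
  have hρ := h.1
  have hs := log_one_add_pos hρ
  have hnm := (mem_nonmonotoneSet_iff hρ).1 h
  by_contra! H
  set r : ℝ → ℝ := fun β => √β * someDensity (ρ, β) with hr_def
  have hmem : ∀ β, 0 < β → someDensity (ρ, β) ∈ optimalDensities ρ β := fun β hβ =>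
    someDensity_mem (p := (ρ, β)) hρ hβ
  have hshoot : ∀ β, 0 < β → shoot (Real.log (1 + ρ)) (r β) = √β := fun β hβ =>
    shoot_eq_sqrt_of_mem hρ hβ (hmem β hβ)
  have hcont : ContinuousOn r (Ioi 0) := fun β hβ => by
    refine (ContinuousAt.mul (by fun_prop) ?_).continuousWithinAt
    exact ContinuousAt.comp (f := fun b => (ρ, b)) (g := someDensity)
      (continuousAt_someDensity (p := (ρ, β)) hρ hβ (H β hβ)) (by fun_prop)
  have hle : ∀ β, 0 < β → r β ≤ √β := fun β hβ =>
    mul_le_of_le_one_right (Real.sqrt_nonneg _) (optimalDensities_subset_Icc _ _ (hmem β hβ)).2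
  have hnonneg : ∀ β, 0 < β → 0 ≤ r β := fun β hβ =>
    mul_nonneg (Real.sqrt_nonneg _) (optimalDensities_subset_Icc _ _ (hmem β hβ)).1
  have hivt : ∀ β₁ β₂ v, 0 < β₁ → β₁ ≤ β₂ → r β₁ ≤ v → v ≤ r β₂ → ∃ β ∈ Icc β₁ β₂, r β = v := by
    intro β₁ β₂ v h0 h12 hv1 hv2
    exact intermediate_value_Icc h12 (hcont.mono fun x hx => h0.trans_le hx.1) ⟨hv1, hv2⟩
  have hsurj : ∀ v, 0 < v → 0 < shoot (Real.log (1 + ρ)) v →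
      r (shoot (Real.log (1 + ρ)) v ^ 2) = v := by
    intro v hv hsv
    obtain ⟨M, hM⟩ := (isCompact_Icc (a := (0 : ℝ)) (b := v)).exists_bound_of_continuousOn
      (continuous_shoot hs).continuousOn
    set B := max (v ^ 2) ((M + 1) ^ 2) with hB
    have hM0 : 0 ≤ M := (norm_nonneg _).trans (hM 0 ⟨le_rfl, hv.le⟩)
    have hB0 : 0 < B := lt_max_of_lt_left (by positivity)
    obtain ⟨β, hβ, hrβ⟩ := hivt (v ^ 2) B v (by positivity) (le_max_left _ _)
      ((hle _ (by positivity)).trans (by rw [Real.sqrt_sq hv.le])) (by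
        by_contra! hc
        have h1 := hM _ ⟨hnonneg B hB0, hc.le⟩
        rw [hshoot B hB0, Real.norm_eq_abs, abs_of_nonneg (Real.sqrt_nonneg _)] at h1
        have h2 : M + 1 ≤ √B := Real.le_sqrt_of_sq_le (le_max_right _ _)
        linarith)
    have hβ0 : 0 < β := lt_of_lt_of_le (by positivity) hβ.1
    have h1 := hshoot β hβ0
    rw [hrβ] at h1
    rw [h1, Real.sq_sqrt hβ0.le, hrβ]
  simp only [MonotoneOn, not_forall, not_le] at hnm
  obtain ⟨a, ha, b, hb, hab, hlt⟩ := hnm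
  have hb0 : 0 ≤ shoot (Real.log (1 + ρ)) b := le_trans hb (le_shoot hs hb)
  have ha0 : 0 < a := by
    rcases (show (0 : ℝ) ≤ a from ha).eq_or_lt with h0 | h0
    · rw [← h0, shoot_zero] at hlt; linarith
    · exact h0
  have hb1 : 0 < b := ha0.trans_le hab
  have hb2 : 0 < shoot (Real.log (1 + ρ)) b := hb1.trans_le (le_shoot hs hb)
  set β₀ := min (a ^ 2) (shoot (Real.log (1 + ρ)) b ^ 2) with hβ₀
  have hβ₀0 : 0 < β₀ := lt_min (by positivity) (by positivity)
  have h1 : r β₀ ≤ a := (hle _ hβ₀0).trans (by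
    rw [Real.sqrt_le_left ha0.le]; exact min_le_left _ _)
  obtain ⟨β, hβ, hrβ⟩ := hivt β₀ (shoot (Real.log (1 + ρ)) b ^ 2) a hβ₀0 (min_le_right _ _) h1 (by
    rw [hsurj b hb1 hb2]; exact hab)
  have h2 := hshoot β (hβ₀0.trans_le hβ.1)
  rw [hrβ] at h2
  have h3 : √β ≤ shoot (Real.log (1 + ρ)) b := by
    rw [Real.sqrt_le_left hb0]; exact hβ.2
  linarith

lemma meanG_le_gfun {s : ℝ} (hs : 0 < s) (r : ℝ) : meanG s r ≤ gfun s := by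
  have := intervalIntegral.integral_mono_on zero_le_one (gfun_arg_intervalIntegrable hs r)
    (intervalIntegrable_const (c := gfun s)) fun w hw => gfun_anti hs (le_arg s r hw)
  simpa [meanG] using this

/-- Two optimal densities at distance at least `ε` force `β` to be bounded. -/
lemma sqrt_le_of_gap {ρ β d₁ d₂ ε s : ℝ} (hρ : 0 < ρ) (hβ : 0 < β) (hε : 0 < ε) (hs : 0 < s)
    (hsρ : s ≤ Real.log (1 + ρ)) (h₁ : d₁ ∈ optimalDensities ρ β) (h₂ : d₂ ∈ optimalDensities ρ β)
    (hgap : d₁ + ε ≤ d₂) : √β ≤ max 1 ((2 + 2 / √s) / ε) * gfun s := by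
  have hsρ0 := hs.trans_le hsρ
  have hd1 := optimalDensities_subset_Ioo hρ hβ h₁
  have hd2 := optimalDensities_subset_Ioo hρ hβ h₂
  have heq := mul_meanG_of_mem hρ hβ h₁
  have hr0 : 0 < √β * d₁ := mul_pos (Real.sqrt_pos.2 hβ) hd1.1
  have hG : 1 + ε ≤ meanG (Real.log (1 + ρ)) (√β * d₁) := by
    have hG1 := meanG_gt_one hsρ0 (√β * d₁)
    nlinarith [hd1.1, hd2.2]
  have hr : √β * d₁ ≤ max 1 ((2 + 2 / √s) / ε) := by
    rcases le_total (√β * d₁) 1 with h | h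
    · exact h.trans (le_max_left _ _)
    · refine le_trans ?_ (le_max_right _ _)
      have h1 := hG.trans (meanG_le hsρ0 h)
      have h2 : 2 / √(Real.log (1 + ρ)) ≤ 2 / √s :=
        div_le_div_of_nonneg_left two_pos.le (Real.sqrt_pos.2 hs) (Real.sqrt_le_sqrt hsρ)
      rw [le_div_iff₀ hε]
      have h3 : ε ≤ (2 + 2 / √(Real.log (1 + ρ))) / (√β * d₁) := by linarith
      rw [le_div_iff₀ hr0] at h3
      linarith
  have hsh := shoot_eq_sqrt_of_mem hρ hβ h₁
  rw [← hsh]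
  unfold shoot
  have hg1 : meanG (Real.log (1 + ρ)) (√β * d₁) ≤ gfun s :=
    (meanG_le_gfun hsρ0 _).trans (gfun_anti hs hsρ)
  exact mul_le_mul hr hg1 (by linarith) (by positivity)

lemma eventually_optimalDensities_merge {ε : ℝ} (hε : 0 < ε) :
    ∀ᶠ ρ in 𝓝 criticalRho, ∀ β, 0 < β → ∀ d₁ ∈ optimalDensities ρ β, ∀ d₂ ∈ optimalDensities ρ β,
      |d₂ - d₁| < ε := by
  have hc := criticalRho_pos
  have hsc := log_one_add_pos hc
  by_contra H
  rw [not_eventually] at H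
  have H' : ∃ᶠ ρ in 𝓝 criticalRho, criticalRho / 2 < ρ ∧ ∃ β, 0 < β ∧
      ∃ d₁ ∈ optimalDensities ρ β, ∃ d₂ ∈ optimalDensities ρ β, d₁ + ε ≤ d₂ := by
    refine (H.and_eventually (lt_mem_nhds (half_lt_self hc))).mono ?_
    rintro ρ ⟨h, hρ⟩
    push Not at h
    obtain ⟨β, hβ, d₁, h₁, d₂, h₂, hge⟩ := h
    refine ⟨hρ, β, hβ, ?_⟩
    rcases le_abs.1 hge with h | h
    · exact ⟨d₁, h₁, d₂, h₂, by linarith⟩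
    · exact ⟨d₂, h₂, d₁, h₁, by linarith⟩
  obtain ⟨ρ, hρ, hseq⟩ := exists_seq_forall_of_frequently H'
  choose hρ2 β hβ d₁ h₁ d₂ h₂ hgap using hseq
  have hρ0 : ∀ n, 0 < ρ n := fun n => (half_pos hc).trans (hρ2 n)
  set s := Real.log (1 + criticalRho / 2)
  have hs : 0 < s := log_one_add_pos (half_pos hc)
  set M := max 1 ((2 + 2 / √s) / ε) * gfun s
  have hM : ∀ n, √(β n) ≤ M := fun n => sqrt_le_of_gap (hρ0 n) (hβ n) hε hs
    (Real.log_le_log (by positivity) (by linarith [hρ2 n])) (h₁ n) (h₂ n) (hgap n)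
  have hK : IsCompact (Icc (0 : ℝ) M ×ˢ (Icc (0 : ℝ) 1 ×ˢ Icc (0 : ℝ) 1)) :=
    isCompact_Icc.prod (isCompact_Icc.prod isCompact_Icc)
  obtain ⟨⟨b, e₁, e₂⟩, hmem, φ, hφ, hlim⟩ := hK.tendsto_subseq
    (x := fun n => (√(β n), d₁ n, d₂ n)) fun n => ⟨⟨Real.sqrt_nonneg _, hM n⟩,
      optimalDensities_subset_Icc _ _ (h₁ n), optimalDensities_subset_Icc _ _ (h₂ n)⟩
  have hb : Tendsto (fun n => √(β (φ n))) atTop (𝓝 b) := (continuous_fst.tendsto _).comp hlim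
  have he₁ : Tendsto (fun n => d₁ (φ n)) atTop (𝓝 e₁) :=
    ((continuous_fst.comp continuous_snd).tendsto _).comp hlim
  have he₂ : Tendsto (fun n => d₂ (φ n)) atTop (𝓝 e₂) :=
    ((continuous_snd.comp continuous_snd).tendsto _).comp hlim
  have hsl : Tendsto (fun n => Real.log (1 + ρ (φ n))) atTop (𝓝 (Real.log (1 + criticalRho))) :=
    (((hρ.comp hφ.tendsto_atTop).const_add 1)).log (by positivity)
  have hlimit : ∀ {d : ℕ → ℝ} {e : ℝ}, (∀ n, d n ∈ optimalDensities (ρ n) (β n)) →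
      Tendsto (fun n => d (φ n)) atTop (𝓝 e) →
      e * meanG (Real.log (1 + criticalRho)) (b * e) = 1 := by
    intro d e hd he
    have h1 := (continuousAt_meanG (p := (Real.log (1 + criticalRho), b * e)) hsc).tendsto.comp
      (hsl.prodMk_nhds (hb.mul he))
    refine tendsto_nhds_unique (he.mul h1) ?_
    refine tendsto_const_nhds.congr fun n => ?_
    exact (mul_meanG_of_mem (hρ0 (φ n)) (hβ (φ n)) (hd (φ n))).symm
  have hl₁ := hlimit h₁ he₁
  have hl₂ := hlimit h₂ he₂
  have hgap' : e₁ + ε ≤ e₂ := le_of_tendsto_of_tendsto' (he₁.add_const ε) he₂ fun n => hgap (φ n)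
  obtain ⟨⟨hb0, -⟩, ⟨he₁0, -⟩, ⟨he₂0, -⟩⟩ := hmem
  rcases hb0.eq_or_lt with h0 | h0
  · have h0' : b = 0 := h0.symm
    rw [h0', zero_mul] at hl₁ hl₂
    have := meanG_gt_one hsc 0
    nlinarith
  · have hinj := shoot_criticalRho_strictMonoOn.injOn (mul_nonneg hb0 he₁0) (mul_nonneg hb0 he₂0)
      (by unfold shoot; rw [mul_assoc, mul_assoc, hl₁, hl₂])
    have := mul_left_cancel₀ h0.ne' hinj
    linarith

lemma energyOf_sub (ρ β d e : ℝ) : energyOf ρ β d - energyOf ρ β e = (d ^ 2 - e ^ 2) / 2 := by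
  unfold energyOf; ring

lemma energyOf_eq (ρ β d : ℝ) : energyOf ρ β d = d ^ 2 / 2 + energyOf ρ β 0 := by
  unfold energyOf; ring

lemma continuousAt_energyOf_zero {p : ℝ × ℝ} (h1 : 0 < p.1) (h2 : 0 < p.2) :
    ContinuousAt (fun q : ℝ × ℝ => energyOf q.1 q.2 0) p :=
  ContinuousAt.comp (f := fun q : ℝ × ℝ => (q, (0 : ℝ)))
    (g := fun x : (ℝ × ℝ) × ℝ => energyOf x.1.1 x.1.2 x.2)
    (continuousAt_energyOf (ρ := p.1) (β := p.2) h1 h2) (by fun_prop)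

lemma exists_mem_of_frequently {p : ℝ × ℝ} (h1 : 0 < p.1) (h2 : 0 < p.2) {K : Set ℝ}
    (hK : IsClosed K) (h : ∃ᶠ q in 𝓝 p, ∃ d ∈ optimalDensities q.1 q.2, d ∈ K) :
    ∃ d ∈ optimalDensities p.1 p.2, d ∈ K := by
  by_contra! H
  refine h ?_
  filter_upwards [eventually_optimalDensities_subset (ρ := p.1) (β := p.2) h1 h2 hK.isOpen_compl H]
    with q hq
  rintro ⟨d, hd, hdK⟩
  exact hq hd hdK

/-- A continuous choice of density along a vertical segment stays in one component. -/
lemma someDensity_mem_of_segment {D : Set ℝ} {η : ℝ}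
    (hsep : ∀ e ∈ D, ∀ e' ∈ D, e ≠ e' → 3 * η ≤ dist e e') {ρ : ℝ} (hρ : 0 < ρ) {T : Set ℝ}
    (hT : IsPreconnected T)
    (hTD : ∀ β ∈ T, 0 < β ∧ (optimalDensities ρ β).Subsingleton ∧
      optimalDensities ρ β ⊆ ⋃ e ∈ D, Metric.ball e η)
    {e : ℝ} (he : e ∈ D) {β₁ β₂ : ℝ} (h₁ : β₁ ∈ T) (h₂ : β₂ ∈ T)
    (hs : someDensity (ρ, β₁) ∈ Metric.ball e η) : someDensity (ρ, β₂) ∈ Metric.ball e η := by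
  have hcont : ContinuousOn (fun β => someDensity (ρ, β)) T := fun β hβ =>
    (ContinuousAt.comp (f := fun b => (ρ, b)) (g := someDensity)
      (continuousAt_someDensity (p := (ρ, β)) hρ (hTD β hβ).1 (hTD β hβ).2.1)
      (by fun_prop)).continuousWithinAt
  have himg := hT.image _ hcont
  have hsub : (fun β => someDensity (ρ, β)) '' T ⊆
      Metric.ball e η ∪ ⋃ e' ∈ D \ {e}, Metric.ball e' η := by
    rintro _ ⟨β, hβ, rfl⟩
    have := (hTD β hβ).2.2 (someDensity_mem (p := (ρ, β)) hρ (hTD β hβ).1)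
    simp only [mem_iUnion] at this
    obtain ⟨e', he', hd⟩ := this
    by_cases h : e' = e
    · exact Or.inl (h ▸ hd)
    · exact Or.inr (mem_biUnion (show e' ∈ D \ {e} from ⟨he', h⟩) hd)
  have hdisj : Disjoint (Metric.ball e η) (⋃ e' ∈ D \ {e}, Metric.ball e' η) := by
    rw [disjoint_iUnion₂_right]
    intro e' he'
    refine Metric.ball_disjoint_ball ?_
    have := hsep e he e' he'.1 (Ne.symm he'.2)
    have h0 : 0 < η := Metric.pos_of_mem_ball hs
    linarith
  have h := himg.subset_left_of_subset_union Metric.isOpen_ball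
    (isOpen_biUnion fun _ _ => Metric.isOpen_ball) hdisj hsub ⟨_, ⟨β₁, h₁, rfl⟩, hs⟩
  exact h ⟨β₂, h₂, rfl⟩

lemma eventually_above_subset_ball {D : Set ℝ} {η ρ β b : ℝ} (hη : 0 < η) (hρ : 0 < ρ)
    (hβ : 0 < β) (hsep : ∀ e ∈ D, ∀ e' ∈ D, e ≠ e' → 3 * η ≤ dist e e')
    (hU : ∀ᶠ q : ℝ × ℝ in 𝓝 (ρ, β), optimalDensities q.1 q.2 ⊆ ⋃ e ∈ D, Metric.ball e η)
    (hb : b ∈ optimalDensities ρ β) (hbD : b ∈ D) (hηb : 3 * η ≤ b) (hmax : ∀ e ∈ D, e ≤ b) :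
    ∀ᶠ β' in 𝓝[>] β, optimalDensities ρ β' ⊆ Metric.ball b η := by
  have hline : Tendsto (fun b : ℝ => (ρ, b)) (𝓝 β) (𝓝 (ρ, β)) :=
    (Continuous.prodMk continuous_const continuous_id).tendsto' _ _ rfl
  have hc : 0 < η * (2 * b - η) / 2 := by
    have : 0 < 2 * b - η := by linarith
    positivity
  have hE : ∀ᶠ q : ℝ × ℝ in 𝓝 (ρ, β),
      energyOf q.1 q.2 0 < energyOf ρ β 0 + η * (2 * b - η) / 2 :=
    (continuousAt_energyOf_zero (p := (ρ, β)) hρ hβ).eventually (gt_mem_nhds (by simpa using hc))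
  filter_upwards [(hline.eventually hU).filter_mono nhdsWithin_le_nhds,
    (hline.eventually hE).filter_mono nhdsWithin_le_nhds, self_mem_nhdsWithin] with β' h1 h2 h3 d hd
  have h3' : β < β' := h3
  have hβ' : 0 < β' := hβ.trans h3'
  have hd0 := (optimalDensities_subset_Ioo hρ hβ' hd).1
  have hm := support_monotone hρ hβ hρ hβ' hb hd
  simp only [sub_self, zero_mul, zero_add] at hm
  have hm' : 0 ≤ energyOf ρ β' d - energyOf ρ β b := nonneg_of_mul_nonneg_right hm (sub_pos.2 h3')
  rw [energyOf_eq ρ β' d, energyOf_eq ρ β b] at hm'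
  have hdb : b - η < d := by
    by_contra! hc'
    nlinarith
  have hdU := h1 hd
  simp only [mem_iUnion] at hdU
  obtain ⟨e, he, hde⟩ := hdU
  by_cases heb : e = b
  · exact heb ▸ hde
  · exfalso
    have h4 := hsep e he b hbD heb
    rw [Real.dist_eq, abs_of_nonpos (by linarith [hmax e he])] at h4
    rw [Metric.mem_ball, Real.dist_eq, abs_lt] at hde
    linarith [hde.2]

lemma eventually_below_subset_ball {D : Set ℝ} {η ρ β a : ℝ} (hη : 0 < η) (hρ : 0 < ρ)
    (hβ : 0 < β) (hsep : ∀ e ∈ D, ∀ e' ∈ D, e ≠ e' → 3 * η ≤ dist e e')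
    (hU : ∀ᶠ q : ℝ × ℝ in 𝓝 (ρ, β), optimalDensities q.1 q.2 ⊆ ⋃ e ∈ D, Metric.ball e η)
    (ha : a ∈ optimalDensities ρ β) (haD : a ∈ D) (hmin : ∀ e ∈ D, a ≤ e) :
    ∀ᶠ β' in 𝓝[<] β, optimalDensities ρ β' ⊆ Metric.ball a η := by
  have hline : Tendsto (fun b : ℝ => (ρ, b)) (𝓝 β) (𝓝 (ρ, β)) :=
    (Continuous.prodMk continuous_const continuous_id).tendsto' _ _ rfl
  have ha0 := (optimalDensities_subset_Ioo hρ hβ ha).1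
  have hc : 0 < η * (2 * a + η) / 2 := by positivity
  have hE : ∀ᶠ q : ℝ × ℝ in 𝓝 (ρ, β),
      energyOf ρ β 0 - η * (2 * a + η) / 2 < energyOf q.1 q.2 0 :=
    (continuousAt_energyOf_zero (p := (ρ, β)) hρ hβ).eventually (lt_mem_nhds (by simpa using hc))
  filter_upwards [(hline.eventually hU).filter_mono nhdsWithin_le_nhds,
    (hline.eventually hE).filter_mono nhdsWithin_le_nhds, self_mem_nhdsWithin,
    (lt_mem_nhds hβ).filter_mono nhdsWithin_le_nhds] with β' h1 h2 h3 hβ' d hd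
  have h3' : β' < β := h3
  have hm := support_monotone hρ hβ' hρ hβ hd ha
  simp only [sub_self, zero_mul, zero_add] at hm
  have hm' : 0 ≤ energyOf ρ β a - energyOf ρ β' d := nonneg_of_mul_nonneg_right hm (sub_pos.2 h3')
  rw [energyOf_eq ρ β' d, energyOf_eq ρ β a] at hm'
  have hdb : d < a + η := by
    by_contra! hc'
    nlinarith
  have hdU := h1 hd
  simp only [mem_iUnion] at hdU
  obtain ⟨e, he, hde⟩ := hdU
  by_cases heb : e = a
  · exact heb ▸ hde
  · exfalso
    have h4 := hsep e he a haD heb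
    rw [Real.dist_eq, abs_of_nonneg (by linarith [hmin e he])] at h4
    rw [Metric.mem_ball, Real.dist_eq, abs_lt] at hde
    linarith [hde.1]

/-- The optimal densities near a transition curve, in terms of the extreme optimal densities on the
curve. -/
structure Phases (βcr : ℝ → ℝ) (ρ a b : ℝ) : Prop where
  pos : 0 < ρ ∧ 0 < βcr ρ
  left_mem : a ∈ optimalDensities ρ (βcr ρ)
  right_mem : b ∈ optimalDensities ρ (βcr ρ)
  lt : a < b
  le : ∀ d ∈ optimalDensities ρ (βcr ρ), a ≤ d ∧ d ≤ b
  continuousAt : ContinuousAt βcr ρ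
  eventually_below : ∀ ε > 0, ∀ᶠ p : ℝ × ℝ in 𝓝 (ρ, βcr ρ), p.2 < βcr p.1 →
    ∀ d ∈ optimalDensities p.1 p.2, |d - a| < ε
  eventually_above : ∀ ε > 0, ∀ᶠ p : ℝ × ℝ in 𝓝 (ρ, βcr ρ), βcr p.1 < p.2 →
    ∀ d ∈ optimalDensities p.1 p.2, |d - b| < ε

lemma exists_phases {L : ℝ → ℝ → ℝ} (hL : AgreesWithValue L) {J : Set ℝ} {βcr : ℝ → ℝ}
    (h : IsTransitionCurve L J βcr) {ρ : ℝ} (hρJ : ρ ∈ J) : ∃ a b, Phases βcr ρ a b := by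
  obtain ⟨hJ, V, hV, hVpos, hgraph, hiff⟩ := h
  set p₀ : ℝ × ℝ := (ρ, βcr ρ) with hp₀
  have hp₀V : p₀ ∈ V := hgraph ρ hρJ
  have hpos : ∀ p ∈ V, 0 < p.1 ∧ 0 < p.2 := fun p hp => ⟨(hVpos hp).1, (hVpos hp).2⟩
  have hsub : ∀ p ∈ V, p.2 ≠ βcr p.1 → (optimalDensities p.1 p.2).Subsingleton := by
    intro p hp hne
    by_contra hns
    exact hne ((hiff p hp).1 ((firstOrderTransition_iff hL (hpos p hp).1 (hpos p hp).2).2 hns)).2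
  obtain ⟨hρ, hβ⟩ : 0 < ρ ∧ 0 < βcr ρ := hpos p₀ hp₀V
  set D := optimalDensities ρ (βcr ρ) with hD
  have hfin : D.Finite := optimalDensities_finite hρ hβ
  have hne : D.Nonempty := optimalDensities_nonempty hρ hβ
  have hnt : D.Nontrivial := Set.not_subsingleton_iff.1
    ((firstOrderTransition_iff hL (p := p₀) hρ hβ).1 ((hiff p₀ hp₀V).2 ⟨hρJ, rfl⟩))
  obtain ⟨a, haD, hmin⟩ := hfin.exists_minimalFor id D hne
  obtain ⟨b, hbD, hmax⟩ := hfin.exists_maximalFor id D hne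
  have hmin' : ∀ e ∈ D, a ≤ e := fun e he => (le_total a e).elim id fun h => hmin he h
  have hmax' : ∀ e ∈ D, e ≤ b := fun e he => (le_total e b).elim id fun h => hmax he h
  have hab : a < b := by
    obtain ⟨x, hx, y, hy, hxy⟩ := hnt.exists_lt
    exact (hmin' x hx).trans_lt (hxy.trans_le (hmax' y hy))
  have ha0 : 0 < a := (optimalDensities_subset_Ioo hρ hβ haD).1
  -- the local picture at scale `η`
  have hlocal : ∀ η₀ > 0, ∃ η > 0, η ≤ η₀ ∧ (∀ e ∈ D, ∀ e' ∈ D, e ≠ e' → 3 * η ≤ dist e e') := by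
    intro η₀ hη₀
    have hs := hfin.infsep_pos_iff_nontrivial.2 hnt
    refine ⟨min η₀ (D.infsep / 3), lt_min hη₀ (by positivity), min_le_left _ _, ?_⟩
    intro e he e' he' hne
    have := Set.infsep_le_dist_of_mem he he' hne
    linarith [min_le_right η₀ (D.infsep / 3)]
  have hbox : ∀ η > 0, ∃ κ > 0, ∀ r β : ℝ, |r - ρ| < κ → |β - βcr ρ| < κ →
      (r, β) ∈ V ∧ optimalDensities r β ⊆ ⋃ e ∈ D, Metric.ball e η := by
    intro η hη
    have h1 := eventually_optimalDensities_subset hρ hβ (U := ⋃ e ∈ D, Metric.ball e η)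
      (isOpen_biUnion fun _ _ => Metric.isOpen_ball)
      fun d hd => mem_biUnion hd (Metric.mem_ball_self hη)
    obtain ⟨κ, hκ, hball⟩ := Metric.mem_nhds_iff.1
      (Filter.Eventually.and (hV.eventually_mem hp₀V) h1)
    refine ⟨κ, hκ, fun r β hr hβ' => ?_⟩
    have := @hball (r, β) (by
      rw [Metric.mem_ball, Prod.dist_eq, max_lt_iff, Real.dist_eq, Real.dist_eq]
      exact ⟨hr, hβ'⟩)
    exact this
  have hends : ∀ η > 0, (∀ e ∈ D, ∀ e' ∈ D, e ≠ e' → 3 * η ≤ dist e e') → ∀ κ > 0,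
      ∃ β₁ β₂, βcr ρ - κ < β₁ ∧ β₁ < βcr ρ ∧ βcr ρ < β₂ ∧ β₂ < βcr ρ + κ ∧ 
      ∀ᶠ r in 𝓝 ρ, optimalDensities r β₁ ⊆ Metric.ball a η ∧
        optimalDensities r β₂ ⊆ Metric.ball b η := by
    intro η hη hsep κ hκ
    have hU := eventually_optimalDensities_subset hρ hβ (U := ⋃ e ∈ D, Metric.ball e η)
      (isOpen_biUnion fun _ _ => Metric.isOpen_ball)
      fun d hd => mem_biUnion hd (Metric.mem_ball_self hη)
    have h3 : 3 * η ≤ b := by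
      have := hsep b hbD a haD hab.ne'
      rw [Real.dist_eq, abs_of_pos (by linarith)] at this
      linarith
    obtain ⟨β₁, hβ₁, hβ₁', hβ₁0⟩ := ((eventually_below_subset_ball hη hρ hβ hsep hU haD haD
      hmin').and (Ioo_mem_nhdsLT (show max 0 (βcr ρ - κ) < βcr ρ from
        max_lt hβ (by linarith)))).exists
    obtain ⟨β₂, hβ₂, hβ₂', hβ₂0⟩ := ((eventually_above_subset_ball hη hρ hβ hsep hU hbD hbD h3
      hmax').and (Ioo_mem_nhdsGT (show βcr ρ < βcr ρ + κ by linarith))).exists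
    refine ⟨β₁, β₂, (le_max_right _ _).trans_lt hβ₁', hβ₁0, hβ₂', hβ₂0, ?_⟩
    have hl : ∀ β : ℝ, Tendsto (fun r : ℝ => (r, β)) (𝓝 ρ) (𝓝 (ρ, β)) := fun β =>
      (Continuous.prodMk continuous_id continuous_const).tendsto' _ _ rfl
    exact ((hl β₁).eventually (eventually_optimalDensities_subset hρ
      ((le_max_left _ _).trans_lt hβ₁') Metric.isOpen_ball hβ₁)).and
      ((hl β₂).eventually (eventually_optimalDensities_subset hρ (hβ.trans hβ₂')
      Metric.isOpen_ball hβ₂))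
  have hcont : ContinuousAt βcr ρ := by
    rw [Metric.continuousAt_iff']
    intro ε hε
    obtain ⟨η, hη, -, hsep⟩ := hlocal 1 one_pos
    obtain ⟨κ, hκ, hκV⟩ := hbox η hη
    obtain ⟨β₁, β₂, h1, h2, h3, h4, hev⟩ := hends η hη hsep (min κ ε) (lt_min hκ hε)
    have hκ1 : min κ ε ≤ κ := min_le_left _ _
    have hκ2 : min κ ε ≤ ε := min_le_right _ _
    filter_upwards [hev, Metric.ball_mem_nhds ρ hκ] with r hr hrκ
    rw [Metric.mem_ball, Real.dist_eq] at hrκ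
    have hseg : ∀ β ∈ Icc β₁ β₂, |β - βcr ρ| < κ := fun β hβ' => by
      rw [abs_lt]; constructor <;> linarith [hβ'.1, hβ'.2]
    by_cases hmem : βcr r ∈ Icc β₁ β₂
    · rw [Real.dist_eq, abs_lt]
      constructor <;> linarith [hmem.1, hmem.2]
    · exfalso
      have hr0 : 0 < r := (hpos _ (hκV r (βcr ρ) hrκ (by simpa using hκ)).1).1
      have hT : ∀ β ∈ Icc β₁ β₂, 0 < β ∧ (optimalDensities r β).Subsingleton ∧
          optimalDensities r β ⊆ ⋃ e ∈ D, Metric.ball e η := fun β hβ' => by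
        have := hκV r β hrκ (hseg β hβ')
        refine ⟨(hpos _ this.1).2, hsub _ this.1 ?_, this.2⟩
        rintro (rfl : β = βcr r)
        exact hmem hβ'
      have m1 : β₁ ∈ Icc β₁ β₂ := ⟨le_rfl, by linarith⟩
      have m2 : β₂ ∈ Icc β₁ β₂ := ⟨by linarith, le_rfl⟩
      have e1 := someDensity_mem_of_segment hsep hr0 isPreconnected_Icc hT haD m1 m2
        (hr.1 (someDensity_mem (p := (r, β₁)) hr0 (hT β₁ m1).1))
      have e2 := hr.2 (someDensity_mem (p := (r, β₂)) hr0 (hT β₂ m2).1)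
      have h5 := hsep a haD b hbD hab.ne
      rw [Metric.mem_ball] at e1 e2
      have := dist_triangle_left a b (someDensity (r, β₂))
      linarith
  have hside : ∀ ε > 0, ∀ᶠ p : ℝ × ℝ in 𝓝 p₀,
      (p.2 < βcr p.1 → ∀ d ∈ optimalDensities p.1 p.2, |d - a| < ε) ∧
      (βcr p.1 < p.2 → ∀ d ∈ optimalDensities p.1 p.2, |d - b| < ε) := by
    intro ε hε
    obtain ⟨η, hη, hηε, hsep⟩ := hlocal ε hε
    obtain ⟨κ, hκ, hκV⟩ := hbox η hη
    obtain ⟨β₁, β₂, h1, h2, h3, h4, hev⟩ := hends η hη hsep κ hκ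
    have hfst : Tendsto (fun p : ℝ × ℝ => p.1) (𝓝 p₀) (𝓝 ρ) := continuous_fst.tendsto p₀
    have hβev : ∀ᶠ r in 𝓝 ρ, β₁ < βcr r ∧ βcr r < β₂ :=
      (hcont.eventually (lt_mem_nhds h2)).and (hcont.eventually (gt_mem_nhds h3))
    filter_upwards [hfst.eventually hev, hfst.eventually hβev,
      hfst.eventually (Metric.ball_mem_nhds ρ hκ),
      (continuous_snd.tendsto p₀).eventually (Metric.ball_mem_nhds (βcr ρ) hκ)] with p hp1 hp2 hp3 hp4
    obtain ⟨r, β⟩ := p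
    simp only [Real.dist_eq] at hp1 hp2 hp3 hp4
    have hr0 : 0 < r := (hpos _ (hκV r β hp3 hp4).1).1
    have hβ0 : 0 < β := (hpos _ (hκV r β hp3 hp4).1).2
    have key : ∀ β', |β' - βcr ρ| < κ → βcr r ∉ uIcc β' β → ∀ e ∈ D,
        optimalDensities r β' ⊆ Metric.ball e η → ∀ d ∈ optimalDensities r β, |d - e| < ε := by
      intro β' hβ' hnot e he hsube d hd
      have hT : ∀ x ∈ uIcc β' β, 0 < x ∧ (optimalDensities r x).Subsingleton ∧
          optimalDensities r x ⊆ ⋃ e ∈ D, Metric.ball e η := fun x hx => by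
        have hx' : |x - βcr ρ| < κ := by
          have := (convex_ball (βcr ρ) κ).ordConnected.uIcc_subset
            (show β' ∈ Metric.ball (βcr ρ) κ from hβ') (show β ∈ Metric.ball (βcr ρ) κ from hp4) hx
          exact this
        have := hκV r x hp3 hx'
        refine ⟨(hpos _ this.1).2, hsub _ this.1 ?_, this.2⟩
        rintro (rfl : x = βcr r)
        exact hnot hx
      have e1 := someDensity_mem_of_segment hsep hr0 isPreconnected_uIcc hT he left_mem_uIcc
        right_mem_uIcc (hsube (someDensity_mem (p := (r, β')) hr0 (hT β' left_mem_uIcc).1))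
      rw [← (hT β right_mem_uIcc).2.1 hd (someDensity_mem (p := (r, β)) hr0 hβ0)] at e1
      exact (Metric.mem_ball.1 e1).trans_le hηε
    constructor
    · intro hlt
      refine key β₁ (by rw [abs_lt]; constructor <;> linarith) ?_ a haD hp1.1
      intro hm
      exact absurd hm.2 (not_le.2 (max_lt hp2.1 hlt))
    · intro hlt
      refine key β₂ (by rw [abs_lt]; constructor <;> linarith) ?_ b hbD hp1.2
      intro hm
      exact absurd hm.1 (not_le.2 (lt_min hp2.2 hlt))
  exact ⟨a, b, ⟨hρ, hβ⟩, haD, hbD, hab, fun d hd => ⟨hmin' d hd, hmax' d hd⟩, hcont,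
    fun ε hε => (hside ε hε).mono fun p hp => hp.1, fun ε hε => (hside ε hε).mono fun p hp => hp.2⟩

lemma tendsto_energyOf {ι : Type*} {l : Filter ι} {p : ι → ℝ × ℝ} {u : ι → ℝ} {ρ β d : ℝ}
    (hρ : 0 < ρ) (hβ : 0 < β) (hp : Tendsto p l (𝓝 (ρ, β))) (hu : Tendsto u l (𝓝 d)) :
    Tendsto (fun i => energyOf (p i).1 (p i).2 (u i)) l (𝓝 (energyOf ρ β d)) :=
  Tendsto.comp (g := fun x : (ℝ × ℝ) × ℝ => energyOf x.1.1 x.1.2 x.2)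
    (f := fun i => (p i, u i)) (y := 𝓝 ((ρ, β), d))
    (continuousAt_energyOf (d := d) hρ hβ) (hp.prodMk_nhds hu)

namespace Phases

variable {βcr : ℝ → ℝ} {ρ a b : ℝ}

lemma tendsto_graph (h : Phases βcr ρ a b) :
    Tendsto (fun r => (r, βcr r)) (𝓝 ρ) (𝓝 (ρ, βcr ρ)) :=
  (continuousAt_id.prodMk h.continuousAt).tendsto

lemma eventually_graph (h : Phases βcr ρ a b) {ε : ℝ} (hε : 0 < ε) :
    ∀ᶠ r in 𝓝 ρ, (∃ d ∈ optimalDensities r (βcr r), |d - a| < ε) ∧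
      ∃ d ∈ optimalDensities r (βcr r), |d - b| < ε := by
  have hε2 : 0 < ε / 2 := by positivity
  have hev := h.tendsto_graph.eventually (((h.eventually_below _ hε2).and
    (h.eventually_above _ hε2)).eventually_nhds.and (quadrant_mem_nhds h.pos.1 h.pos.2))
  filter_upwards [hev] with r hr
  obtain ⟨hr, hr1, hr2⟩ := hr
  have hline : Tendsto (fun x : ℝ => (r, x)) (𝓝 (βcr r)) (𝓝 (r, βcr r)) :=
    (Continuous.prodMk continuous_const continuous_id).tendsto' _ _ rfl
  have hpos : ∀ᶠ x in 𝓝 (βcr r), 0 < x := lt_mem_nhds hr2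
  have key : ∀ c : ℝ, ∀ l ≤ 𝓝 (βcr r), l.NeBot →
      (∀ᶠ x in l, ∀ d ∈ optimalDensities r x, |d - c| < ε / 2) →
      ∃ d ∈ optimalDensities r (βcr r), |d - c| < ε := by
    intro c l hl hne hc
    have hfr : ∃ᶠ q in 𝓝 (r, βcr r), ∃ d ∈ optimalDensities q.1 q.2,
        d ∈ Metric.closedBall c (ε / 2) := by
      refine (hline.mono_left hl).frequently (Eventually.frequently ?_)
      filter_upwards [hc, hl hpos] with x hx hx0
      have hm := someDensity_mem (p := (r, x)) hr1 hx0
      exact ⟨_, hm, by rw [Metric.mem_closedBall, Real.dist_eq]; exact (hx _ hm).le⟩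
    obtain ⟨d, hd, hdc⟩ := exists_mem_of_frequently hr1 hr2 Metric.isClosed_closedBall hfr
    rw [Metric.mem_closedBall, Real.dist_eq] at hdc
    exact ⟨d, hd, by linarith⟩
  constructor
  · refine key a (𝓝[<] βcr r) nhdsWithin_le_nhds inferInstance ?_
    filter_upwards [(hline.eventually hr).filter_mono nhdsWithin_le_nhds, self_mem_nhdsWithin]
      with x hx hlt
    exact hx.1 hlt
  · refine key b (𝓝[>] βcr r) nhdsWithin_le_nhds inferInstance ?_
    filter_upwards [(hline.eventually hr).filter_mono nhdsWithin_le_nhds, self_mem_nhdsWithin]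
      with x hx hlt
    exact hx.2 hlt

lemma eventually_exists_mem (h : Phases βcr ρ a b) {ε : ℝ} (hε : 0 < ε) :
    ∀ᶠ p : ℝ × ℝ in 𝓝 (ρ, βcr ρ), ∃ d ∈ optimalDensities p.1 p.2, |d - a| < ε ∨ |d - b| < ε := by
  filter_upwards [h.eventually_below ε hε, h.eventually_above ε hε,
    (continuous_fst.tendsto (ρ, βcr ρ)).eventually (h.eventually_graph hε),
    quadrant_mem_nhds h.pos.1 h.pos.2] with p h1 h2 h3 h4
  have hm := someDensity_mem h4.1 h4.2
  rcases lt_trichotomy p.2 (βcr p.1) with hlt | heq | hgt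
  · exact ⟨_, hm, Or.inl (h1 hlt _ hm)⟩
  · obtain ⟨d, hd, hda⟩ := h3.1
    exact ⟨d, by rwa [heq], Or.inl hda⟩
  · exact ⟨_, hm, Or.inr (h2 hgt _ hm)⟩

lemma left_pos (h : Phases βcr ρ a b) : 0 < a :=
  (optimalDensities_subset_Ioo h.pos.1 h.pos.2 h.left_mem).1

/-- Exactly two optimal densities coexist on a transition curve. -/
lemma optimalDensities_eq (h : Phases βcr ρ a b) : optimalDensities ρ (βcr ρ) = {a, b} := by
  obtain ⟨hρ, hβ⟩ := h.pos
  refine subset_antisymm (fun e he => ?_) (by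
    rintro _ (rfl | rfl)
    exacts [h.left_mem, h.right_mem])
  by_contra hne
  simp only [mem_insert_iff, mem_singleton_iff, not_or] at hne
  have hae : a < e := lt_of_le_of_ne (h.le e he).1 (Ne.symm hne.1)
  have heb : e < b := lt_of_le_of_ne (h.le e he).2 hne.2
  have ha := h.left_pos
  obtain ⟨s, hs1, hs2⟩ : ∃ s, 2 / (b + e) < s ∧ s < 2 / (a + e) :=
    exists_between (div_lt_div_of_pos_left two_pos (by linarith) (by linarith))
  rw [div_lt_iff₀ (by linarith)] at hs1
  rw [lt_div_iff₀ (by linarith)] at hs2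
  set ψ : (ℝ × ℝ) × ℝ → ℝ := fun x =>
    (x.2 - e) - s * (energyOf x.1.1 x.1.2 x.2 - energyOf ρ (βcr ρ) e) with hψ
  have hψc : ∀ d, ContinuousAt ψ ((ρ, βcr ρ), d) := fun d =>
    (continuousAt_snd.sub continuousAt_const).sub (continuousAt_const.mul
      ((continuousAt_energyOf hρ hβ).sub continuousAt_const))
  have hψa : ψ ((ρ, βcr ρ), a) < 0 := by
    simp only [hψ, energyOf_sub]
    nlinarith
  have hψb : ψ ((ρ, βcr ρ), b) < 0 := by
    simp only [hψ, energyOf_sub]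
    nlinarith
  have hnear : ∀ c, ψ ((ρ, βcr ρ), c) < 0 → ∃ ε > 0, ∀ᶠ p in 𝓝 (ρ, βcr ρ), ∀ d, |d - c| < ε →
      ψ (p, d) < 0 := by
    intro c hc
    have hev := (hψc c).eventually (gt_mem_nhds hc)
    rw [nhds_prod_eq] at hev
    obtain ⟨P, hP, Q, hQ, hPQ⟩ := Filter.eventually_prod_iff.1 hev
    obtain ⟨ε, hε, hball⟩ := Metric.eventually_nhds_iff.1 hQ
    exact ⟨ε, hε, hP.mono fun p hp d hd => hPQ hp (hball hd)⟩
  obtain ⟨ε₁, hε₁, hev₁⟩ := hnear a hψa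
  obtain ⟨ε₂, hε₂, hev₂⟩ := hnear b hψb
  have hpath : Tendsto (fun t : ℝ => (Real.exp (Real.log ρ + t), βcr ρ - t * s)) (𝓝[>] 0)
      (𝓝 (ρ, βcr ρ)) := by
    refine Tendsto.mono_left ?_ nhdsWithin_le_nhds
    refine Continuous.tendsto' (by fun_prop) _ _ ?_
    simp [Real.exp_log hρ]
  obtain ⟨t, ⟨⟨d, hd, hor⟩, h1, h2, h3⟩, ht⟩ := ((hpath.eventually
    ((h.eventually_exists_mem (lt_min hε₁ hε₂)).and (hev₁.and (hev₂.and
    (quadrant_mem_nhds hρ hβ))))).and self_mem_nhdsWithin).exists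
  have ht' : 0 < t := ht
  have hneg : ψ ((Real.exp (Real.log ρ + t), βcr ρ - t * s), d) < 0 := by
    rcases hor with hor | hor
    · exact h1 d (hor.trans_le (min_le_left _ _))
    · exact h2 d (hor.trans_le (min_le_right _ _))
  have hm := support_monotone hρ hβ h3.1 h3.2 he hd
  simp only [Real.log_exp] at hm
  simp only [hψ] at hneg
  nlinarith [mul_neg_of_pos_of_neg ht' hneg]

lemma tendsto_sInf (h : Phases βcr ρ a b) :
    Tendsto (fun r => sInf (optimalDensities r (βcr r))) (𝓝 ρ) (𝓝 a) := by
  rw [Metric.tendsto_nhds]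
  intro ε hε
  have hU : optimalDensities ρ (βcr ρ) ⊆ Ioi (a - ε) := fun d hd => by
    rw [mem_Ioi]; linarith [(h.le d hd).1]
  filter_upwards [h.eventually_graph hε, h.tendsto_graph.eventually
    ((eventually_optimalDensities_subset h.pos.1 h.pos.2 isOpen_Ioi hU).and
    (quadrant_mem_nhds h.pos.1 h.pos.2))] with r h1 h2
  have hm := someDensity_mem (p := (r, βcr r)) h2.2.1 h2.2.2
  obtain ⟨d, hd, hda⟩ := h1.1
  have h3 := csInf_le ⟨0, fun x hx => (optimalDensities_subset_Icc _ _ hx).1⟩ hd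
  have h4 : a - ε < someDensity (r, βcr r) := h2.1 hm
  change a - ε < sInf (optimalDensities r (βcr r)) at h4
  rw [Real.dist_eq, abs_lt]
  rw [abs_lt] at hda
  constructor <;> linarith [hda.2]

lemma tendsto_sSup (h : Phases βcr ρ a b) :
    Tendsto (fun r => sSup (optimalDensities r (βcr r))) (𝓝 ρ) (𝓝 b) := by
  rw [Metric.tendsto_nhds]
  intro ε hε
  have hU : optimalDensities ρ (βcr ρ) ⊆ Iio (b + ε) := fun d hd => by
    rw [mem_Iio]; linarith [(h.le d hd).2]
  filter_upwards [h.eventually_graph hε, h.tendsto_graph.eventually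
    ((eventually_optimalDensities_subset h.pos.1 h.pos.2 isOpen_Iio hU).and
    (quadrant_mem_nhds h.pos.1 h.pos.2))] with r h1 h2
  have hm : sSup (optimalDensities r (βcr r)) ∈ optimalDensities r (βcr r) :=
    (optimalDensities_nonempty h2.2.1 h2.2.2).csSup_mem (optimalDensities_finite h2.2.1 h2.2.2)
  obtain ⟨d, hd, hda⟩ := h1.2
  have h3 := le_csSup ⟨1, fun x hx => (optimalDensities_subset_Icc _ _ hx).2⟩ hd
  have h4 : sSup (optimalDensities r (βcr r)) < b + ε := h2.1 hm
  rw [Real.dist_eq, abs_lt]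
  rw [abs_lt] at hda
  constructor <;> linarith [hda.1]

lemma hasDerivAt (h : Phases βcr ρ a b) : HasDerivAt βcr (-(2 / (a + b)) * ρ⁻¹) ρ := by
  obtain ⟨hρ, hβ⟩ := h.pos
  have ha := h.left_pos
  have hab := h.lt
  set lo : ℝ → ℝ := fun r => sInf (optimalDensities r (βcr r)) with hlo
  set hi : ℝ → ℝ := fun r => sSup (optimalDensities r (βcr r)) with hhi
  have hElo : Tendsto (fun r => energyOf r (βcr r) (lo r)) (𝓝 ρ) (𝓝 (energyOf ρ (βcr ρ) a)) :=
    tendsto_energyOf (p := fun r => (r, βcr r)) (u := lo) (d := a) hρ hβ h.tendsto_graph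
      h.tendsto_sInf
  have hEhi : Tendsto (fun r => energyOf r (βcr r) (hi r)) (𝓝 ρ) (𝓝 (energyOf ρ (βcr ρ) b)) :=
    tendsto_energyOf (p := fun r => (r, βcr r)) (u := hi) (d := b) hρ hβ h.tendsto_graph
      h.tendsto_sSup
  have hgap : energyOf ρ (βcr ρ) b - energyOf ρ (βcr ρ) a = (b - a) * ((a + b) / 2) := by
    rw [energyOf_sub]; ring
  have hgap0 : 0 < (b - a) * ((a + b) / 2) := by
    exact mul_pos (by linarith) (by linarith)
  have hval : -((b - a) / ((b - a) * ((a + b) / 2))) = -(2 / (a + b)) := by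
    have : b - a ≠ 0 := by linarith
    have : a + b ≠ 0 := by linarith
    field_simp
  have hX : Tendsto (fun r => hi r - a) (𝓝 ρ) (𝓝 (b - a)) := h.tendsto_sSup.sub_const a
  have hX' : Tendsto (fun r => b - lo r) (𝓝 ρ) (𝓝 (b - a)) := h.tendsto_sInf.const_sub b
  have hY : Tendsto (fun r => energyOf r (βcr r) (hi r) - energyOf ρ (βcr ρ) a) (𝓝 ρ)
      (𝓝 ((b - a) * ((a + b) / 2))) := by
    rw [← hgap]; exact hEhi.sub_const _
  have hY' : Tendsto (fun r => energyOf ρ (βcr ρ) b - energyOf r (βcr r) (lo r)) (𝓝 ρ)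
      (𝓝 ((b - a) * ((a + b) / 2))) := by
    rw [← hgap]; exact hElo.const_sub _
  have hg₁ : Tendsto (fun r => -((hi r - a) / (energyOf r (βcr r) (hi r) -
      energyOf ρ (βcr ρ) a))) (𝓝 ρ) (𝓝 (-(2 / (a + b)))) := by
    rw [← hval]; exact (hX.div hY hgap0.ne').neg
  have hg₂ : Tendsto (fun r => -((b - lo r) / (energyOf ρ (βcr ρ) b -
      energyOf r (βcr r) (lo r)))) (𝓝 ρ) (𝓝 (-(2 / (a + b)))) := by
    rw [← hval]; exact (hX'.div hY' hgap0.ne').neg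
  have hq := h.tendsto_graph.eventually (quadrant_mem_nhds hρ hβ)
  refine hasDerivAt_of_increment_le (Real.hasDerivAt_log hρ.ne') hg₁ hg₂ ?_ ?_
  · filter_upwards [hq, hY.eventually (lt_mem_nhds hgap0)] with r hr hYr
    have hm : hi r ∈ optimalDensities r (βcr r) :=
      (optimalDensities_nonempty hr.1 hr.2).csSup_mem (optimalDensities_finite hr.1 hr.2)
    have hs := support_monotone hρ hβ hr.1 hr.2 h.left_mem hm
    rw [mul_neg, ← mul_div_assoc, neg_le, neg_sub, le_div_iff₀ hYr]
    linarith
  · filter_upwards [hq, hY'.eventually (lt_mem_nhds hgap0)] with r hr hYr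
    have hm : lo r ∈ optimalDensities r (βcr r) := someDensity_mem (p := (r, βcr r)) hr.1 hr.2
    have hs := support_monotone hρ hβ hr.1 hr.2 h.right_mem hm
    rw [mul_neg, ← mul_div_assoc, le_neg, neg_sub, div_le_iff₀ hYr]
    linarith

lemma tendsto_someDensity {l : Filter (ℝ × ℝ)} {c : ℝ} (h : Phases βcr ρ a b)
    (hl : l ≤ 𝓝 (ρ, βcr ρ))
    (hc : ∀ ε > 0, ∀ᶠ p in l, ∀ d ∈ optimalDensities p.1 p.2, |d - c| < ε) :
    Tendsto someDensity l (𝓝 c) := by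
  rw [Metric.tendsto_nhds]
  intro ε hε
  filter_upwards [hc ε hε, hl (quadrant_mem_nhds h.pos.1 h.pos.2)] with p hp hp0
  exact hp _ (someDensity_mem hp0.1 hp0.2)

end Phases

/-- The Clausius–Clapeyron relation for any function agreeing with the variational value. -/
theorem clausius_clapeyron {L : ℝ → ℝ → ℝ} (hL : AgreesWithValue L) {J : Set ℝ} {βcr : ℝ → ℝ}
    (hcurve : IsTransitionCurve L J βcr) {ρ : ℝ} (hρJ : ρ ∈ J) :
    ∃ d₁ d₂ R₁ R₂ B₁ B₂ : ℝ,
      0 < d₁ ∧ d₁ < d₂ ∧ d₂ < 1 ∧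
      optimalDensities ρ (βcr ρ) = {d₁, d₂} ∧
      (∀ ε > 0, ∀ᶠ p in belowCurve βcr ρ, ∀ d ∈ optimalDensities p.1 p.2, |d - d₁| < ε) ∧
      (∀ ε > 0, ∀ᶠ p in aboveCurve βcr ρ, ∀ d ∈ optimalDensities p.1 p.2, |d - d₂| < ε) ∧
      (∀ᶠ p in belowCurve βcr ρ ⊔ aboveCurve βcr ρ,
        DifferentiableAt ℝ (fun r => L r p.2) p.1 ∧
        DifferentiableAt ℝ (fun b => L p.1 b) p.2) ∧
      Tendsto (partialRho L) (belowCurve βcr ρ) (𝓝 R₁) ∧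
      Tendsto (partialRho L) (aboveCurve βcr ρ) (𝓝 R₂) ∧
      Tendsto (partialBeta L) (belowCurve βcr ρ) (𝓝 B₁) ∧
      Tendsto (partialBeta L) (aboveCurve βcr ρ) (𝓝 B₂) ∧
      B₂ - B₁ ≠ 0 ∧
      HasDerivAt βcr (-((R₂ - R₁) / (B₂ - B₁))) ρ ∧
      -((R₂ - R₁) / (B₂ - B₁)) = -(2 / (ρ * (d₁ + d₂))) := by
  obtain ⟨a, b, h⟩ := exists_phases hL hcurve hρJ
  obtain ⟨hρ, hβ⟩ := h.pos
  have ha := h.left_pos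
  have hab := h.lt
  have hbelow : ∀ ε > 0, ∀ᶠ p in belowCurve βcr ρ, ∀ d ∈ optimalDensities p.1 p.2, |d - a| < ε :=
    fun ε hε => eventually_nhdsWithin_iff.2 (h.eventually_below ε hε)
  have habove : ∀ ε > 0, ∀ᶠ p in aboveCurve βcr ρ, ∀ d ∈ optimalDensities p.1 p.2, |d - b| < ε :=
    fun ε hε => eventually_nhdsWithin_iff.2 (h.eventually_above ε hε)
  have hoff : ∀ᶠ p : ℝ × ℝ in 𝓝 (ρ, βcr ρ), p.2 ≠ βcr p.1 →
      (optimalDensities p.1 p.2).Subsingleton := by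
    obtain ⟨-, V, hV, hVpos, hgraph, hiff⟩ := hcurve
    filter_upwards [hV.mem_nhds (hgraph ρ hρJ)] with p hp hne
    by_contra hns
    exact hne ((hiff p hp).1 ((firstOrderTransition_iff hL (hVpos hp).1 (hVpos hp).2).2 hns)).2
  have hbl : belowCurve βcr ρ ≤ 𝓝 (ρ, βcr ρ) := nhdsWithin_le_nhds
  have hal : aboveCurve βcr ρ ≤ 𝓝 (ρ, βcr ρ) := nhdsWithin_le_nhds
  have hbs : ∀ᶠ p in belowCurve βcr ρ, (optimalDensities p.1 p.2).Subsingleton :=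
    eventually_nhdsWithin_iff.2 (hoff.mono fun p hp (hlt : p.2 < βcr p.1) => hp hlt.ne)
  have has : ∀ᶠ p in aboveCurve βcr ρ, (optimalDensities p.1 p.2).Subsingleton :=
    eventually_nhdsWithin_iff.2 (hoff.mono fun p hp (hlt : βcr p.1 < p.2) => hp hlt.ne')
  have hquad := quadrant_mem_nhds (p := (ρ, βcr ρ)) hρ hβ
  have hR : ∀ {l : Filter (ℝ × ℝ)} {c : ℝ}, l ≤ 𝓝 (ρ, βcr ρ) →
      (∀ᶠ p in l, (optimalDensities p.1 p.2).Subsingleton) →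
      (∀ ε > 0, ∀ᶠ p in l, ∀ d ∈ optimalDensities p.1 p.2, |d - c| < ε) →
      Tendsto (partialRho L) l (𝓝 (c / ρ)) := by
    intro l c hl hs hc
    refine ((h.tendsto_someDensity hl hc).div
      ((continuous_fst.tendsto (ρ, βcr ρ)).mono_left hl) hρ.ne').congr' ?_
    filter_upwards [hs, hl hquad] with p hp hp0
    exact (hL.partialRho_eq hp0.1 hp0.2 (someDensity_mem hp0.1 hp0.2)
      (hL.differentiableAt_fst hp0.1 hp0.2 hp)).symm
  have hB : ∀ {l : Filter (ℝ × ℝ)} {c : ℝ}, l ≤ 𝓝 (ρ, βcr ρ) →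
      (∀ᶠ p in l, (optimalDensities p.1 p.2).Subsingleton) →
      (∀ ε > 0, ∀ᶠ p in l, ∀ d ∈ optimalDensities p.1 p.2, |d - c| < ε) →
      Tendsto (partialBeta L) l (𝓝 (energyOf ρ (βcr ρ) c)) := by
    intro l c hl hs hc
    refine (tendsto_energyOf hρ hβ (tendsto_id.mono_left hl)
      (h.tendsto_someDensity hl hc)).congr' ?_
    filter_upwards [hs, hl hquad] with p hp hp0
    exact (hL.partialBeta_eq hp0.1 hp0.2 (someDensity_mem hp0.1 hp0.2)
      (hL.differentiableAt_snd hp0.1 hp0.2 hp)).symm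
  have hgap : energyOf ρ (βcr ρ) b - energyOf ρ (βcr ρ) a = (b - a) * (a + b) / 2 := by
    rw [energyOf_sub]; ring
  have hba : b - a ≠ 0 := by linarith
  have hapb : a + b ≠ 0 := by linarith
  have hslope : -((b / ρ - a / ρ) / (energyOf ρ (βcr ρ) b - energyOf ρ (βcr ρ) a)) =
      -(2 / (ρ * (a + b))) := by
    rw [hgap]; field_simp
  refine ⟨a, b, a / ρ, b / ρ, energyOf ρ (βcr ρ) a, energyOf ρ (βcr ρ) b, ha, hab,
    (optimalDensities_subset_Ioo hρ hβ h.right_mem).2, h.optimalDensities_eq, hbelow, habove, ?_,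
    hR hbl hbs hbelow, hR hal has habove, hB hbl hbs hbelow, hB hal has habove, ?_, ?_, hslope⟩
  · refine eventually_sup.2 ⟨?_, ?_⟩
    · filter_upwards [hbs, hbl hquad] with p hp hp0
      exact ⟨hL.differentiableAt_fst hp0.1 hp0.2 hp, hL.differentiableAt_snd hp0.1 hp0.2 hp⟩
    · filter_upwards [has, hal hquad] with p hp hp0
      exact ⟨hL.differentiableAt_fst hp0.1 hp0.2 hp, hL.differentiableAt_snd hp0.1 hp0.2 hp⟩
  · rw [hgap]
    exact div_ne_zero (mul_ne_zero hba hapb) two_ne_zero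
  · rw [hslope]
    convert h.hasDerivAt using 1
    field_simp

/-! ### The expectation as a partition function -/

/-- The number of elements of `S` exceeding `j`. -/
def countAbove (S : Finset ℕ) (j : ℕ) : ℕ := (S.filter (j < ·)).card

lemma sum_sum_range_eq {S : Finset ℕ} {n : ℕ} (hS : S ⊆ Finset.range n) (c : ℕ → ℝ) :
    ∑ i ∈ S, ∑ j ∈ Finset.range i, c j = ∑ j ∈ Finset.range n, countAbove S j * c j := by
  have h1 : ∀ i ∈ S, ∑ j ∈ Finset.range i, c j =
      ∑ j ∈ Finset.range n, if j < i then c j else 0 := fun i hi => by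
    rw [← Finset.sum_filter]
    congr 1
    ext j
    have := Finset.mem_range.1 (hS hi)
    simp only [Finset.mem_range, Finset.mem_filter]
    omega
  rw [Finset.sum_congr rfl h1, Finset.sum_comm]
  refine Finset.sum_congr rfl fun j _ => ?_
  rw [← Finset.sum_filter, Finset.sum_const, countAbove, nsmul_eq_mul]

/-- The weight of an occupied set in the lattice-gas representation of the expectation. -/
noncomputable def weight (ρ β : ℝ) (n : ℕ) (S : Finset ℕ) : ℝ :=
  ρ ^ S.card * Real.exp (β / n ^ 2 *
    (∑ j ∈ Finset.range n, (countAbove S j : ℝ) ^ 2 - ∑ i ∈ S, (i : ℝ)))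

/-- The lattice-gas partition function. -/
noncomputable def partitionSum (ρ β : ℝ) (n : ℕ) : ℝ :=
  ∑ S ∈ (Finset.range n).powerset, weight ρ β n S

lemma state_eq_prod (x₀ τ ρ σ : ℝ) (v : ℕ → ℝ) (n : ℕ) :
    state x₀ τ ρ σ v n = x₀ * ∏ i ∈ Finset.range n, multiplier τ ρ σ v i := by
  induction n with
  | zero => simp [state]
  | succ n ih => rw [state, ih, Finset.prod_range_succ]; ring

lemma hasMgf_incrementLaw {τ : ℝ} (hτ : 0 < τ) (σ : ℝ) (N : ℕ → ℝ) (n : ℕ) :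
    Integrable (fun v => Real.exp (σ * ∑ j ∈ Finset.range n, N j * v j)) (incrementLaw τ) ∧
    ∫ v, Real.exp (σ * ∑ j ∈ Finset.range n, N j * v j) ∂(incrementLaw τ) =
      Real.exp (σ ^ 2 * τ / 2 * ∑ j ∈ Finset.range n, N j ^ 2) := by
  have hind : iIndepFun (fun (j : ℕ) (v : ℕ → ℝ) => N j * v j) (incrementLaw τ) :=
    iIndepFun_infinitePi (P := fun _ : ℕ => gaussianReal 0 τ.toNNReal)
      (X := fun j x => N j * x) fun j => by fun_prop
  have hmeas : ∀ j, Measurable fun v : ℕ → ℝ => N j * v j := fun j => by fun_prop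
  have hmap : ∀ j, (incrementLaw τ).map (fun v : ℕ → ℝ => v j) = gaussianReal 0 τ.toNNReal :=
    fun j => Measure.infinitePi_map_eval _ j
  have hprob : IsProbabilityMeasure (incrementLaw τ) := by unfold incrementLaw; infer_instance
  have hfun : ∀ v : ℕ → ℝ, ∑ j ∈ Finset.range n, N j * v j =
      (∑ j ∈ Finset.range n, fun v : ℕ → ℝ => N j * v j) v := fun v => by
    rw [Finset.sum_apply]
  simp only [hfun]
  constructor
  · refine hind.integrable_exp_mul_sum hmeas fun j _ => ?_
    have h1 := integrable_exp_mul_gaussianReal (μ := 0) (v := τ.toNNReal) (σ * N j)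
    rw [← hmap j] at h1
    refine (h1.comp_measurable (measurable_pi_apply j)).congr (Eventually.of_forall fun v => ?_)
    simp only [Function.comp]
    ring_nf
  · have h1 := hind.mgf_sum (t := σ) hmeas (Finset.range n)
    rw [mgf] at h1
    rw [h1, Finset.mul_sum, Real.exp_sum]
    refine Finset.prod_congr rfl fun j _ => ?_
    rw [mgf_const_mul, mgf_gaussianReal (hmap j), Real.coe_toNNReal _ hτ.le]
    congr 1
    ring

lemma integral_state {x₀ τ ρ β : ℝ} (hτ : 0 < τ) (hβ : 0 < β) {n : ℕ} (hn : 0 < n) :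
    ∫ v, state x₀ τ ρ (volatility τ β n) v n ∂(incrementLaw τ) = x₀ * partitionSum ρ β n := by
  set σ := volatility τ β n with hσ
  have hn0 : (n : ℝ) ≠ 0 := by positivity
  have hσ2 : σ ^ 2 * τ / 2 = β / n ^ 2 := by
    rw [hσ, volatility, div_pow, Real.sq_sqrt (by positivity)]
    field_simp
  have hexp : ∀ v, state x₀ τ ρ σ v n = x₀ * ∑ S ∈ (Finset.range n).powerset,
      (ρ ^ S.card * Real.exp (-(σ ^ 2 * τ / 2 * ∑ i ∈ S, (i : ℝ)))) *
        Real.exp (σ * ∑ j ∈ Finset.range n, countAbove S j * v j) := by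
    intro v
    rw [state_eq_prod]
    unfold multiplier
    rw [Finset.prod_one_add]
    congr 1
    refine Finset.sum_congr rfl fun S hS => ?_
    rw [Finset.prod_mul_distrib, Finset.prod_const, ← Real.exp_sum, mul_assoc, ← Real.exp_add]
    congr 2
    have := sum_sum_range_eq (Finset.mem_powerset.1 hS) v
    rw [← this]
    unfold walk
    rw [Finset.sum_sub_distrib, ← Finset.mul_sum, Finset.mul_sum (s := S) (f := fun i : ℕ => (i : ℝ)),
      sub_eq_add_neg, add_comm, ← Finset.sum_neg_distrib, ← Finset.sum_neg_distrib]
    congr 1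
    refine Finset.sum_congr rfl fun i _ => ?_
    ring
  simp only [hexp]
  rw [integral_const_mul, integral_finsetSum _ fun S _ =>
    (hasMgf_incrementLaw hτ σ (fun j => (countAbove S j : ℝ)) n).1.const_mul _]
  congr 1
  refine Finset.sum_congr rfl fun S _ => ?_
  rw [integral_const_mul, (hasMgf_incrementLaw hτ σ (fun j => (countAbove S j : ℝ)) n).2, weight,
    mul_assoc, ← Real.exp_add, hσ2]
  congr 2
  ring

/-! ### Linearization of the partition function -/

/-- The dual functional on the lattice. -/
noncomputable def latticeDual (ρ β : ℝ) (n : ℕ) (c : ℕ → ℝ) : ℝ :=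
  ∑ i ∈ Finset.range n, softplus (Real.log ρ + 2 * β / n * ∑ j ∈ Finset.range i, c j)
    - β * ∑ j ∈ Finset.range n, c j ^ 2

/-- The weight in which the quadratic term is linearized around `n c`. -/
noncomputable def linearWeight (ρ β : ℝ) (n : ℕ) (c : ℕ → ℝ) (S : Finset ℕ) : ℝ :=
  ρ ^ S.card * Real.exp (2 * β / n * (∑ j ∈ Finset.range n, countAbove S j * c j)
    - β * ∑ j ∈ Finset.range n, c j ^ 2)

lemma sum_linearWeight {ρ : ℝ} (hρ : 0 < ρ) (β : ℝ) (n : ℕ) (c : ℕ → ℝ) :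
    ∑ S ∈ (Finset.range n).powerset, linearWeight ρ β n c S =
      Real.exp (latticeDual ρ β n c) := by
  unfold latticeDual
  rw [Real.exp_sub, Real.exp_sum]
  simp only [exp_softplus]
  rw [Finset.prod_one_add, Finset.sum_div]
  refine Finset.sum_congr rfl fun S hS => ?_
  rw [linearWeight, ← sum_sum_range_eq (Finset.mem_powerset.1 hS) c, Real.exp_sub, mul_div_assoc]
  simp only [Real.exp_add, Real.exp_log hρ]
  rw [Finset.prod_mul_distrib, Finset.prod_const, ← Real.exp_sum, ← Finset.mul_sum]
  ring

lemma countAbove_le_card (S : Finset ℕ) (j : ℕ) : countAbove S j ≤ S.card :=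
  Finset.card_filter_le _ _

lemma card_le_of_subset_range {S : Finset ℕ} {n : ℕ} (hS : S ⊆ Finset.range n) : S.card ≤ n := by
  simpa using Finset.card_le_card hS

lemma sum_le_sq {S : Finset ℕ} {n : ℕ} (hS : S ⊆ Finset.range n) :
    ∑ i ∈ S, (i : ℝ) ≤ n ^ 2 := by
  have h1 : ∑ i ∈ S, (i : ℝ) ≤ ∑ _i ∈ S, (n : ℝ) := Finset.sum_le_sum fun i hi => by
    exact_mod_cast (Finset.mem_range.1 (hS hi)).le
  rw [Finset.sum_const, nsmul_eq_mul] at h1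
  have h2 : (S.card : ℝ) ≤ n := by exact_mod_cast card_le_of_subset_range hS
  nlinarith [(Nat.cast_nonneg n : (0 : ℝ) ≤ n)]

lemma quadratic_identity {n : ℕ} (hn : 0 < n) (β : ℝ) (S : Finset ℕ) (c : ℕ → ℝ) :
    β / n ^ 2 * ∑ j ∈ Finset.range n, (countAbove S j : ℝ) ^ 2 =
      2 * β / n * (∑ j ∈ Finset.range n, countAbove S j * c j)
        - β * (∑ j ∈ Finset.range n, c j ^ 2)
        + β * ∑ j ∈ Finset.range n, ((countAbove S j : ℝ) / n - c j) ^ 2 := by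
  have hn0 : (n : ℝ) ≠ 0 := by positivity
  rw [Finset.mul_sum, Finset.mul_sum, Finset.mul_sum, Finset.mul_sum, ← Finset.sum_sub_distrib,
    ← Finset.sum_add_distrib]
  refine Finset.sum_congr rfl fun j _ => ?_
  field_simp
  ring

lemma linearWeight_le_weight {ρ β : ℝ} (hρ : 0 < ρ) (hβ : 0 < β) {n : ℕ} (hn : 0 < n) (c : ℕ → ℝ)
    {S : Finset ℕ} (hS : S ⊆ Finset.range n) :
    Real.exp (-β) * linearWeight ρ β n c S ≤ weight ρ β n S := by
  have hn0 : (0 : ℝ) < n := by positivity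
  unfold linearWeight weight
  rw [mul_left_comm, ← Real.exp_add]
  refine mul_le_mul_of_nonneg_left (Real.exp_le_exp.2 ?_) (by positivity)
  rw [mul_sub, quadratic_identity hn β S c]
  have h1 : 0 ≤ β * ∑ j ∈ Finset.range n, ((countAbove S j : ℝ) / n - c j) ^ 2 :=
    mul_nonneg hβ.le (Finset.sum_nonneg fun _ _ => sq_nonneg _)
  have h2 : β / n ^ 2 * ∑ i ∈ S, (i : ℝ) ≤ β := by
    calc _ ≤ β / n ^ 2 * n ^ 2 := by gcongr; exact sum_le_sq hS
      _ = β := by field_simp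
  linarith

lemma weight_le_linearWeight {ρ β : ℝ} (hρ : 0 < ρ) (hβ : 0 < β) {n : ℕ} (hn : 0 < n) {c : ℕ → ℝ}
    {S : Finset ℕ} {δ : ℝ}
    (hc : ∀ j < n, |(countAbove S j : ℝ) / n - c j| ≤ δ) :
    weight ρ β n S ≤ Real.exp (β * δ ^ 2 * n) * linearWeight ρ β n c S := by
  have hn0 : (0 : ℝ) < n := by positivity
  unfold linearWeight weight
  rw [mul_left_comm, ← Real.exp_add]
  refine mul_le_mul_of_nonneg_left (Real.exp_le_exp.2 ?_) (by positivity)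
  rw [mul_sub, quadratic_identity hn β S c]
  have h1 : ∑ j ∈ Finset.range n, ((countAbove S j : ℝ) / n - c j) ^ 2 ≤ n * δ ^ 2 := by
    have : ∑ j ∈ Finset.range n, ((countAbove S j : ℝ) / n - c j) ^ 2 ≤
        ∑ _j ∈ Finset.range n, δ ^ 2 := Finset.sum_le_sum fun j hj => by
      rw [← sq_abs]
      exact pow_le_pow_left₀ (abs_nonneg _) (hc j (Finset.mem_range.1 hj)) 2
    simpa using this
  have h2 : 0 ≤ β / n ^ 2 * ∑ i ∈ S, (i : ℝ) :=
    mul_nonneg (by positivity) (Finset.sum_nonneg fun _ _ => Nat.cast_nonneg _)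
  have h3 := mul_le_mul_of_nonneg_left h1 hβ.le
  linarith

lemma exp_latticeDual_le_partitionSum {ρ β : ℝ} (hρ : 0 < ρ) (hβ : 0 < β) {n : ℕ} (hn : 0 < n)
    (c : ℕ → ℝ) : Real.exp (latticeDual ρ β n c - β) ≤ partitionSum ρ β n := by
  rw [sub_eq_add_neg, add_comm, Real.exp_add, ← sum_linearWeight hρ, Finset.mul_sum]
  exact Finset.sum_le_sum fun S hS => linearWeight_le_weight hρ hβ hn c (Finset.mem_powerset.1 hS)

/-- The block-constant profile with values in `{0, 1/m, …, 1}` on the `m` blocks of `{0, …, n-1}`. -/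
noncomputable def blockProfile {m : ℕ} (n : ℕ) (N : Fin m → Fin (m + 1)) (j : ℕ) : ℝ :=
  if h : j * m / n < m then ((N ⟨j * m / n, h⟩ : ℕ) : ℝ) / m else 0

lemma blockProfile_mem {m : ℕ} (n : ℕ) (N : Fin m → Fin (m + 1)) (j : ℕ) :
    blockProfile n N j ∈ Icc (0 : ℝ) 1 := by
  unfold blockProfile
  split_ifs with h
  · have hm : 0 < m := lt_of_le_of_lt (Nat.zero_le _) h
    refine ⟨by positivity, ?_⟩
    rw [div_le_one (by positivity)]
    exact_mod_cast Nat.lt_succ_iff.1 (N ⟨j * m / n, h⟩).2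
  · simp

lemma countAbove_anti (S : Finset ℕ) : Antitone (countAbove S) := fun _ _ h =>
  Finset.card_le_card fun _ hi => by
    rw [Finset.mem_filter] at hi ⊢
    exact ⟨hi.1, h.trans_lt hi.2⟩

lemma countAbove_le_add (S : Finset ℕ) (k j : ℕ) :
    countAbove S k ≤ countAbove S j + (j - k) := by
  have hsub : S.filter (k < ·) ⊆ S.filter (j < ·) ∪ Finset.Ioc k j := fun i hi => by
    simp only [Finset.mem_filter, Finset.mem_union, Finset.mem_Ioc] at hi ⊢
    by_cases hij : j < i
    · exact Or.inl ⟨hi.1, hij⟩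
    · exact Or.inr ⟨hi.2, not_lt.1 hij⟩
  refine (Finset.card_le_card hsub).trans ((Finset.card_union_le _ _).trans ?_)
  rw [Nat.card_Ioc]
  rfl

lemma exists_blockProfile {m n : ℕ} (hm : 0 < m) (hmn : m ≤ n) {S : Finset ℕ}
    (hS : S ⊆ Finset.range n) :
    ∃ N : Fin m → Fin (m + 1), ∀ j < n,
      |(countAbove S j : ℝ) / n - blockProfile n N j| ≤ 2 / m := by
  have hn : 0 < n := hm.trans_le hmn
  have hm0 : (0 : ℝ) < m := by positivity
  have hn0 : (0 : ℝ) < n := by positivity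
  refine ⟨fun b => ⟨countAbove S (b * n / m) * m / n, ?_⟩, fun j hj => ?_⟩
  · rw [Nat.lt_succ_iff]
    refine Nat.div_le_of_le_mul ?_
    exact Nat.mul_le_mul_right m ((countAbove_le_card _ _).trans (card_le_of_subset_range hS))
  · have hb : j * m / n < m := by
      rw [Nat.div_lt_iff_lt_mul hn, mul_comm m]
      exact Nat.mul_lt_mul_of_pos_right hj hm
    rw [blockProfile, dif_pos hb]
    simp only
    set b := j * m / n with hbdef
    set k := b * n / m with hkdef
    have hkj : k ≤ j := by
      refine Nat.div_le_of_le_mul ?_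
      rw [mul_comm m]
      exact Nat.div_mul_le_self _ _
    have h1 : (countAbove S j : ℝ) ≤ countAbove S k := by exact_mod_cast countAbove_anti S hkj
    have h2 : (countAbove S k : ℝ) ≤ countAbove S j + (j - k) := by
      have := countAbove_le_add S k j
      rw [← Nat.cast_sub hkj]
      exact_mod_cast this
    have h3 : (j : ℝ) - k ≤ n / m + 1 := by
      have e1 : (j * m : ℝ) < (b + 1) * n := by
        have := Nat.lt_mul_div_succ (j * m) hn
        rw [mul_comm n] at this
        exact_mod_cast this
      have e2 : (b * n : ℝ) < (k + 1) * m := by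
        have := Nat.lt_mul_div_succ (b * n) hm
        rw [mul_comm m] at this
        exact_mod_cast this
      have e3 : ((j : ℝ) - k) * m ≤ (n / m + 1) * m := by
        rw [add_mul, div_mul_cancel₀ _ hm0.ne']
        nlinarith
      exact le_of_mul_le_mul_right e3 hm0
    set q := countAbove S k * m / n with hqdef
    have h4 : (q * n : ℝ) ≤ countAbove S k * m := by
      exact_mod_cast Nat.div_mul_le_self (countAbove S k * m) n
    have h5 : (countAbove S k * m : ℝ) < (q + 1) * n := by
      have := Nat.lt_mul_div_succ (countAbove S k * m) hn
      rw [mul_comm n] at this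
      exact_mod_cast this
    have h6 : (q : ℝ) / m ≤ countAbove S k / n := by
      rw [div_le_div_iff₀ hm0 hn0]; exact h4
    have h7 : (countAbove S k : ℝ) / n ≤ q / m + 1 / m := by
      rw [← add_div, div_le_div_iff₀ hn0 hm0]; exact h5.le
    have h8 : (countAbove S k : ℝ) / n ≤ countAbove S j / n + 2 / m := by
      have e : ((n : ℝ) / m + 1) / n ≤ 2 / m := by
        have e1 : ((n : ℝ) / m + 1) / n = 1 / m + 1 / n := by field_simp
        have e2 : (1 : ℝ) / n ≤ 1 / m :=
          one_div_le_one_div_of_le hm0 (by exact_mod_cast hmn)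
        have e3 : (2 : ℝ) / m = 1 / m + 1 / m := by ring
        rw [e1, e3]; linarith
      calc (countAbove S k : ℝ) / n ≤ (countAbove S j + (n / m + 1)) / n := by gcongr; linarith
        _ = countAbove S j / n + (n / m + 1) / n := by ring
        _ ≤ _ := by gcongr
    have h9 : (countAbove S j : ℝ) / n ≤ countAbove S k / n := by gcongr
    have h10 : (1 : ℝ) / m ≤ 2 / m := by gcongr; norm_num
    rw [abs_le]
    constructor <;> linarith

lemma partitionSum_le {ρ β : ℝ} (hρ : 0 < ρ) (hβ : 0 < β) {m n : ℕ} (hm : 0 < m) (hmn : m ≤ n)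
    {M : ℝ} (hM : ∀ c : ℕ → ℝ, (∀ j, c j ∈ Icc (0 : ℝ) 1) → latticeDual ρ β n c ≤ n * M) :
    partitionSum ρ β n ≤ Real.exp (m * Real.log (m + 1) + n * (4 * β / m ^ 2 + M)) := by
  have hn : 0 < n := hm.trans_le hmn
  have h1 : partitionSum ρ β n ≤ ∑ S ∈ (Finset.range n).powerset,
      ∑ N : Fin m → Fin (m + 1), Real.exp (β * (2 / m) ^ 2 * n) *
        linearWeight ρ β n (blockProfile n N) S := by
    refine Finset.sum_le_sum fun S hS => ?_
    obtain ⟨N, hN⟩ := exists_blockProfile hm hmn (Finset.mem_powerset.1 hS)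
    refine (weight_le_linearWeight hρ hβ hn hN).trans ?_
    exact Finset.single_le_sum (f := fun N : Fin m → Fin (m + 1) =>
      Real.exp (β * (2 / m) ^ 2 * n) * linearWeight ρ β n (blockProfile n N) S)
      (fun N _ => by unfold linearWeight; positivity) (Finset.mem_univ N)
  rw [Finset.sum_comm] at h1
  simp only [← Finset.mul_sum, sum_linearWeight hρ] at h1
  refine h1.trans ?_
  have h2 : ∑ N : Fin m → Fin (m + 1), Real.exp (latticeDual ρ β n (blockProfile n N)) ≤
      (m + 1) ^ m * Real.exp (n * M) := by
    have : ∑ N : Fin m → Fin (m + 1), Real.exp (latticeDual ρ β n (blockProfile n N)) ≤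
        ∑ _N : Fin m → Fin (m + 1), Real.exp (n * M) :=
      Finset.sum_le_sum fun N _ => Real.exp_le_exp.2 (hM _ (blockProfile_mem n N))
    simpa using this
  calc _ ≤ Real.exp (β * (2 / m) ^ 2 * n) * ((m + 1) ^ m * Real.exp (n * M)) := by gcongr
    _ = _ := by
      have h3 : Real.exp (m * Real.log (m + 1)) = ((m : ℝ) + 1) ^ m := by
        rw [Real.exp_nat_mul, Real.exp_log (by positivity)]
      rw [Real.exp_add (m * Real.log (m + 1)), h3, mul_left_comm, ← Real.exp_add]
      congr 2
      ring

/-! ### Riemann sums -/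

lemma _root_.AntitoneOn.mul_integral_le_sum_div {F : ℝ → ℝ} (hF : AntitoneOn F (Icc 0 1))
    {n k : ℕ} (hn : 0 < n) (hk : k ≤ n) :
    n * ∫ x in (0 : ℝ)..k / n, F x ≤ ∑ i ∈ Finset.range k, F (i / n) := by
  have hn0 : (0 : ℝ) < n := by positivity
  have hk' : (k : ℝ) ≤ n := by exact_mod_cast hk
  have h : AntitoneOn (fun x => F (x / n)) (Icc (0 : ℝ) (0 + k)) := fun x hx y hy hxy =>
    hF ⟨by have := hx.1; positivity, by rw [div_le_one hn0]; linarith [hx.2]⟩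
      ⟨by have := hy.1; positivity, by rw [div_le_one hn0]; linarith [hy.2]⟩ (by gcongr)
  have h2 := h.integral_le_sum
  rw [intervalIntegral.integral_comp_div _ hn0.ne'] at h2
  simpa using h2

lemma _root_.AntitoneOn.sum_div_succ_le_mul_integral {F : ℝ → ℝ} (hF : AntitoneOn F (Icc 0 1))
    {n : ℕ} (hn : 0 < n) :
    ∑ i ∈ Finset.range n, F ((i + 1 : ℕ) / n) ≤ n * ∫ x in (0 : ℝ)..1, F x := by
  have hn0 : (0 : ℝ) < n := by positivity
  have h : AntitoneOn (fun x => F (x / n)) (Icc (0 : ℝ) (0 + n)) := fun x hx y hy hxy =>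
    hF ⟨by have := hx.1; positivity, by rw [div_le_one hn0]; linarith [hx.2]⟩
      ⟨by have := hy.1; positivity, by rw [div_le_one hn0]; linarith [hy.2]⟩ (by gcongr)
  have h2 := h.sum_le_integral
  rw [intervalIntegral.integral_comp_div _ hn0.ne'] at h2
  simpa [hn0.ne'] using h2

lemma _root_.AntitoneOn.sum_div_le_mul_integral_add {F : ℝ → ℝ} (hF : AntitoneOn F (Icc 0 1))
    {n : ℕ} (hn : 0 < n) :
    ∑ i ∈ Finset.range n, F (i / n) ≤ n * (∫ x in (0 : ℝ)..1, F x) + F 0 - F 1 := by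
  have hn0 : (0 : ℝ) < n := by positivity
  have h := hF.sum_div_succ_le_mul_integral hn
  have h1 := Finset.sum_range_succ (fun i : ℕ => F (i / n)) n
  have h2 := Finset.sum_range_succ' (fun i : ℕ => F (i / n)) n
  simp only [div_self hn0.ne', Nat.cast_zero, zero_div] at h1 h2
  linarith

/-! ### The upper bound -/

lemma measurable_stepProfile (c : ℕ → ℝ) (n : ℕ) : Measurable fun x : ℝ => c ⌊n * x⌋₊ :=
  (measurable_of_countable c).comp (Nat.measurable_floor.comp (measurable_const.mul measurable_id))

lemma stepProfile_intervalIntegrable {c : ℕ → ℝ} (hc : ∀ j, c j ∈ Icc (0 : ℝ) 1) (n : ℕ) :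
    IntervalIntegrable (fun x : ℝ => c ⌊n * x⌋₊) volume 0 1 :=
  intervalIntegrable_of_bounded (C := 1) (measurable_stepProfile c n).aestronglyMeasurable
    fun x _ => by rw [abs_of_nonneg (hc _).1]; exact (hc _).2

lemma integral_stepProfile {c : ℕ → ℝ} (hc : ∀ j, c j ∈ Icc (0 : ℝ) 1) {n k : ℕ} (hn : 0 < n)
    (hk : k ≤ n) :
    ∫ x in (0 : ℝ)..k / n, c ⌊n * x⌋₊ = 1 / n * ∑ j ∈ Finset.range k, c j := by
  have hn0 : (0 : ℝ) < n := by positivity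
  have h := intervalIntegral.sum_integral_adjacent_intervals (μ := volume)
    (f := fun x : ℝ => c ⌊n * x⌋₊) (a := fun j : ℕ => (j : ℝ) / n) (n := k) fun j hj => by
      refine (stepProfile_intervalIntegrable hc n).mono_set ?_
      rw [uIcc_of_le zero_le_one, uIcc_of_le (by gcongr; omega)]
      refine Icc_subset_Icc (by positivity) ?_
      rw [div_le_one hn0]
      exact_mod_cast (by omega : j + 1 ≤ n)
  simp only [Nat.cast_zero, zero_div] at h
  rw [← h, Finset.mul_sum]
  refine Finset.sum_congr rfl fun j _ => ?_
  rw [intervalIntegral.integral_congr_Ioo_of_le (g := fun _ => c j)]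
  · rw [intervalIntegral.integral_const, smul_eq_mul]
    push_cast
    ring
  · gcongr; omega
  · intro x hx
    have h1 := (div_lt_iff₀' hn0).1 hx.1
    have h2 := (lt_div_iff₀' hn0).1 hx.2
    have : ⌊n * x⌋₊ = j := by
      rw [Nat.floor_eq_iff (by linarith [(Nat.cast_nonneg j : (0 : ℝ) ≤ j)])]
      exact ⟨h1.le, by exact_mod_cast h2⟩
    simp only [this]

lemma field_monotoneOn {β : ℝ} (hβ : 0 ≤ β) {c : ℝ → ℝ} (hc : IntervalIntegrable c volume 0 1)
    (hc0 : ∀ x ∈ Icc (0 : ℝ) 1, 0 ≤ c x) (ρ : ℝ) : MonotoneOn (field ρ β c) (Icc 0 1) := by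
  intro x hx y hy hxy
  unfold field
  have hsub : ∀ {a b : ℝ}, a ∈ Icc (0 : ℝ) 1 → b ∈ Icc (0 : ℝ) 1 →
      IntervalIntegrable c volume a b := fun ha hb => hc.mono_set <| by
    rw [uIcc_of_le zero_le_one]
    exact uIcc_subset_Icc ha hb
  have h1 := intervalIntegral.integral_add_adjacent_intervals (hsub zero_mem_unit hx) (hsub hx hy)
  have h2 : 0 ≤ ∫ t in x..y, c t := intervalIntegral.integral_nonneg hxy fun t ht =>
    hc0 t ⟨hx.1.trans ht.1, ht.2.trans hy.2⟩
  rw [← h1]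
  have := mul_nonneg hβ h2
  linarith

lemma latticeDual_le {β : ℝ} (hβ : 0 ≤ β) (ρ : ℝ) {n : ℕ} (hn : 0 < n) {c : ℕ → ℝ}
    (hc : ∀ j, c j ∈ Icc (0 : ℝ) 1) : latticeDual ρ β n c ≤ n * value ρ β := by
  have hn0 : (0 : ℝ) < n := by positivity
  set s : ℝ → ℝ := fun x => c ⌊n * x⌋₊ with hs
  have hsi := stepProfile_intervalIntegrable hc n
  have hc2 : ∀ j, c j ^ 2 ∈ Icc (0 : ℝ) 1 := fun j =>
    ⟨sq_nonneg _, pow_le_one₀ (hc j).1 (hc j).2⟩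
  have hsi2 := stepProfile_intervalIntegrable hc2 n
  have hmono : MonotoneOn (fun x => softplus (field ρ β s x)) (Icc 0 1) :=
    softplus_mono.comp_monotoneOn (field_monotoneOn hβ hsi (fun x _ => (hc _).1) ρ)
  have h1 : ∑ i ∈ Finset.range n, softplus (field ρ β s (i / n)) ≤
      n * ∫ x in (0 : ℝ)..1, softplus (field ρ β s x) := by
    have := hmono.neg.mul_integral_le_sum_div hn le_rfl
    simp only [div_self hn0.ne', intervalIntegral.integral_neg, Finset.sum_neg_distrib] at this
    linarith
  have h2 : ∫ x in (0 : ℝ)..1, s x ^ 2 = 1 / n * ∑ j ∈ Finset.range n, c j ^ 2 := by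
    have := integral_stepProfile hc2 hn le_rfl
    rwa [div_self hn0.ne'] at this
  have h3 : ∑ i ∈ Finset.range n, softplus (field ρ β s (i / n)) =
      ∑ i ∈ Finset.range n, softplus (Real.log ρ + 2 * β / n * ∑ j ∈ Finset.range i, c j) := by
    refine Finset.sum_congr rfl fun i hi => ?_
    rw [field, hs, integral_stepProfile hc hn (Finset.mem_range.1 hi).le]
    congr 2
    ring
  have h4 := mul_le_mul_of_nonneg_left (dual_le_value hβ hsi hsi2 ρ) hn0.le
  have h5 : n * dual ρ β s = n * (∫ x in (0 : ℝ)..1, softplus (field ρ β s x))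
      - β * ∑ j ∈ Finset.range n, c j ^ 2 := by
    rw [dual, h2]
    field_simp
  unfold latticeDual
  rw [← h3]
  linarith

/-! ### The lower bound -/

lemma Admissible.le_latticeDual {f : ℝ → ℝ} (hf : Admissible f) {β : ℝ} (hβ : 0 ≤ β) (ρ : ℝ)
    {n : ℕ} (hn : 0 < n) :
    n * dual ρ β (tail f) - (softplus (field ρ β (tail f) 1) + β) ≤
      latticeDual ρ β n fun j => tail f (j / n) := by
  have hn0 : (0 : ℝ) < n := by positivity
  have hmono : MonotoneOn (fun x => softplus (field ρ β (tail f) x)) (Icc 0 1) :=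
    softplus_mono.comp_monotoneOn
      (field_monotoneOn hβ hf.tail_intervalIntegrable (fun x hx => (hf.tail_mem hx).1) ρ)
  have h1 := hmono.neg.sum_div_le_mul_integral_add hn
  have hsq : AntitoneOn (fun x => tail f x ^ 2) (Icc 0 1) := fun x hx y hy hxy =>
    pow_le_pow_left₀ (hf.tail_mem hy).1 (hf.tail_antitone hx hy hxy) 2
  have h2 := hsq.sum_div_le_mul_integral_add hn
  have h3 : ∑ i ∈ Finset.range n, softplus (field ρ β (tail f) (i / n)) ≤
      ∑ i ∈ Finset.range n,
        softplus (Real.log ρ + 2 * β / n * ∑ j ∈ Finset.range i, tail f (j / n)) := by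
    refine Finset.sum_le_sum fun i hi => softplus_mono ?_
    have h := hf.tail_antitone.mul_integral_le_sum_div hn (Finset.mem_range.1 hi).le
    have e := mul_le_mul_of_nonneg_left h (by positivity : 0 ≤ 2 * β / n)
    have e2 : 2 * β / n * (n * ∫ x in (0 : ℝ)..i / n, tail f x) =
        2 * β * ∫ x in (0 : ℝ)..i / n, tail f x := by field_simp
    rw [e2] at e
    unfold field
    linarith
  simp only [intervalIntegral.integral_neg, Finset.sum_neg_distrib] at h1
  have h4 : tail f 0 ^ 2 - tail f 1 ^ 2 ≤ 1 := by
    have := pow_le_one₀ (n := 2) (hf.tail_mem zero_mem_unit).1 (hf.tail_mem zero_mem_unit).2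
    nlinarith [sq_nonneg (tail f 1)]
  have h5 := softplus_pos (field ρ β (tail f) 0)
  have h6 : ∑ i ∈ Finset.range n, tail f (i / n) ^ 2 ≤
      n * (∫ x in (0 : ℝ)..1, tail f x ^ 2) + 1 := by linarith
  have h7 := mul_le_mul_of_nonneg_left h6 hβ
  unfold latticeDual dual
  linarith

/-! ### The Lyapunov exponent -/

lemma partitionSum_pos {ρ : ℝ} (hρ : 0 < ρ) (β : ℝ) (n : ℕ) : 0 < partitionSum ρ β n :=
  Finset.sum_pos (fun S _ => by unfold weight; positivity) ⟨∅, by simp⟩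

lemma growthRate_eq {x₀ τ ρ β : ℝ} (hx₀ : 0 < x₀) (hτ : 0 < τ) (hρ : 0 < ρ) (hβ : 0 < β) {n : ℕ}
    (hn : 0 < n) :
    growthRate x₀ τ ρ β n = Real.log x₀ / n + Real.log (partitionSum ρ β n) / n := by
  rw [growthRate, integral_state hτ hβ hn,
    Real.log_mul hx₀.ne' (partitionSum_pos hρ β n).ne']
  ring

theorem tendsto_growthRate {x₀ τ ρ β : ℝ} (hx₀ : 0 < x₀) (hτ : 0 < τ) (hρ : 0 < ρ) (hβ : 0 < β) :
    Tendsto (growthRate x₀ τ ρ β) atTop (𝓝 (value ρ β)) := by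
  have hdiv : ∀ C : ℝ, Tendsto (fun n : ℕ => C / (n : ℝ)) atTop (𝓝 0) := fun C =>
    tendsto_const_div_atTop_nhds_zero_nat C
  refine tendsto_order.2 ⟨fun a ha => ?_, fun a ha => ?_⟩
  · obtain ⟨f, hf, hfa⟩ := exists_lt_functional ha
    have hda := hfa.trans_le (functional_le_dual hf ρ β)
    set C := Real.log x₀ - (softplus (field ρ β (tail f) 1) + β) - β with hC
    have hlim : Tendsto (fun n : ℕ => dual ρ β (tail f) + C / (n : ℝ)) atTop
        (𝓝 (dual ρ β (tail f) + 0)) := (hdiv C).const_add _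
    rw [add_zero] at hlim
    filter_upwards [hlim.eventually_const_lt hda, eventually_gt_atTop 0] with n h1 hn
    refine h1.trans_le ?_
    have hn0 : (0 : ℝ) < n := by positivity
    have h2 := (Real.le_log_iff_exp_le (partitionSum_pos hρ β n)).2
      (exp_latticeDual_le_partitionSum hρ hβ hn fun j => tail f (j / n))
    have h3 := hf.le_latticeDual hβ.le ρ hn
    rw [growthRate_eq hx₀ hτ hρ hβ hn, ← add_div, le_div_iff₀ hn0, add_mul,
      div_mul_cancel₀ _ hn0.ne', hC]
    linarith
  · have hm : Tendsto (fun m : ℕ => 4 * β / (m : ℝ) ^ 2 + value ρ β) atTop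
        (𝓝 (0 + value ρ β)) :=
      (tendsto_const_nhds.div_atTop
        ((tendsto_pow_atTop two_ne_zero).comp tendsto_natCast_atTop_atTop)).add_const _
    rw [zero_add] at hm
    obtain ⟨m, hma, hm0⟩ := ((hm.eventually_lt_const ha).and (eventually_gt_atTop 0)).exists
    set C := Real.log x₀ + m * Real.log (m + 1) with hC
    have hlim : Tendsto (fun n : ℕ => C / (n : ℝ) + (4 * β / (m : ℝ) ^ 2 + value ρ β)) atTop
        (𝓝 (0 + (4 * β / (m : ℝ) ^ 2 + value ρ β))) := (hdiv C).add_const _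
    rw [zero_add] at hlim
    filter_upwards [hlim.eventually_lt_const hma, eventually_ge_atTop m] with n h1 hn
    refine lt_of_le_of_lt ?_ h1
    have hn1 : 0 < n := hm0.trans_le hn
    have hn0 : (0 : ℝ) < n := by positivity
    have h2 := (Real.log_le_iff_le_exp (partitionSum_pos hρ β n)).2
      (partitionSum_le hρ hβ hm0 hn fun c hc => latticeDual_le hβ.le ρ hn1 hc)
    rw [growthRate_eq hx₀ hτ hρ hβ hn1, ← add_div, div_le_iff₀ hn0, add_mul,
      div_mul_cancel₀ _ hn0.ne', hC]
    linarith

lemma agreesWithValue_lyapunov {x₀ τ : ℝ} (hx₀ : 0 < x₀) (hτ : 0 < τ) :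
    AgreesWithValue (lyapunov x₀ τ) := fun _ _ hρ hβ =>
  (tendsto_growthRate hx₀ hτ hρ hβ).limUnder_eq

end LinRec

theorem mainTheorem7 (x₀ τ : ℝ) (hx₀ : 0 < x₀) (hτ : 0 < τ) :
    -- the Lyapunov exponent exists
    (∀ ρ β : ℝ, 0 < ρ → 0 < β →
      Tendsto (LinRec.growthRate x₀ τ ρ β) atTop (𝓝 (LinRec.lyapunov x₀ τ ρ β))) ∧
    -- the slope of the transition curve
    (∀ (J : Set ℝ) (βcr : ℝ → ℝ),
      LinRec.IsTransitionCurve (LinRec.lyapunov x₀ τ) J βcr →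
      ∀ ρ ∈ J, ∃ d₁ d₂ R₁ R₂ B₁ B₂ : ℝ,
        0 < d₁ ∧ d₁ < d₂ ∧ d₂ < 1 ∧
        LinRec.optimalDensities ρ (βcr ρ) = {d₁, d₂} ∧
        -- below the curve is the phase of `d₁`, above it is the phase of `d₂`
        (∀ ε > 0, ∀ᶠ p in LinRec.belowCurve βcr ρ,
          ∀ d ∈ LinRec.optimalDensities p.1 p.2, |d - d₁| < ε) ∧
        (∀ ε > 0, ∀ᶠ p in LinRec.aboveCurve βcr ρ,
          ∀ d ∈ LinRec.optimalDensities p.1 p.2, |d - d₂| < ε) ∧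
        -- near the curve, off it, the partial derivatives exist
        (∀ᶠ p in LinRec.belowCurve βcr ρ ⊔ LinRec.aboveCurve βcr ρ,
          DifferentiableAt ℝ (fun r => LinRec.lyapunov x₀ τ r p.2) p.1 ∧
          DifferentiableAt ℝ (fun b => LinRec.lyapunov x₀ τ p.1 b) p.2) ∧
        -- one-sided values of the partial derivatives in the two phases
        Tendsto (LinRec.partialRho (LinRec.lyapunov x₀ τ)) (LinRec.belowCurve βcr ρ) (𝓝 R₁) ∧
        Tendsto (LinRec.partialRho (LinRec.lyapunov x₀ τ)) (LinRec.aboveCurve βcr ρ) (𝓝 R₂) ∧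
        Tendsto (LinRec.partialBeta (LinRec.lyapunov x₀ τ)) (LinRec.belowCurve βcr ρ) (𝓝 B₁) ∧
        Tendsto (LinRec.partialBeta (LinRec.lyapunov x₀ τ)) (LinRec.aboveCurve βcr ρ) (𝓝 B₂) ∧
        B₂ - B₁ ≠ 0 ∧
        HasDerivAt βcr (-((R₂ - R₁) / (B₂ - B₁))) ρ ∧
        -((R₂ - R₁) / (B₂ - B₁)) = -(2 / (ρ * (d₁ + d₂)))) ∧
    -- the critical point: transitions occur arbitrarily close to `ρ_c`, and the two optimizers merge
    IsLUB LinRec.nonmonotoneSet LinRec.criticalRho ∧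
    (∃ᶠ ρ in 𝓝[<] LinRec.criticalRho,
      ∃ β, 0 < β ∧ LinRec.FirstOrderTransition (LinRec.lyapunov x₀ τ) (ρ, β)) ∧
    (∀ ε > 0, ∃ δ > 0, ∀ ρ β : ℝ, 0 < ρ → 0 < β → |ρ - LinRec.criticalRho| < δ →
      LinRec.FirstOrderTransition (LinRec.lyapunov x₀ τ) (ρ, β) →
      ∀ d₁ ∈ LinRec.optimalDensities ρ β, ∀ d₂ ∈ LinRec.optimalDensities ρ β,
        |d₂ - d₁| < ε) := by
  have hL := LinRec.agreesWithValue_lyapunov hx₀ hτ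
  refine ⟨fun ρ β hρ hβ => ?_, fun J βcr hcurve ρ hρ => LinRec.clausius_clapeyron hL hcurve hρ,
    LinRec.isLUB_criticalRho, ?_, fun ε hε => ?_⟩
  · rw [hL ρ β hρ hβ]
    exact LinRec.tendsto_growthRate hx₀ hτ hρ hβ
  · refine LinRec.frequently_mem_nonmonotoneSet.mono fun ρ hρ => ?_
    obtain ⟨β, hβ, h⟩ := LinRec.exists_not_subsingleton hρ
    exact ⟨β, hβ, (LinRec.firstOrderTransition_iff hL hρ.1 hβ).2 h⟩
  · obtain ⟨δ, hδ, h⟩ := Metric.eventually_nhds_iff.1 (LinRec.eventually_optimalDensities_merge hε)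
    exact ⟨δ, hδ, fun ρ β _ hβ hdist _ => h (by rwa [Real.dist_eq]) β hβ⟩
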